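/- **Notation.** Let $R\ge 2$ and $N_{R^{-1}}(\mathcal P)=\{(t,t^2+\eta): |t|\le 1,\ |\eta|\le R^{-1}\}\subset\mathbb R^2$. Fourier transforms are normalized by $\hat g(\xi)=\int g(x)e^{-ix\cdot\xi}\,dx$ and taken in the sense of tempered distributions; all functions $f, f_\theta$ below are measurable functions $g:\mathbb R^2\to\mathbb C$ with $\int |g(x)|(1+|x|)^{-N}dx<\infty$ for some $N$. *Blocks.* For $0<s\le 1$ and $c\in\mathbb R$ let $\tau_{s,c}$ be the image of $[-1,1]\times[-2,2]$ under $(u,v)\mapsto (c,c^2)+(su,\,2csu+s^2v)$. The blocks of scale $s$ are the $\tau_{s,c}$ with $c=sm$, $m\in\mathbb Z$, $|m|\le\lceil s^{-1}\rceil$; they cover $N_{s^2}(\mathcal P)$ with bounded overlap. The blocks of scale $R^{-1/2}$ are denoted by $\theta$. *Tubes.* For a block $\tau=\tau_{s,c}$ let $$L_\tau=\begin{pmatrix}s^{-1}&-2cs^{-2}\\0&s^{-2}\end{pmatrix},\qquad q=[-\tfrac12,\tfrac12]^2,$$ $$\mathbb T_\tau=\{L_\tau(z+q):z\in\mathbb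 Z^2\},\qquad \mathbb U_\tau=\{Rs^2\cdot T:T\in\mathbb T_\tau\}.$$ Let $\mathbb U$ be the (disjoint) union of the families $\mathbb U_\tau$ over all blocks $\tau$ of all dyadic scales $s=2^{-j}$, $j\in\mathbb{N}_0$, $R^{-1/2}\le s\le 1$; write $\tau(U)=\tau$ for $U\in\mathbb U_\tau$. *Weight parameters.* For measurable $H:\mathbb R^2\to[0,1]$ write $H(E)=\int_E H\,dx$, and for $U\in\mathbb U$ and $2\le p\le 4$ put $$\kappa_{p,H}(U)=\max_{T\in\mathbb T_{\tau(U)}}\Big(\frac{H(T\cap U)}{|T|}\Big)^{\frac14}\Big(\frac{H(U)}{|U|}\Big)^{\frac1p-\frac14}.$$ **Theorem.** There is an absolute constant $A$ and, for every $2\le p\le 4$, a constant $C_p$ depending only on $p$ such that the following holds for all $R\ge 2$ and all measurable $H:\mathbb R^2\to[0,1]$. Let $\hat f$ be supported in $N_{R^{-1}}(\mathcal P)$, and let $f=\sum_\theta f_\theta$ almost everywhere, where $\theta$ runs over the blocks of scale $R^{-1/2}$ and each $\hat f_\theta$ is supported in $\theta$. Then $$\|f\|_{L^p(H\,dx)}\le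 C_p(\log R)^{A}\Big(\sup_{U\in\mathbb U}\kappa_{p,H}(U)+R^{-100}\Big)\Big\|\Big(\sum_\theta|f_\theta|^2\Big)^{1/2}\Big\|_{L^p(\mathbb R^2)}.$$ -/

import Mathlib

open MeasureTheory
open scoped SchwartzMap FourierTransform Pointwise ENNReal

noncomputable section

namespace WeightedSquare

/-- The Euclidean plane. -/
abbrev Plane : Type := EuclideanSpace ℝ (Fin 2)

/-- The vertical `r`-neighbourhood `{(t, t² + η) : |t| ≤ 1, |η| ≤ r}` of the truncated parabola. -/
def parabolaNhd (r : ℝ) : Set Plane :=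
  {ξ | |ξ 0| ≤ 1 ∧ |ξ 1 - ξ 0 ^ 2| ≤ r}

/-- The canonical block of dimensions `s × s²` centred at `(c, c²)`: the image of
`[-1,1] × [-2,2]` under `(u, v) ↦ (c, c²) + (s u, 2 c s u + s² v)`. -/
def block (s c : ℝ) : Set Plane :=
  {ξ | ∃ u v : ℝ, |u| ≤ 1 ∧ |v| ≤ 2 ∧
    ξ 0 = c + s * u ∧ ξ 1 = c ^ 2 + (2 * c * s * u + s ^ 2 * v)}

/-- The blocks of scale `s` are centred over the points `c = s m`, `m ∈ blockIndices s`. -/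
def blockIndices (s : ℝ) : Finset ℤ := Finset.Icc (-⌈s⁻¹⌉) ⌈s⁻¹⌉

/-- The linear map of the parabolic rescaling attached to the block of scale `s` and centre
`(c, c²)`. -/
def rescaling (s c : ℝ) : Plane →ₗ[ℝ] Plane :=
  Matrix.toLpLin 2 2 !![s⁻¹, -2 * c * (s ^ 2)⁻¹; 0, (s ^ 2)⁻¹]

/-- The closed unit square centred at the lattice point `z`. -/
def unitSquare (z : Fin 2 → ℤ) : Set Plane :=
  {x | ∀ i, |x i - z i| ≤ 1 / 2}

/-- The tiling of the plane by translates of the parallelogram dual to a block. -/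
def tubes (s c : ℝ) : Set (Set Plane) :=
  Set.range fun z : Fin 2 → ℤ => rescaling s c '' unitSquare z

/-- The tiling of the plane by the `R s²`-dilates of the tubes. -/
def envelopes (R s c : ℝ) : Set (Set Plane) :=
  {U | ∃ T ∈ tubes s c, U = (R * s ^ 2) • T}

/-- The dyadic scales `s` with `R^{-1/2} ≤ s ≤ 1`. -/
def scales (R : ℝ) : Set ℝ :=
  {s | (∃ j : ℕ, s = (1 / 2 : ℝ) ^ j) ∧ (√R)⁻¹ ≤ s}

/-- `κ_{p,H}(U)` for an envelope `U` attached to the block of scale `s` and centre `(c, c²)`.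
Tubes lying in `U` contribute the mean of `H` over the tube. A tube crossing the boundary of `U`
contributes through its part in `U`, so that all of `U` is seen also when the tubes contained in
`U` do not cover `U`. -/
def kappa (p : ℝ) (H : Plane → ℝ) (s c : ℝ) (U : Set Plane) : ℝ :=
  ⨆ T : tubes s c,
    ((∫ x in (T : Set Plane) ∩ U, H x) / volume.real (T : Set Plane)) ^ (1 / 4 : ℝ) *
      ((∫ x in U, H x) / volume.real U) ^ (1 / p - 1 / 4)

/-- The supremum of `κ_{p,H}(U)` over all envelopes of all blocks of all dyadic scales. -/
def kappaSup (p : ℝ) (H : Plane → ℝ) (R : ℝ) : ℝ :=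
  sSup {k | ∃ s ∈ scales R, ∃ m ∈ blockIndices s, ∃ U ∈ envelopes R s (s * m),
    k = kappa p H s (s * m) U}

/-- A (measurable) function of at most polynomial growth in the mean, so that it defines a
tempered distribution. -/
def IsTempered (g : Plane → ℂ) : Prop :=
  ∃ N : ℕ, Integrable fun x => (((1 + ‖x‖) ^ N)⁻¹ : ℝ) • g x

/-- The distributional Fourier transform of `g`, in the normalization
`ĝ(ξ) = ∫ g(x) exp(-i x·ξ) dx`: it sends `φ` to `∫ g φ̂`, and `φ̂(x) = 𝓕 φ (x / 2π)`. -/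
def fourierDistribution (g : Plane → ℂ) (φ : 𝓢(Plane, ℂ)) : ℂ :=
  ∫ x, g x * 𝓕 φ ((2 * Real.pi)⁻¹ • x)

/-- `g` is a tempered function whose Fourier transform is supported in the closed set `K`. -/
def HasFourierSupportIn (g : Plane → ℂ) (K : Set Plane) : Prop :=
  IsTempered g ∧ Distribution.IsVanishingOn (fourierDistribution g) Kᶜ

/-- `f = ∑_θ f_θ`, where `θ` runs over the blocks of scale `R^{-1/2}` and the Fourier transform of
`f_θ` is supported in `θ`. -/
def IsBlockDecomposition (R : ℝ) (f : Plane → ℂ) (fθ : ℤ → Plane → ℂ) : Prop :=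
  (∀ m ∈ blockIndices (√R)⁻¹, HasFourierSupportIn (fθ m) (block (√R)⁻¹ ((√R)⁻¹ * m))) ∧
    ∀ᵐ x, f x = ∑ m ∈ blockIndices (√R)⁻¹, fθ m x

/-- The square function `(∑_θ |f_θ|²)^{1/2}`. -/
def squareFunction (R : ℝ) (fθ : ℤ → Plane → ℂ) (x : Plane) : ℝ :=
  √(∑ m ∈ blockIndices (√R)⁻¹, ‖fθ m x‖ ^ 2)

end WeightedSquare

end

/-! Write r = R^{-1/2}. The proof reduces the sum over blocks to products of two transversal pieces,
and proves the weighted bound for each product by an L² argument in coordinates where the pair has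
unit size.

Reduction. Group the block indices into dyadic intervals of length 2^i. A broad-narrow induction
over adjacent pairs of intervals (`norm_sum_le_broad_narrow`) bounds |f| by O(n) times the largest
of two kinds of quantities: the sums over intervals of four blocks, and the square roots of |F_A
F_B| for intervals A, B of equal length at distance two or three. Here n = O(log R) is the number of
levels. Running the induction with ε = 1/n keeps the accumulated factor (1 + 2/n)^n bounded.

One pair. Let s be a dyadic scale comparable to the length of A and B, and c a nearby block centre.
The parabolic rescaling carries the parabola near (c, c²) to the parabola near the origin. Tubes
become unit squares, and envelopes become cells of side ρ⁻¹, where ρ = (r/s)². Multiplying by a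
smooth bump adapted to a cell blurs frequencies only by O(ρ), so the blocks remain in
O(ρ)-neighbourhoods of the parabola (`localized_spec`, `block_rescaled`). Transversality then makes
the fibres of the sum map have area O(ρ²) (`fibre_close`), which is the gain in the bilinear L²
estimate `lintegral_enorm_sq_mul_le`; boundedly overlapping supports give orthogonality inside each
factor. The product has bounded frequency, so a weight enters only through its largest mass M on
unit squares (`exists_lintegral_weight_le`). With S = Σ|f_θ|² over the two pieces and ψ the bump of
the cell, this gives ∫ |F_A F_B|² H ≲ M ρ² (∫ S ψ²)² over the cell.

From L² to L^p. Let h be the mass of H on the cell. Hölder in H passes from exponent 2 to p/2 at the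
cost h^{1-p/4}, and Hölder in ψ² replaces (∫ S ψ²)^{p/2} by ∫ S^{p/2} ψ². All powers of ρ cancel,
and what remains is M^{p/4}(ρ²h)^{1-p/4}. Since ρ²h is the mean of H on the envelope and M is
governed by its tube averages, this is exactly κ^p (`exists_mass_bound`, `kappaSup_bound`).

Summation. The squared bumps have bounded sum over cells. Over the intervals of one level, p/2 ≥ 1
allows the p/2-th powers to be summed into the full square function. The levels cost another O(log
R), so A = 2 suffices. -/

namespace WeightedSquare

/-! ### Fourier inversion, Plancherel, and bilinear L² estimates for integrable functions. -/

section Fourier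

variable {V : Type*} [NormedAddCommGroup V] [InnerProductSpace ℝ V] [FiniteDimensional ℝ V]
  [MeasurableSpace V] [BorelSpace V]

lemma integral_fourier_mul_eq_flip {f g : V → ℂ} (hf : Integrable f) (hg : Integrable g) :
    ∫ ξ, 𝓕 f ξ * g ξ = ∫ x, f x * 𝓕 g x := by
  have h := VectorFourier.integral_fourierIntegral_smul_eq_flip (L := innerₗ V)
    (μ := volume) (ν := volume) Real.continuous_fourierChar continuous_inner hf hg
  rw [flip_innerₗ] at h
  exact h

lemma integral_fourierInv_mul_eq_flip {f g : V → ℂ} (hf : Integrable f) (hg : Integrable g) :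
    ∫ ξ, 𝓕⁻ f ξ * g ξ = ∫ x, f x * 𝓕⁻ g x := by
  have h := integral_fourier_mul_eq_flip hf.comp_neg hg
  rw [Real.fourierInv_eq_fourier_comp_neg, h, ← integral_neg_eq_self]
  simp [Real.fourierInv_eq_fourier_neg]

lemma continuous_fourier {f : V → ℂ} (hf : Integrable f) : Continuous (𝓕 f) :=
  VectorFourier.fourierIntegral_continuous Real.continuous_fourierChar
    (L := innerₗ V) continuous_inner hf

lemma continuous_fourierInv {f : V → ℂ} (hf : Integrable f) : Continuous (𝓕⁻ f) := by
  have : 𝓕⁻ f = fun x => 𝓕 f (-x) := funext (Real.fourierInv_eq_fourier_neg f)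
  rw [this]
  exact (continuous_fourier hf).comp continuous_neg

lemma norm_fourier_le (f : V → ℂ) (x : V) : ‖𝓕 f x‖ ≤ ∫ v, ‖f v‖ :=
  VectorFourier.norm_fourierIntegral_le_integral_norm _ _ _ _ _

lemma norm_fourierInv_le (f : V → ℂ) (x : V) : ‖𝓕⁻ f x‖ ≤ ∫ v, ‖f v‖ := by
  rw [Real.fourierInv_eq_fourier_neg]; exact norm_fourier_le f _

/-- Fourier inversion for integrable functions with integrable Fourier transform. -/
lemma ae_eq_fourierInv_fourier {f : V → ℂ} (hf : Integrable f) (hF : Integrable (𝓕 f)) :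
    f =ᵐ[volume] 𝓕⁻ (𝓕 f) := by
  -- With no continuity of `f` available, the identity is tested against smooth compactly supported
  -- functions: two applications of the multiplication formula move both transforms onto the test
  -- function, where Schwartz inversion applies.
  refine ae_eq_of_integral_contDiff_smul_eq hf.locallyIntegrable
    (continuous_fourierInv hF).locallyIntegrable fun g hg hgc => ?_
  have hc : HasCompactSupport (fun x => (g x : ℂ)) := hgc.comp_left Complex.ofReal_zero
  have hd : ContDiff ℝ ((⊤ : ℕ∞) : WithTop ℕ∞) (fun x => (g x : ℂ)) :=
    Complex.ofRealCLM.contDiff.comp hg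
  set φ : 𝓢(V, ℂ) := hc.toSchwartzMap hd with hφ
  have hφg : ∀ x, φ x = g x := fun x => rfl
  have h1 : ∫ x, 𝓕⁻ (𝓕 f) x * φ x = ∫ x, 𝓕 f x * 𝓕⁻ (φ : V → ℂ) x :=
    integral_fourierInv_mul_eq_flip hF φ.integrable
  have h2 : ∫ x, 𝓕 f x * 𝓕⁻ (φ : V → ℂ) x = ∫ x, f x * φ x := by
    rw [← SchwartzMap.fourierInv_coe, integral_fourier_mul_eq_flip hf (SchwartzMap.integrable _),
      ← SchwartzMap.fourier_coe, FourierTransform.fourier_fourierInv_eq]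
  simp only [Complex.real_smul]
  simp only [hφg] at h1 h2
  calc ∫ x, (g x : ℂ) * f x = ∫ x, f x * g x := by simp_rw [mul_comm]
    _ = ∫ x, 𝓕⁻ (𝓕 f) x * g x := by rw [h1, h2]
    _ = _ := by simp_rw [mul_comm]

lemma ae_norm_le_of_integrable_fourier {f : V → ℂ} (hf : Integrable f) (hF : Integrable (𝓕 f)) :
    ∀ᵐ x, ‖f x‖ ≤ ∫ v, ‖𝓕 f v‖ := by
  filter_upwards [ae_eq_fourierInv_fourier hf hF] with x hx
  rw [hx]; exact norm_fourierInv_le _ _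

/-- The Plancherel identity for integrable functions with integrable Fourier transform. -/
lemma lintegral_enorm_sq_fourier {f : V → ℂ} (hf : Integrable f) (hF : Integrable (𝓕 f)) :
    ∫⁻ x, ‖𝓕 f x‖ₑ ^ 2 = ∫⁻ x, ‖f x‖ₑ ^ 2 := by
  have hconj : Integrable (fun x => (starRingEnd ℂ) (𝓕 f x)) := by
    refine (hF.norm).mono' (Complex.continuous_conj.comp_aestronglyMeasurable hF.1) ?_
    simp
  -- Both `f` and its transform are integrable and bounded, hence square integrable. This allows the
  -- identity to be proved for Bochner integrals and then transferred.
  have hI : ∀ g : V → ℂ, Integrable g → (∀ᵐ x, ‖g x‖ ≤ ∫ v, ‖𝓕 f v‖ ⊔ ‖f v‖) →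
      ∫⁻ x, ‖g x‖ₑ ^ 2 = ENNReal.ofReal (∫ x, ‖g x‖ ^ 2) := by
    intro g hg hb
    rw [ofReal_integral_eq_lintegral_ofReal]
    · refine lintegral_congr fun x => ?_
      rw [← ofReal_norm, ENNReal.ofReal_pow (norm_nonneg _)]
    · have := (hg.norm).bdd_mul (c := ∫ v, ‖𝓕 f v‖ ⊔ ‖f v‖) hg.norm.1
        (by filter_upwards [hb] with x hx; simpa using hx)
      simpa [pow_two] using this
    · exact Filter.Eventually.of_forall fun x => by positivity
  have hsup : Integrable fun v => ‖𝓕 f v‖ ⊔ ‖f v‖ := hF.norm.sup hf.norm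
  rw [hI _ hF (Filter.Eventually.of_forall fun x => (norm_fourier_le f x).trans
      (integral_mono hf.norm hsup fun v => le_sup_right)),
    hI _ hf ((ae_norm_le_of_integrable_fourier hf hF).mono fun x hx => hx.trans
      (integral_mono hF.norm hsup fun v => le_sup_left))]
  congr 1
  -- The multiplication formula is paired with the conjugate of the transform of `f`, whose own
  -- transform is the conjugate of `f` almost everywhere by inversion.
  have h := integral_fourier_mul_eq_flip hf hconj
  have h3 : ∀ x, 𝓕 (fun x => (starRingEnd ℂ) (𝓕 f x)) x = (starRingEnd ℂ) (𝓕⁻ (𝓕 f) x) := by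
    intro x
    rw [Real.fourier_eq', Real.fourierInv_eq', ← integral_conj]
    refine integral_congr_ae (Filter.Eventually.of_forall fun v => ?_)
    simp only [smul_eq_mul, map_mul, ← Complex.exp_conj, Complex.conj_ofReal, Complex.conj_I]
    congr 2
    push_cast; ring
  simp_rw [h3] at h
  have h4 : ∫ x, f x * (starRingEnd ℂ) (𝓕⁻ (𝓕 f) x) = ∫ x, f x * (starRingEnd ℂ) (f x) := by
    refine integral_congr_ae ?_
    filter_upwards [ae_eq_fourierInv_fourier hf hF] with x hx
    rw [← hx]
  rw [h4] at h
  simp_rw [Complex.mul_conj, Complex.normSq_eq_norm_sq] at h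
  rw [integral_complex_ofReal, integral_complex_ofReal] at h
  exact_mod_cast h

/-- The Fourier transform of a product is a convolution. -/
lemma fourier_mul_eq {f g : V → ℂ} (hf : Integrable f) (hF : Integrable (𝓕 f))
    (hg : Integrable g) (ξ : V) :
    𝓕 (fun x => f x * g x) ξ = ∫ ζ, 𝓕 f ζ * 𝓕 g (ξ - ζ) := by
  have hgi : Integrable (fun x => Real.fourierChar (-inner ℝ x ξ) • g x) := by
    simpa using hg
  have h := integral_fourierInv_mul_eq_flip hF hgi
  have h2 : ∀ ζ, 𝓕⁻ (fun x => Real.fourierChar (-inner ℝ x ξ) • g x) ζ = 𝓕 g (ξ - ζ) := by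
    intro ζ
    rw [Real.fourierInv_eq, Real.fourier_eq]
    refine integral_congr_ae (Filter.Eventually.of_forall fun v => ?_)
    simp only [smul_smul, ← AddChar.map_add_eq_mul, inner_sub_right]
    congr 2; ring
  simp_rw [h2] at h
  rw [← h, Real.fourier_eq]
  refine integral_congr_ae ?_
  filter_upwards [ae_eq_fourierInv_fourier hf hF] with x hx
  rw [← hx]
  simp only [Circle.smul_def, smul_eq_mul]; ring

lemma integrable_mul_of_fourier {f g : V → ℂ} (hf : Integrable f) (hF : Integrable (𝓕 f))
    (hg : Integrable g) : Integrable (fun x => f x * g x) :=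
  hg.bdd_mul hf.1 (ae_norm_le_of_integrable_fourier hf hF)

lemma integrable_fourier_mul {f g : V → ℂ} (hf : Integrable f) (hF : Integrable (𝓕 f))
    (hg : Integrable g) (hG : Integrable (𝓕 g)) : Integrable (𝓕 (fun x => f x * g x)) := by
  have h := MeasureTheory.Integrable.integrable_convolution (ContinuousLinearMap.mul ℂ ℂ) hF hG
  refine h.congr (Filter.Eventually.of_forall fun ξ => ?_)
  rw [fourier_mul_eq hf hF hg]
  rfl

/-- A bilinear `L²` estimate: the product is controlled by the measure of the fibres of the
sumset of the Fourier supports. -/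
lemma lintegral_enorm_sq_mul_le {f g : V → ℂ} (hf : Integrable f) (hF : Integrable (𝓕 f))
    (hg : Integrable g) (hG : Integrable (𝓕 g)) {δ : ℝ≥0∞}
    (hδ : ∀ ξ, volume {ζ | 𝓕 f ζ ≠ 0 ∧ 𝓕 g (ξ - ζ) ≠ 0} ≤ δ) :
    ∫⁻ x, ‖f x * g x‖ₑ ^ 2 ≤ δ * ((∫⁻ x, ‖f x‖ₑ ^ 2) * ∫⁻ x, ‖g x‖ₑ ^ 2) := by
  rw [← lintegral_enorm_sq_fourier (integrable_mul_of_fourier hf hF hg)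
    (integrable_fourier_mul hf hF hg hG), ← lintegral_enorm_sq_fourier hf hF,
    ← lintegral_enorm_sq_fourier hg hG]
  have cF := (continuous_fourier hf)
  have cG := (continuous_fourier hg)
  have hpt : ∀ ξ, ‖𝓕 (fun x => f x * g x) ξ‖ₑ ^ 2 ≤
      δ * ∫⁻ ζ, ‖𝓕 f ζ‖ₑ ^ 2 * ‖𝓕 g (ξ - ζ)‖ₑ ^ 2 := by
    intro ξ
    set S := {ζ | 𝓕 f ζ ≠ 0 ∧ 𝓕 g (ξ - ζ) ≠ 0} with hS
    have hSm : MeasurableSet S := by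
      refine (IsOpen.inter ?_ ?_).measurableSet
      · exact isOpen_ne_fun cF continuous_const
      · exact isOpen_ne_fun (cG.comp (continuous_const.sub continuous_id)) continuous_const
    -- The convolution integrand lives on `S`. Cauchy-Schwarz against the indicator of `S` produces
    -- the factor `volume S ≤ δ`; integrating in `ξ` then decouples the two transforms.
    have h1 : ‖𝓕 (fun x => f x * g x) ξ‖ₑ ≤
        ∫⁻ ζ, (‖𝓕 f ζ‖ₑ * ‖𝓕 g (ξ - ζ)‖ₑ) * S.indicator 1 ζ := by
      rw [fourier_mul_eq hf hF hg]
      refine (enorm_integral_le_lintegral_enorm _).trans (lintegral_mono fun ζ => ?_)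
      by_cases h : ζ ∈ S
      · simp [h, enorm_mul]
      · have : 𝓕 f ζ * 𝓕 g (ξ - ζ) = 0 := by
          simp only [hS, Set.mem_ofPred_eq, not_and_or, not_not] at h
          rcases h with h | h <;> simp [h]
        simp only [this, enorm_zero]; exact zero_le
    have hm1 : Measurable fun ζ => ‖𝓕 f ζ‖ₑ * ‖𝓕 g (ξ - ζ)‖ₑ :=
      cF.enorm.measurable.mul (cG.comp (continuous_const.sub continuous_id)).enorm.measurable
    have h2 := ENNReal.lintegral_mul_norm_pow_le (μ := (volume : Measure V))
      (f := fun ζ => (‖𝓕 f ζ‖ₑ * ‖𝓕 g (ξ - ζ)‖ₑ) ^ 2) (g := fun ζ => S.indicator 1 ζ)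
      (hm1.pow_const 2).aemeasurable (measurable_one.indicator hSm).aemeasurable
      (p := 1 / 2) (q := 1 / 2) (by norm_num) (by norm_num) (by norm_num)
    have h3 : ∀ ζ, ((‖𝓕 f ζ‖ₑ * ‖𝓕 g (ξ - ζ)‖ₑ) ^ 2) ^ (1 / 2 : ℝ) *
        (S.indicator (1 : V → ℝ≥0∞) ζ) ^ (1 / 2 : ℝ) =
        (‖𝓕 f ζ‖ₑ * ‖𝓕 g (ξ - ζ)‖ₑ) * S.indicator 1 ζ := by
      intro ζ
      congr 1
      · rw [← ENNReal.rpow_natCast, ← ENNReal.rpow_mul]; norm_num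
      · by_cases h : ζ ∈ S <;> simp [h]
    simp_rw [h3] at h2
    have h4 := h1.trans h2
    calc _ ≤ (_ : ℝ≥0∞) ^ 2 := pow_le_pow_left' h4 2
      _ = (∫⁻ ζ, (‖𝓕 f ζ‖ₑ * ‖𝓕 g (ξ - ζ)‖ₑ) ^ 2) * ∫⁻ ζ, S.indicator 1 ζ := by
        rw [mul_pow, ← ENNReal.rpow_natCast, ← ENNReal.rpow_natCast, ← ENNReal.rpow_mul,
          ← ENNReal.rpow_mul]
        norm_num
      _ ≤ (∫⁻ ζ, (‖𝓕 f ζ‖ₑ * ‖𝓕 g (ξ - ζ)‖ₑ) ^ 2) * δ := by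
        gcongr
        rw [lintegral_indicator_one hSm]; exact hδ ξ
      _ = _ := by rw [mul_comm]; simp_rw [mul_pow]
  have hmeas : Measurable fun q : V × V => ‖𝓕 f q.2‖ₑ ^ 2 * ‖𝓕 g (q.1 - q.2)‖ₑ ^ 2 :=
    ((cF.comp continuous_snd).enorm.measurable.pow_const 2).mul
      ((cG.comp (continuous_fst.sub continuous_snd)).enorm.measurable.pow_const 2)
  calc _ ≤ ∫⁻ ξ, δ * ∫⁻ ζ, ‖𝓕 f ζ‖ₑ ^ 2 * ‖𝓕 g (ξ - ζ)‖ₑ ^ 2 := lintegral_mono hpt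
    _ = δ * ∫⁻ ξ, ∫⁻ ζ, ‖𝓕 f ζ‖ₑ ^ 2 * ‖𝓕 g (ξ - ζ)‖ₑ ^ 2 :=
        lintegral_const_mul _ hmeas.lintegral_prod_right'
    _ = δ * ∫⁻ ζ, ∫⁻ ξ, ‖𝓕 f ζ‖ₑ ^ 2 * ‖𝓕 g (ξ - ζ)‖ₑ ^ 2 := by
        rw [lintegral_lintegral_swap hmeas.aemeasurable]
    _ = δ * ∫⁻ ζ, ‖𝓕 f ζ‖ₑ ^ 2 * ∫⁻ ξ, ‖𝓕 g ξ‖ₑ ^ 2 := by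
        congr 1
        refine lintegral_congr fun ζ => ?_
        rw [lintegral_const_mul' _ _ (by simp),
          lintegral_sub_right_eq_self (fun ξ => ‖𝓕 g ξ‖ₑ ^ 2) ζ]
    _ = _ := by rw [lintegral_mul_const _ (cF.enorm.measurable.pow_const 2)]

/-- Supplies the integrability of the transform required by the preceding lemmas; in the application
it comes from the bounded frequency support. -/
lemma integrable_fourier_of_compactSupport {f : V → ℂ} (hf : Integrable f) {r : ℝ}
    (h : ∀ ζ, r < ‖ζ‖ → 𝓕 f ζ = 0) : Integrable (𝓕 f) := by
  refine (continuous_fourier hf).integrable_of_hasCompactSupport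
    (HasCompactSupport.intro (isCompact_closedBall (0 : V) r) fun x hx => h x ?_)
  simpa using hx

lemma fourier_finset_sum {ι : Type*} (s : Finset ι) (g : ι → V → ℂ)
    (hg : ∀ i ∈ s, Integrable (g i)) (ζ : V) :
    𝓕 (fun x => ∑ i ∈ s, g i x) ζ = ∑ i ∈ s, 𝓕 (g i) ζ := by
  simp_rw [Real.fourier_eq, Finset.smul_sum]
  exact integral_finsetSum _ fun i hi => by simpa using hg i hi

/-- Almost orthogonality of functions with boundedly overlapping Fourier supports. -/
lemma lintegral_enorm_sq_sum_le {ι : Type*} (s : Finset ι) (g : ι → V → ℂ)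
    (hg : ∀ i ∈ s, Integrable (g i)) {r : ℝ} (hr : ∀ i ∈ s, ∀ ζ, r < ‖ζ‖ → 𝓕 (g i) ζ = 0)
    (N : ℕ) (hN : ∀ ζ, ∃ t : Finset ι, t ⊆ s ∧ t.card ≤ N ∧ ∀ i ∈ s, i ∉ t → 𝓕 (g i) ζ = 0) :
    ∫⁻ x, ‖∑ i ∈ s, g i x‖ₑ ^ 2 ≤ N * ∑ i ∈ s, ∫⁻ x, ‖g i x‖ₑ ^ 2 := by
  have hsum : Integrable (fun x => ∑ i ∈ s, g i x) := integrable_finsetSum s hg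
  have hFs : Integrable (𝓕 (fun x => ∑ i ∈ s, g i x)) := by
    refine integrable_fourier_of_compactSupport hsum (r := r) fun ζ hζ => ?_
    rw [fourier_finset_sum s g hg]
    exact Finset.sum_eq_zero fun i hi => hr i hi ζ hζ
  have hpt : ∀ ζ, ‖𝓕 (fun x => ∑ i ∈ s, g i x) ζ‖ₑ ^ 2 ≤ N * ∑ i ∈ s, ‖𝓕 (g i) ζ‖ₑ ^ 2 := by
    intro ζ
    obtain ⟨t, hts, hcard, ht⟩ := hN ζ
    rw [fourier_finset_sum s g hg, ← Finset.sum_subset hts ht]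
    have h1 : ‖∑ i ∈ t, 𝓕 (g i) ζ‖ ^ 2 ≤ N * ∑ i ∈ s, ‖𝓕 (g i) ζ‖ ^ 2 := by
      calc ‖∑ i ∈ t, 𝓕 (g i) ζ‖ ^ 2 ≤ (∑ i ∈ t, ‖𝓕 (g i) ζ‖) ^ 2 := by
            gcongr; exact norm_sum_le _ _
        _ ≤ t.card * ∑ i ∈ t, ‖𝓕 (g i) ζ‖ ^ 2 := sq_sum_le_card_mul_sum_sq
        _ ≤ N * ∑ i ∈ s, ‖𝓕 (g i) ζ‖ ^ 2 := by
            gcongr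
    have h2 := ENNReal.ofReal_le_ofReal h1
    rw [ENNReal.ofReal_mul (by positivity), ENNReal.ofReal_sum_of_nonneg (by intros; positivity),
      ENNReal.ofReal_pow (norm_nonneg _), ENNReal.ofReal_natCast] at h2
    simpa only [ENNReal.ofReal_pow (norm_nonneg _), ofReal_norm] using h2
  rw [← lintegral_enorm_sq_fourier hsum hFs]
  calc _ ≤ ∫⁻ ζ, N * ∑ i ∈ s, ‖𝓕 (g i) ζ‖ₑ ^ 2 := lintegral_mono hpt
    _ = N * ∑ i ∈ s, ∫⁻ ζ, ‖𝓕 (g i) ζ‖ₑ ^ 2 := by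
      rw [lintegral_const_mul' _ _ (by simp), lintegral_finsetSum' s]
      intro i hi
      exact ((continuous_fourier (hg i hi)).enorm.measurable.pow_const 2).aemeasurable
    _ = _ := by
      congr 1
      refine Finset.sum_congr rfl fun i hi => lintegral_enorm_sq_fourier (hg i hi) ?_
      exact integrable_fourier_of_compactSupport (hg i hi) (hr i hi)

/-- A function is reproduced by convolution with a kernel whose Fourier transform is `1` on the
Fourier support of the function. -/
lemma ae_eq_convolution {f : V → ℂ} (hf : Integrable f) (hF : Integrable (𝓕 f))
    (K : 𝓢(V, ℂ)) (hK : ∀ ζ, 𝓕 f ζ ≠ 0 → 𝓕 (K : V → ℂ) ζ = 1) :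
    ∀ᵐ x, f x = ∫ v, f v * K (x - v) := by
  have hi := MeasureTheory.Integrable.integrable_convolution (ContinuousLinearMap.mul ℂ ℂ) hf
    (K.integrable (μ := volume))
  -- The convolution has the same transform as `f`, so inversion recovers both from the same
  -- function.
  have hfe : 𝓕 (convolution f K (ContinuousLinearMap.mul ℂ ℂ) volume) = 𝓕 f := by
    ext ζ
    rw [Real.fourier_mul_convolution_eq hf K.integrable]
    by_cases h : 𝓕 f ζ = 0
    · simp [h]
    · rw [hK ζ h, mul_one]
  have h1 := ae_eq_fourierInv_fourier hf hF
  have h2 := ae_eq_fourierInv_fourier hi (hfe ▸ hF)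
  rw [hfe] at h2
  filter_upwards [h1, h2] with x hx1 hx2
  rw [hx1, ← hx2]
  rfl

end Fourier

/-! ### Rapidly decaying kernels, and weights seen through their masses on unit squares. -/

/-- The decaying weight `(1 + |a|)⁻² (1 + |b|)⁻²`. -/
noncomputable def decay (a b : ℝ) : ℝ := ((1 + |a|) ^ 2 * (1 + |b|) ^ 2)⁻¹

lemma decay_nonneg (a b : ℝ) : 0 ≤ decay a b := by unfold decay; positivity

lemma decay_le_one (a b : ℝ) : decay a b ≤ 1 := by
  unfold decay
  refine inv_le_one_of_one_le₀ ?_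
  have h1 : 1 ≤ (1 + |a|) ^ 2 := one_le_pow₀ (by linarith [abs_nonneg a])
  have h2 : 1 ≤ (1 + |b|) ^ 2 := one_le_pow₀ (by linarith [abs_nonneg b])
  nlinarith

lemma decay_le_of_close {a b a' b' : ℝ} (ha : |a - a'| ≤ 1 / 2) (hb : |b - b'| ≤ 1 / 2) :
    decay a b ≤ 6 * decay a' b' := by
  have key : ∀ x y : ℝ, |x - y| ≤ 1 / 2 → 1 + |y| ≤ 3 / 2 * (1 + |x|) := by
    intro x y h
    have := abs_sub_abs_le_abs_sub y x
    rw [abs_sub_comm] at this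
    linarith [abs_nonneg x]
  have h1 := key _ _ ha
  have h2 := key _ _ hb
  unfold decay
  rw [← div_eq_mul_inv, inv_eq_one_div, div_le_div_iff₀ (by positivity) (by positivity), one_mul]
  calc (1 + |a'|) ^ 2 * (1 + |b'|) ^ 2
      ≤ (3 / 2 * (1 + |a|)) ^ 2 * (3 / 2 * (1 + |b|)) ^ 2 := by gcongr
    _ = 81 / 16 * ((1 + |a|) ^ 2 * (1 + |b|) ^ 2) := by ring
    _ ≤ _ := by gcongr; norm_num

lemma exists_tsum_int_decay_le :
    ∃ C : ℝ≥0∞, C ≠ ⊤ ∧ ∀ t : ℝ, ∑' n : ℤ, ENNReal.ofReal (((1 + |t - n|) ^ 2)⁻¹) ≤ C := by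
  have hs : Summable fun m : ℤ => 4 * (1 / (m : ℝ) ^ 2) + (if m = 0 then (1 : ℝ) else 0) := by
    refine Summable.add ((Real.summable_one_div_int_pow.2 (by norm_num)).mul_left 4) ?_
    exact (hasSum_ite_eq (0 : ℤ) (1 : ℝ)).summable
  refine ⟨_, hs.tsum_ofReal_ne_top, fun t => ?_⟩
  -- Translating the index by the integer part leaves only the fractional part of `t`, which makes
  -- the majorant independent of `t`.
  rw [← (Equiv.addRight ⌊t⌋).tsum_eq (fun n : ℤ => ENNReal.ofReal (((1 + |t - n|) ^ 2)⁻¹))]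
  refine ENNReal.tsum_le_tsum fun m => ENNReal.ofReal_le_ofReal ?_
  have h0 := Int.fract_nonneg t
  have h1 := Int.fract_lt_one t
  have h2 : t - ((m + ⌊t⌋ : ℤ) : ℝ) = Int.fract t - m := by
    push_cast; rw [← Int.self_sub_floor]; ring
  simp only [Equiv.coe_addRight, h2]
  rcases eq_or_ne m 0 with rfl | hm
  · simp only [Int.cast_zero, sub_zero, if_true]
    have : ((1 + |Int.fract t|) ^ 2)⁻¹ ≤ 1 :=
      inv_le_one_of_one_le₀ (one_le_pow₀ (by linarith [abs_nonneg (Int.fract t)]))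
    norm_num; exact this
  · rw [if_neg hm, add_zero]
    have hm1 : 1 ≤ |(m : ℝ)| := by exact_mod_cast Int.one_le_abs hm
    have h3 : |(m : ℝ)| ≤ 1 + |Int.fract t - m| := by
      have h := abs_sub_abs_le_abs_sub (m : ℝ) (Int.fract t)
      rw [abs_sub_comm, abs_of_nonneg h0] at h
      linarith
    calc ((1 + |Int.fract t - m|) ^ 2)⁻¹ ≤ (|(m : ℝ)| ^ 2)⁻¹ := by gcongr
      _ = 1 * (1 / (m : ℝ) ^ 2) := by rw [sq_abs]; ring
      _ ≤ _ := by gcongr; norm_num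

lemma exists_tsum_decay_le :
    ∃ C : ℝ≥0∞, C ≠ ⊤ ∧ ∀ a b : ℝ,
      ∑' z : Fin 2 → ℤ, ENNReal.ofReal (decay (a - z 0) (b - z 1)) ≤ C := by
  obtain ⟨C, hC, h⟩ := exists_tsum_int_decay_le
  refine ⟨C * C, ENNReal.mul_ne_top hC hC, fun a b => ?_⟩
  rw [← (finTwoArrowEquiv ℤ).symm.tsum_eq]
  simp only [finTwoArrowEquiv_symm_apply, Matrix.cons_val_zero, Matrix.cons_val_one]
  rw [ENNReal.tsum_prod (f := fun n k : ℤ => ENNReal.ofReal (decay (a - n) (b - k)))]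
  calc _ = ∑' n : ℤ, ∑' k : ℤ, ENNReal.ofReal (((1 + |a - n|) ^ 2)⁻¹) *
        ENNReal.ofReal (((1 + |b - k|) ^ 2)⁻¹) := by
        refine tsum_congr fun n => tsum_congr fun k => ?_
        rw [← ENNReal.ofReal_mul (by positivity), decay, mul_inv]
    _ ≤ C * C := by
        simp_rw [ENNReal.tsum_mul_left, ENNReal.tsum_mul_right]
        gcongr
        · exact h a
        · exact h b

lemma abs_apply_le_norm (x : Plane) (i : Fin 2) : |x i| ≤ ‖x‖ := by
  simpa using PiLp.norm_apply_le x i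

lemma exists_norm_le_decay (K : 𝓢(Plane, ℂ)) :
    ∃ C : ℝ, 0 ≤ C ∧ ∀ x : Plane, ‖K x‖ ≤ C * decay (x 0) (x 1) := by
  refine ⟨2 ^ 4 * (Finset.Iic ((4, 0) : ℕ × ℕ)).sup (fun m => SchwartzMap.seminorm ℝ m.1 m.2) K,
    by positivity, fun x => ?_⟩
  have h := SchwartzMap.one_add_le_sup_seminorm_apply (𝕜 := ℝ) (m := (4, 0)) (k := 4) (n := 0)
    le_rfl le_rfl K x
  rw [norm_iteratedFDeriv_zero] at h
  rw [decay, ← div_eq_mul_inv, le_div_iff₀ (by positivity)]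
  refine le_trans ?_ h
  rw [mul_comm]
  gcongr
  calc (1 + |x 0|) ^ 2 * (1 + |x 1|) ^ 2 ≤ (1 + ‖x‖) ^ 2 * (1 + ‖x‖) ^ 2 := by
        gcongr <;> exact abs_apply_le_norm x _
    _ = (1 + ‖x‖) ^ 4 := by ring

/-- The inverse transform of a smooth bump equal to one on the ball. Convolution with it reproduces
functions of frequency at most `r`, and thus expresses that they are essentially constant at unit
scale for fixed `r`. -/
lemma exists_kernel (r : ℝ) (hr : 0 < r) :
    ∃ K : 𝓢(Plane, ℂ), ∀ ζ : Plane, ‖ζ‖ ≤ r → 𝓕 (K : Plane → ℂ) ζ = 1 := by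
  let b : ContDiffBump (0 : Plane) := ⟨r, r + 1, hr, by linarith⟩
  have hc : HasCompactSupport (fun x => (b x : ℂ)) := b.hasCompactSupport.comp_left
    Complex.ofReal_zero
  have hd : ContDiff ℝ ((⊤ : ℕ∞) : WithTop ℕ∞) (fun x => (b x : ℂ)) :=
    Complex.ofRealCLM.contDiff.comp b.contDiff
  refine ⟨𝓕⁻ (hc.toSchwartzMap hd), fun ζ hζ => ?_⟩
  rw [← SchwartzMap.fourier_coe, FourierTransform.fourier_fourierInv_eq]
  change (b ζ : ℂ) = 1
  rw [b.one_of_mem_closedBall (by simpa using hζ)]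
  simp

lemma iUnion_unitSquare : ⋃ z, unitSquare z = Set.univ := by
  refine Set.eq_univ_of_forall fun x => Set.mem_iUnion.2 ⟨fun i => round (x i), fun i => ?_⟩
  exact abs_sub_round (x i)

lemma isClosed_unitSquare (z : Fin 2 → ℤ) : IsClosed (unitSquare z) := by
  have : unitSquare z = ⋂ i, {x : Plane | |x i - z i| ≤ 1 / 2} := by
    ext; simp [unitSquare]
  rw [this]
  exact isClosed_iInter fun i => isClosed_le (by fun_prop) continuous_const

lemma measurableSet_unitSquare (z : Fin 2 → ℤ) : MeasurableSet (unitSquare z) :=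
  (isClosed_unitSquare z).measurableSet

/-- Averages of a weight against a decaying kernel are controlled by its masses on unit squares. -/
lemma exists_lintegral_kernel_le (K : 𝓢(Plane, ℂ)) :
    ∃ C : ℝ≥0∞, C ≠ ⊤ ∧ ∀ (W : Plane → ℝ≥0∞) (M : ℝ≥0∞),
      (∀ z, ∫⁻ x in unitSquare z, W x ≤ M) →
      ∀ v, ∫⁻ x, ‖K (x - v)‖ₑ * W x ≤ C * M := by
  obtain ⟨B, hB, hK⟩ := exists_norm_le_decay K
  obtain ⟨C, hC, hsum⟩ := exists_tsum_decay_le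
  refine ⟨ENNReal.ofReal (B * 6) * C, ENNReal.mul_ne_top ENNReal.ofReal_ne_top hC,
    fun W M hM v => ?_⟩
  calc ∫⁻ x, ‖K (x - v)‖ₑ * W x = ∫⁻ x in ⋃ z, unitSquare z, ‖K (x - v)‖ₑ * W x := by
        rw [iUnion_unitSquare, setLIntegral_univ]
    _ ≤ ∑' z, ∫⁻ x in unitSquare z, ‖K (x - v)‖ₑ * W x := lintegral_iUnion_le _ _
    _ ≤ ∑' z : Fin 2 → ℤ, ENNReal.ofReal (B * 6) *
          ENNReal.ofReal (decay (v 0 - z 0) (v 1 - z 1)) * M := by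
        refine ENNReal.tsum_le_tsum fun z => ?_
        calc _ ≤ ∫⁻ x in unitSquare z, (ENNReal.ofReal (B * 6) *
              ENNReal.ofReal (decay (v 0 - z 0) (v 1 - z 1))) * W x := by
              refine setLIntegral_mono' (measurableSet_unitSquare z) fun x hx => ?_
              gcongr
              rw [← ofReal_norm, ← ENNReal.ofReal_mul (by positivity)]
              refine ENNReal.ofReal_le_ofReal ((hK _).trans ?_)
              rw [mul_assoc]
              gcongr
              have hsym : decay (v 0 - z 0) (v 1 - z 1) = decay (z 0 - v 0) (z 1 - v 1) := by
                simp only [decay, abs_sub_comm]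
              rw [hsym]
              refine decay_le_of_close ?_ ?_
              · simpa using hx 0
              · simpa using hx 1
          _ = _ := lintegral_const_mul' _ _
              (ENNReal.mul_ne_top ENNReal.ofReal_ne_top ENNReal.ofReal_ne_top)
          _ ≤ _ := by gcongr; exact hM z
    _ = ENNReal.ofReal (B * 6) *
          (∑' z : Fin 2 → ℤ, ENNReal.ofReal (decay (v 0 - z 0) (v 1 - z 1))) * M := by
        rw [ENNReal.tsum_mul_right, ENNReal.tsum_mul_left]
    _ ≤ _ := by gcongr; exact hsum _ _

/-- Functions with bounded Fourier support see a weight only through its masses on unit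
squares. -/
lemma exists_lintegral_weight_le (r : ℝ) (hr : 0 < r) :
    ∃ C : ℝ≥0∞, C ≠ ⊤ ∧ ∀ f : Plane → ℂ, Integrable f → (∀ ζ, r < ‖ζ‖ → 𝓕 f ζ = 0) →
      ∀ W : Plane → ℝ≥0∞, AEMeasurable W → ∀ M : ℝ≥0∞, (∀ z, ∫⁻ x in unitSquare z, W x ≤ M) →
        ∫⁻ x, ‖f x‖ₑ ^ 2 * W x ≤ C * M * ∫⁻ x, ‖f x‖ₑ ^ 2 := by
  obtain ⟨K, hK⟩ := exists_kernel r hr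
  obtain ⟨C, hC, hker⟩ := exists_lintegral_kernel_le K
  have hK1 : ∫⁻ x, ‖K x‖ₑ ≠ ⊤ := (K.integrable (μ := volume)).2.ne
  refine ⟨(∫⁻ x, ‖K x‖ₑ) * C, ENNReal.mul_ne_top hK1 hC, fun f hf hF W hW M hM => ?_⟩
  have hrep := ae_eq_convolution hf (integrable_fourier_of_compactSupport hf hF) K
    (fun ζ h => hK ζ (not_lt.1 fun h' => h (hF ζ h')))
  -- From `f = f * K`, Cauchy-Schwarz with density `|K|` dominates `|f|²` by a multiple of `|f|² *
  -- |K|`. Fubini then moves the averaging onto `W`, where only masses on unit squares matter.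
  have hpt : ∀ᵐ x, ‖f x‖ₑ ^ 2 ≤ (∫⁻ x, ‖K x‖ₑ) * ∫⁻ v, ‖f v‖ₑ ^ 2 * ‖K (x - v)‖ₑ := by
    filter_upwards [hrep] with x hx
    have hKm : Measurable fun v => ‖K (x - v)‖ₑ :=
      (K.continuous.comp (continuous_const.sub continuous_id)).enorm.measurable
    have h1 : ‖f x‖ₑ ≤ ∫⁻ v, ‖f v‖ₑ * ‖K (x - v)‖ₑ := by
      conv_lhs => rw [hx]
      refine (enorm_integral_le_lintegral_enorm _).trans_eq ?_
      simp_rw [enorm_mul]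
    have h2 := ENNReal.lintegral_mul_norm_pow_le (μ := (volume : Measure Plane))
      (f := fun v => ‖f v‖ₑ ^ 2 * ‖K (x - v)‖ₑ) (g := fun v => ‖K (x - v)‖ₑ)
      ((hf.1.enorm.pow_const 2).mul hKm.aemeasurable) hKm.aemeasurable
      (p := 1 / 2) (q := 1 / 2) (by norm_num) (by norm_num) (by norm_num)
    have h3 : ∀ v, (‖f v‖ₑ ^ 2 * ‖K (x - v)‖ₑ) ^ (1 / 2 : ℝ) * ‖K (x - v)‖ₑ ^ (1 / 2 : ℝ) =
        ‖f v‖ₑ * ‖K (x - v)‖ₑ := by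
      intro v
      rw [ENNReal.mul_rpow_of_nonneg _ _ (by norm_num), mul_assoc,
        ← ENNReal.rpow_add_of_nonneg _ _ (by norm_num) (by norm_num),
        ← ENNReal.rpow_natCast, ← ENNReal.rpow_mul]
      norm_num
    simp_rw [h3] at h2
    calc _ ≤ (_ : ℝ≥0∞) ^ 2 := pow_le_pow_left' (h1.trans h2) 2
      _ = (∫⁻ v, ‖f v‖ₑ ^ 2 * ‖K (x - v)‖ₑ) * ∫⁻ v, ‖K (x - v)‖ₑ := by
        rw [mul_pow, ← ENNReal.rpow_natCast, ← ENNReal.rpow_natCast, ← ENNReal.rpow_mul,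
          ← ENNReal.rpow_mul]
        norm_num
      _ = _ := by
        rw [lintegral_sub_left_eq_self (fun v => ‖K v‖ₑ) x, mul_comm]
  have hfe : AEMeasurable (fun x => ‖f x‖ₑ ^ 2) := hf.1.enorm.pow_const 2
  have hmeas : AEMeasurable (fun q : Plane × Plane => ‖f q.2‖ₑ ^ 2 * ‖K (q.1 - q.2)‖ₑ * W q.1)
      (volume.prod volume) := by
    refine AEMeasurable.fun_mul (AEMeasurable.fun_mul ?_ ?_) ?_
    · exact hfe.comp_quasiMeasurePreserving Measure.quasiMeasurePreserving_snd
    · exact (K.continuous.comp (continuous_fst.sub continuous_snd)).enorm.measurable.aemeasurable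
    · exact hW.comp_quasiMeasurePreserving Measure.quasiMeasurePreserving_fst
  calc _ ≤ ∫⁻ x, (∫⁻ x, ‖K x‖ₑ) * ∫⁻ v, ‖f v‖ₑ ^ 2 * ‖K (x - v)‖ₑ * W x := by
        refine lintegral_mono_ae ?_
        filter_upwards [hpt] with x hx
        have hKm : Measurable fun v => ‖K (x - v)‖ₑ :=
          (K.continuous.comp (continuous_const.sub continuous_id)).enorm.measurable
        rw [lintegral_mul_const'' _ (hfe.fun_mul hKm.aemeasurable), ← mul_assoc]
        gcongr
    _ = (∫⁻ x, ‖K x‖ₑ) * ∫⁻ x, ∫⁻ v, ‖f v‖ₑ ^ 2 * ‖K (x - v)‖ₑ * W x :=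
        lintegral_const_mul' _ _ hK1
    _ = (∫⁻ x, ‖K x‖ₑ) * ∫⁻ v, ∫⁻ x, ‖f v‖ₑ ^ 2 * ‖K (x - v)‖ₑ * W x := by
        rw [lintegral_lintegral_swap hmeas]
    _ ≤ (∫⁻ x, ‖K x‖ₑ) * ∫⁻ v, ‖f v‖ₑ ^ 2 * (C * M) := by
        gcongr with v
        simp_rw [mul_assoc]
        rw [lintegral_const_mul' _ _ (by simp)]
        gcongr
        exact hker W M hM v
    _ = _ := by
        rw [lintegral_mul_const'' _ hfe]; ring

/-- The weighted bilinear estimate in normalized coordinates. -/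
lemma exists_lintegral_bilinear_le (r : ℝ) (hr : 0 < r) (N : ℕ) :
    ∃ C : ℝ≥0∞, C ≠ ⊤ ∧ ∀ (A B : Finset ℤ) (g : ℤ → Plane → ℂ) (δ : ℝ≥0∞),
      (∀ m ∈ A ∪ B, Integrable (g m)) →
      (∀ m ∈ A ∪ B, ∀ ζ, r < ‖ζ‖ → 𝓕 (g m) ζ = 0) →
      (∀ ζ, ∃ t : Finset ℤ, t.card ≤ N ∧ ∀ m ∈ A ∪ B, m ∉ t → 𝓕 (g m) ζ = 0) →
      (∀ ξ, volume {ζ | (∃ m ∈ A, 𝓕 (g m) ζ ≠ 0) ∧ ∃ m ∈ B, 𝓕 (g m) (ξ - ζ) ≠ 0} ≤ δ) →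
      ∀ W : Plane → ℝ≥0∞, AEMeasurable W → ∀ M : ℝ≥0∞, (∀ z, ∫⁻ x in unitSquare z, W x ≤ M) →
        ∫⁻ x, ‖(∑ m ∈ A, g m x) * ∑ m ∈ B, g m x‖ₑ ^ 2 * W x ≤
          C * M * δ * ((∑ m ∈ A, ∫⁻ x, ‖g m x‖ₑ ^ 2) * ∑ m ∈ B, ∫⁻ x, ‖g m x‖ₑ ^ 2) := by
  -- The radius doubles because the product of two functions of frequency at most `r` has frequency
  -- at most `2 * r`.
  obtain ⟨C, hC, hw⟩ := exists_lintegral_weight_le (2 * r) (by linarith)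
  refine ⟨C * (N * N), ENNReal.mul_ne_top hC (by simp [ENNReal.mul_eq_top]),
    fun A B g δ hg hr' hN hδ W hW M hM => ?_⟩
  have hsub : ∀ E : Finset ℤ, E ⊆ A ∪ B →
      Integrable (fun x => ∑ m ∈ E, g m x) ∧
      (∀ ζ, 𝓕 (fun x => ∑ m ∈ E, g m x) ζ ≠ 0 → ∃ m ∈ E, 𝓕 (g m) ζ ≠ 0) ∧
      ∫⁻ x, ‖∑ m ∈ E, g m x‖ₑ ^ 2 ≤ N * ∑ m ∈ E, ∫⁻ x, ‖g m x‖ₑ ^ 2 := by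
    intro E hE
    refine ⟨integrable_finsetSum _ fun m hm => hg m (hE hm), fun ζ h => ?_, ?_⟩
    · rw [fourier_finset_sum E g fun m hm => hg m (hE hm)] at h
      exact Finset.exists_ne_zero_of_sum_ne_zero h
    · refine lintegral_enorm_sq_sum_le E g (fun m hm => hg m (hE hm))
        (fun m hm => hr' m (hE hm)) N fun ζ => ?_
      obtain ⟨t, ht, h⟩ := hN ζ
      refine ⟨t ∩ E, Finset.inter_subset_right, (Finset.card_le_card
        Finset.inter_subset_left).trans ht, fun m hm hmt => h m (hE hm) fun h' => hmt ?_⟩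
      exact Finset.mem_inter.2 ⟨h', hm⟩
  obtain ⟨iA, sA, lA⟩ := hsub A Finset.subset_union_left
  obtain ⟨iB, sB, lB⟩ := hsub B Finset.subset_union_right
  have rA : ∀ ζ, r < ‖ζ‖ → 𝓕 (fun x => ∑ m ∈ A, g m x) ζ = 0 := by
    intro ζ hζ
    by_contra h
    obtain ⟨m, hm, h⟩ := sA ζ h
    exact h (hr' m (Finset.mem_union_left _ hm) ζ hζ)
  have rB : ∀ ζ, r < ‖ζ‖ → 𝓕 (fun x => ∑ m ∈ B, g m x) ζ = 0 := by
    intro ζ hζ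
    by_contra h
    obtain ⟨m, hm, h⟩ := sB ζ h
    exact h (hr' m (Finset.mem_union_right _ hm) ζ hζ)
  have fA := integrable_fourier_of_compactSupport iA rA
  have fB := integrable_fourier_of_compactSupport iB rB
  have hbil := lintegral_enorm_sq_mul_le iA fA iB fB (δ := δ) fun ξ =>
    le_trans (measure_mono fun ζ (hζ : _ ∧ _) => (⟨sA ζ hζ.1, sB _ hζ.2⟩ : _ ∧ _)) (hδ ξ)
  have hprod := hw _ (integrable_mul_of_fourier iA fA iB) (fun ξ hξ => by
    rw [fourier_mul_eq iA fA iB]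
    have : ∀ ζ, 𝓕 (fun x => ∑ m ∈ A, g m x) ζ * 𝓕 (fun x => ∑ m ∈ B, g m x) (ξ - ζ) = 0 := by
      intro ζ
      by_cases h : r < ‖ζ‖
      · rw [rA ζ h, zero_mul]
      · rw [rB (ξ - ζ) (by linarith [norm_sub_norm_le ξ ζ]), mul_zero]
    simp [this]) W hW M hM
  calc _ ≤ C * M * (δ * ((N * ∑ m ∈ A, ∫⁻ x, ‖g m x‖ₑ ^ 2) *
        (N * ∑ m ∈ B, ∫⁻ x, ‖g m x‖ₑ ^ 2))) := by
        refine hprod.trans ?_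
        gcongr
        refine hbil.trans ?_
        gcongr
    _ = _ := by ring

/-! ### Linear changes of variables and the parabolic rescaling. -/

section ChangeOfVariables

variable {E : Type*} [NormedAddCommGroup E] [NormedSpace ℝ E] [FiniteDimensional ℝ E]
  [MeasurableSpace E] [BorelSpace E] (μ : Measure E) [μ.IsAddHaarMeasure]

lemma exists_homeomorph_eq {E : Type*} [NormedAddCommGroup E] [NormedSpace ℝ E]
    [FiniteDimensional ℝ E] {T : E →ₗ[ℝ] E} (hT : LinearMap.det T ≠ 0) :
    ∃ e : E ≃ₜ E, ⇑e = T :=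
  ⟨(LinearEquiv.ofIsUnitDet (f := T) (v := Module.finBasis ℝ E) (v' := Module.finBasis ℝ E)
    (by rw [LinearMap.det_toMatrix]; exact hT.isUnit)).toContinuousLinearEquiv.toHomeomorph, rfl⟩

lemma measurableEmbedding_of_det_ne_zero {T : E →ₗ[ℝ] E} (hT : LinearMap.det T ≠ 0) :
    MeasurableEmbedding T := by
  obtain ⟨e, he⟩ := exists_homeomorph_eq hT
  exact he ▸ e.measurableEmbedding

lemma integral_comp_linearMap {T : E →ₗ[ℝ] E} (hT : LinearMap.det T ≠ 0) (h : E → ℂ) :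
    ∫ x, h (T x) ∂μ = ((|(LinearMap.det T)⁻¹| : ℝ) : ℂ) * ∫ x, h x ∂μ := by
  rw [← (measurableEmbedding_of_det_ne_zero hT).integral_map,
    Measure.map_linearMap_addHaar_eq_smul_addHaar μ hT, integral_smul_measure,
    ENNReal.toReal_ofReal (abs_nonneg _), Complex.real_smul]

lemma lintegral_comp_linearMap {T : E →ₗ[ℝ] E} (hT : LinearMap.det T ≠ 0) (h : E → ℝ≥0∞) :
    ∫⁻ x, h (T x) ∂μ = ENNReal.ofReal |(LinearMap.det T)⁻¹| * ∫⁻ x, h x ∂μ := by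
  rw [← (measurableEmbedding_of_det_ne_zero hT).lintegral_map,
    Measure.map_linearMap_addHaar_eq_smul_addHaar μ hT, lintegral_smul_measure, smul_eq_mul]

lemma quasiMeasurePreserving_linearMap {T : E →ₗ[ℝ] E} (hT : LinearMap.det T ≠ 0) :
    Measure.QuasiMeasurePreserving T μ μ := by
  refine ⟨(measurableEmbedding_of_det_ne_zero hT).measurable, ?_⟩
  rw [Measure.map_linearMap_addHaar_eq_smul_addHaar μ hT]
  exact Measure.smul_absolutelyContinuous

lemma integrable_comp_linearMap {T : E →ₗ[ℝ] E} (hT : LinearMap.det T ≠ 0) {h : E → ℂ}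
    (hh : Integrable h μ) : Integrable (fun x => h (T x)) μ := by
  have := (measurableEmbedding_of_det_ne_zero hT).integrable_map_iff (μ := μ) (g := h)
  refine this.1 ?_
  rw [Measure.map_linearMap_addHaar_eq_smul_addHaar μ hT]
  exact hh.smul_measure ENNReal.ofReal_ne_top

end ChangeOfVariables

/-- The transpose of the parabolic rescaling. -/
noncomputable def rescalingT (s c : ℝ) : Plane →ₗ[ℝ] Plane :=
  Matrix.toLpLin 2 2 !![s⁻¹, 0; -2 * c * (s ^ 2)⁻¹, (s ^ 2)⁻¹]

@[simp] lemma rescaling_zero (s c : ℝ) (y : Plane) :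
    rescaling s c y 0 = s⁻¹ * y 0 - 2 * c * (s ^ 2)⁻¹ * y 1 := by
  simp [rescaling, Matrix.toLpLin_apply, dotProduct, Fin.sum_univ_two]; ring

@[simp] lemma rescaling_one (s c : ℝ) (y : Plane) :
    rescaling s c y 1 = (s ^ 2)⁻¹ * y 1 := by
  simp [rescaling, Matrix.toLpLin_apply, dotProduct, Fin.sum_univ_two]

@[simp] lemma rescalingT_zero (s c : ℝ) (y : Plane) : rescalingT s c y 0 = s⁻¹ * y 0 := by
  simp [rescalingT, Matrix.toLpLin_apply, dotProduct, Fin.sum_univ_two]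

@[simp] lemma rescalingT_one (s c : ℝ) (y : Plane) :
    rescalingT s c y 1 = (s ^ 2)⁻¹ * (y 1 - 2 * c * y 0) := by
  simp [rescalingT, Matrix.toLpLin_apply, dotProduct, Fin.sum_univ_two]; ring

lemma inner_plane (x y : Plane) : inner ℝ x y = x 0 * y 0 + x 1 * y 1 := by
  simp [PiLp.inner_apply, Fin.sum_univ_two, mul_comm]

lemma inner_rescaling (s c : ℝ) (ξ y : Plane) :
    inner ℝ ξ (rescaling s c y) = inner ℝ (rescalingT s c ξ) y := by
  simp only [inner_plane, rescaling_zero, rescaling_one, rescalingT_zero, rescalingT_one]; ring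

lemma det_rescaling (s c : ℝ) : LinearMap.det (rescaling s c) = (s ^ 3)⁻¹ := by
  rw [rescaling, LinearMap.det_toLpLin, Matrix.det_fin_two_of]
  rw [pow_succ s 2, mul_inv]; ring

lemma det_rescalingT (s c : ℝ) : LinearMap.det (rescalingT s c) = (s ^ 3)⁻¹ := by
  rw [rescalingT, LinearMap.det_toLpLin, Matrix.det_fin_two_of]
  rw [pow_succ s 2, mul_inv]; ring

lemma det_rescaling_ne_zero {s : ℝ} (hs : s ≠ 0) (c : ℝ) :
    LinearMap.det (rescaling s c) ≠ 0 := by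
  rw [det_rescaling]; positivity

/-! ### Localization to an envelope and its effect on frequency supports. -/

/-- A Schwartz function with small support whose Fourier transform is bounded below on the unit
square. -/
lemma exists_localizer :
    ∃ χ : 𝓢(Plane, ℂ), (∀ w, χ w ≠ 0 → ‖w‖ ≤ 1 / 16) ∧
      ∀ y : Plane, (∀ i, |y i| ≤ 1 / 2) → 1 / 2 ≤ ‖𝓕 (χ : Plane → ℂ) y‖ := by
  let b : ContDiffBump (0 : Plane) := ⟨1 / 32, 1 / 16, by norm_num, by norm_num⟩
  have hc : HasCompactSupport (fun x => (b.normed volume x : ℂ)) :=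
    b.hasCompactSupport_normed.comp_left Complex.ofReal_zero
  have hd : ContDiff ℝ ((⊤ : ℕ∞) : WithTop ℕ∞) (fun x => (b.normed volume x : ℂ)) :=
    Complex.ofRealCLM.contDiff.comp b.contDiff_normed
  have hsupp : ∀ w : Plane, b.normed volume w ≠ 0 → ‖w‖ ≤ 1 / 16 := by
    intro w hw
    have : w ∈ Function.support (b.normed volume) := hw
    rw [b.support_normed_eq] at this
    have h2 : ‖w‖ < b.rOut := by simpa using this
    exact h2.le
  refine ⟨hc.toSchwartzMap hd, fun w hw => hsupp w ?_, fun y hy => ?_⟩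
  · intro h
    apply hw
    change (b.normed volume w : ℂ) = 0
    rw [h]; simp
  set χ : Plane → ℂ := fun x => (b.normed volume x : ℂ) with hχ
  change 1 / 2 ≤ ‖𝓕 χ y‖
  have hy1 : ‖y‖ ≤ 1 := by
    have h0 := sq_le_sq' (by linarith [neg_abs_le (y 0), hy 0] : -(1 / 2) ≤ y 0)
      ((le_abs_self _).trans (hy 0))
    have h1 := sq_le_sq' (by linarith [neg_abs_le (y 1), hy 1] : -(1 / 2) ≤ y 1)
      ((le_abs_self _).trans (hy 1))
    rw [EuclideanSpace.norm_eq, Fin.sum_univ_two, Real.norm_eq_abs, Real.norm_eq_abs, sq_abs,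
      sq_abs]
    exact Real.sqrt_le_one.2 (by linarith)
  have hi : Integrable χ := hd.continuous.integrable_of_hasCompactSupport hc
  have h1 : ∫ w, χ w = 1 := by
    rw [hχ, integral_complex_ofReal, b.integral_normed]; simp
  have h2 : ‖𝓕 χ y - 1‖ ≤ 1 / 2 := by
    rw [← h1, Real.fourier_eq', ← integral_sub _ hi]
    · calc _ ≤ ∫ w, ‖Complex.exp ((↑(-2 * Real.pi * inner ℝ w y) * Complex.I)) • χ w - χ w‖ :=
            norm_integral_le_integral_norm _
        _ ≤ ∫ w, 1 / 2 * b.normed volume w := by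
            refine integral_mono_of_nonneg (Filter.Eventually.of_forall fun _ => norm_nonneg _)
              (b.integrable_normed.const_mul _) (Filter.Eventually.of_forall fun w => ?_)
            have hn : ‖χ w‖ = b.normed volume w := by
              rw [hχ]; simp [abs_of_nonneg (b.nonneg_normed w)]
            have : Complex.exp ((↑(-2 * Real.pi * inner ℝ w y) * Complex.I)) • χ w - χ w =
                (Complex.exp (Complex.I * ↑(-2 * Real.pi * inner ℝ w y)) - 1) * χ w := by
              rw [smul_eq_mul, mul_comm Complex.I]; ring
            simp only [this, norm_mul, hn]
            by_cases h0 : b.normed volume w = 0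
            · simp [h0]
            gcongr
            · exact b.nonneg_normed w
            -- The bump has mass one and the phase is at most 2π/16 ≤ 1/2 on its support, so its
            -- transform stays within 1/2 of 1 on the square.
            refine (Real.norm_exp_I_mul_ofReal_sub_one_le).trans ?_
            rw [Real.norm_eq_abs, abs_mul, abs_mul, abs_neg, abs_two, abs_of_pos Real.pi_pos]
            have h3 := abs_real_inner_le_norm w y
            have h4 : |inner ℝ w y| ≤ 1 / 16 := h3.trans (by
              nlinarith [norm_nonneg w, norm_nonneg y, hsupp w h0])
            nlinarith [Real.pi_lt_four, Real.pi_pos, abs_nonneg (inner ℝ w y : ℝ)]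
        _ = 1 / 2 := by rw [integral_const_mul, b.integral_normed, mul_one]
    · have := (Real.fourierIntegral_convergent_iff (μ := volume) (f := χ) y).2 hi
      refine this.congr (Filter.Eventually.of_forall fun w => ?_)
      simp only [Circle.smul_def, Real.fourierChar_apply]
      congr 3
      push_cast; ring
  have h3 := norm_sub_norm_le (1 : ℂ) (1 - 𝓕 χ y)
  rw [norm_sub_rev 1, sub_sub_cancel, norm_one] at h3
  linarith

lemma IsTempered.aestronglyMeasurable {f : Plane → ℂ} (hf : IsTempered f) :
    AEStronglyMeasurable f := by
  obtain ⟨N, hN⟩ := hf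
  have h : Continuous fun x : Plane => (1 + ‖x‖) ^ N := by fun_prop
  refine (h.aestronglyMeasurable.smul hN.1).congr (Filter.Eventually.of_forall fun x => ?_)
  have : (1 + ‖x‖) ^ N ≠ 0 := by positivity
  simp only [Pi.smul_apply', smul_smul, mul_inv_cancel₀ this, one_smul]

/-- Schwartz decay of order `N` absorbs the polynomial weight in the definition of temperedness. The
dilation is the one in `fourierDistribution`, and costs only a factor (2π)^N. -/
lemma IsTempered.integrable_mul {f : Plane → ℂ} (hf : IsTempered f) (Φ : 𝓢(Plane, ℂ)) :
    Integrable fun x => f x * Φ ((2 * Real.pi)⁻¹ • x) := by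
  obtain ⟨N, hN⟩ := hf
  have hb := fun x => SchwartzMap.one_add_le_sup_seminorm_apply (𝕜 := ℝ) (m := (N, 0)) (k := N)
    (n := 0) le_rfl le_rfl Φ x
  set B := 2 ^ (N, 0).1 * (Finset.Iic ((N, 0) : ℕ × ℕ)).sup
    (fun m => SchwartzMap.seminorm ℝ m.1 m.2) Φ
  have hc : Continuous fun x : Plane => ((1 + ‖x‖) ^ N : ℝ) • Φ ((2 * Real.pi)⁻¹ • x) := by
    have := Φ.continuous
    fun_prop
  have h := hN.bdd_mul (c := (2 * Real.pi) ^ N * B) hc.aestronglyMeasurable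
    (Filter.Eventually.of_forall fun x => ?_)
  · refine h.congr (Filter.Eventually.of_forall fun x => ?_)
    have : ((1 + ‖x‖) ^ N : ℂ) ≠ 0 := by
      have : (1 + ‖x‖ : ℝ) ^ N ≠ 0 := by positivity
      exact_mod_cast this
    simp only [Complex.real_smul]
    push_cast
    field_simp
  · have h1 := hb ((2 * Real.pi)⁻¹ • x)
    rw [norm_iteratedFDeriv_zero, norm_smul, norm_inv, Real.norm_eq_abs,
      abs_of_pos (by positivity)] at h1
    rw [norm_smul, norm_pow, Real.norm_eq_abs, abs_of_pos (by positivity)]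
    have h2 : 1 + ‖x‖ ≤ (2 * Real.pi) * (1 + (2 * Real.pi)⁻¹ * ‖x‖) := by
      rw [mul_add, mul_inv_cancel_left₀ (by positivity)]
      linarith [Real.pi_gt_three]
    calc (1 + ‖x‖) ^ N * ‖Φ ((2 * Real.pi)⁻¹ • x)‖
        ≤ ((2 * Real.pi) * (1 + (2 * Real.pi)⁻¹ * ‖x‖)) ^ N * ‖Φ ((2 * Real.pi)⁻¹ • x)‖ := by
          gcongr
      _ = (2 * Real.pi) ^ N * ((1 + (2 * Real.pi)⁻¹ * ‖x‖) ^ N * ‖Φ ((2 * Real.pi)⁻¹ • x)‖) := by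
          rw [mul_pow]; ring
      _ ≤ _ := by gcongr

/-- The lattice point `z` as a point of the plane. -/
noncomputable def latticePoint (z : Fin 2 → ℤ) : Plane := WithLp.toLp 2 fun i => (z i : ℝ)

/-- `f` in the coordinates of a rescaling, localized to a square of side `ρ⁻¹` and modulated. -/
noncomputable def localized (χ : 𝓢(Plane, ℂ)) (f : Plane → ℂ) (s c ρ : ℝ) (z : Fin 2 → ℤ)
    (η : Plane) (y : Plane) : ℂ :=
  f (rescaling s c y) * 𝓕 (χ : Plane → ℂ) (ρ • y - latticePoint z) *
    Complex.exp (-(inner ℝ η y : ℝ) * Complex.I)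

/-- The test function whose pairing with the Fourier transform of `f` is the Fourier transform of
a localized piece of `f`. -/
lemma exists_testFunction (χ : 𝓢(Plane, ℂ)) (hχ : HasCompactSupport χ) {s ρ : ℝ} (c : ℝ)
    (hs : s ≠ 0) (hρ : 0 < ρ) (z : Fin 2 → ℤ) (η : Plane) :
    ∃ (φ : 𝓢(Plane, ℂ)) (a : ℂ), a ≠ 0 ∧
      (∀ ξ, φ ξ ≠ 0 → χ ((2 * Real.pi * ρ)⁻¹ • (rescalingT s c ξ - η)) ≠ 0) ∧
      ∀ y, 𝓕 φ ((2 * Real.pi)⁻¹ • rescaling s c y) =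
        a * (𝓕 (χ : Plane → ℂ) (ρ • y - latticePoint z) *
          Complex.exp (-(inner ℝ η y : ℝ) * Complex.I)) := by
  have hπ := Real.pi_pos
  set κ : ℝ := (2 * Real.pi * ρ)⁻¹ with hκ
  have hκ0 : κ ≠ 0 := by positivity
  set T : Plane →ₗ[ℝ] Plane := κ • rescalingT s c with hT
  have hTdet : LinearMap.det T ≠ 0 := by
    rw [hT, LinearMap.det_smul, det_rescalingT]; positivity
  set v : Plane := κ • η with hv
  -- Modulation by this point on the frequency side centres the transform at `ρ⁻¹ z` in rescaled
  -- space.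
  set a : Plane := ρ⁻¹ • rescaling s c (latticePoint z) with ha
  have hTv : ∀ ξ, κ • (rescalingT s c ξ - η) = T ξ - v := fun ξ => by
    rw [smul_sub, hT, hv]; rfl
  obtain ⟨e, he⟩ := exists_homeomorph_eq hTdet
  have hc1 : HasCompactSupport (fun ξ => χ (T ξ - v)) := by
    have := hχ.comp_homeomorph (e.trans (Homeomorph.subRight v))
    have h2 : (⇑χ ∘ ⇑(e.trans (Homeomorph.subRight v))) = fun ξ => χ (T ξ - v) := by
      ext ξ; simp [he]
    rwa [h2] at this
  have hc : HasCompactSupport (fun ξ => χ (T ξ - v) *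
      Complex.exp ((inner ℝ ξ a : ℝ) * Complex.I)) := hc1.mul_right
  have hTc : ContDiff ℝ ((⊤ : ℕ∞) : WithTop ℕ∞) T :=
    (LinearMap.toContinuousLinearMap T).contDiff
  have hd : ContDiff ℝ ((⊤ : ℕ∞) : WithTop ℕ∞) (fun ξ => χ (T ξ - v) *
      Complex.exp ((inner ℝ ξ a : ℝ) * Complex.I)) := by
    refine ((χ.smooth ⊤).comp (hTc.sub contDiff_const)).mul ?_
    have h1 : ContDiff ℝ ((⊤ : ℕ∞) : WithTop ℕ∞) (fun ξ : Plane => (inner ℝ ξ a : ℝ)) :=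
      contDiff_id.inner ℝ contDiff_const
    exact ((Complex.ofRealCLM.contDiff.comp h1).mul contDiff_const).cexp
  refine ⟨hc.toSchwartzMap hd, ((|(LinearMap.det T)⁻¹| : ℝ) : ℂ) *
    Complex.exp ((ρ⁻¹ * inner ℝ η (latticePoint z) : ℝ) * Complex.I), ?_, fun ξ hξ => ?_,
    fun y => ?_⟩
  · refine mul_ne_zero ?_ (Complex.exp_ne_zero _)
    exact_mod_cast (abs_pos.2 (inv_ne_zero hTdet)).ne'
  · rw [hTv]
    exact left_ne_zero_of_mul (show χ (T ξ - v) * _ ≠ 0 from hξ)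
  rw [SchwartzMap.fourier_coe, Real.fourier_eq']
  -- This is the integrand after the substitution `w = T ξ - v`. The constant phase and the Jacobian
  -- of that substitution make up the scalar chosen above.
  set h : Plane → ℂ := fun w => χ w * Complex.exp
    (-(inner ℝ (η + (2 * Real.pi * ρ) • w) (y - ρ⁻¹ • latticePoint z) : ℝ) * Complex.I) with hh
  have key : ∀ ξ, Complex.exp (((-2 * Real.pi * inner ℝ ξ ((2 * Real.pi)⁻¹ • rescaling s c y) : ℝ)
      : ℂ) * Complex.I) • (χ (T ξ - v) * Complex.exp ((inner ℝ ξ a : ℝ) * Complex.I)) =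
      h (T ξ - v) := by
    intro ξ
    have e1 : η + (2 * Real.pi * ρ) • (T ξ - v) = rescalingT s c ξ := by
      rw [← hTv, smul_smul, hκ, mul_inv_cancel₀ (by positivity), one_smul]; abel
    have e2 : inner ℝ (rescalingT s c ξ) (y - ρ⁻¹ • latticePoint z) =
        2 * Real.pi * inner ℝ ξ ((2 * Real.pi)⁻¹ • rescaling s c y) - inner ℝ ξ a := by
      rw [← inner_rescaling, map_sub, map_smul, inner_sub_right, ← ha,
        real_inner_smul_right ξ (rescaling s c y), mul_inv_cancel_left₀ (by positivity)]
    simp only [hh]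
    rw [e1, e2, smul_eq_mul, mul_left_comm, ← Complex.exp_add]
    congr 2
    push_cast; ring
  have h_int : ∀ ξ, (hc.toSchwartzMap hd) ξ =
      χ (T ξ - v) * Complex.exp ((inner ℝ ξ a : ℝ) * Complex.I) := fun ξ => rfl
  simp_rw [h_int, key]
  rw [integral_comp_linearMap volume hTdet (fun w => h (w - v)), integral_sub_right_eq_self,
    mul_assoc]
  congr 1
  rw [Real.fourier_eq', ← integral_mul_const, ← integral_const_mul]
  refine integral_congr_ae (Filter.Eventually.of_forall fun w => ?_)
  simp only [hh, smul_eq_mul]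
  have e3 : (inner ℝ (η + (2 * Real.pi * ρ) • w) (y - ρ⁻¹ • latticePoint z) : ℝ) =
      inner ℝ η y - ρ⁻¹ * inner ℝ η (latticePoint z) +
        2 * Real.pi * inner ℝ w (ρ • y - latticePoint z) := by
    simp only [inner_add_left, inner_sub_right, real_inner_smul_left, real_inner_smul_right]
    field_simp
    ring
  rw [e3, mul_comm (χ w)]
  have e4 : ∀ A B C D X : ℂ, Complex.exp D = Complex.exp A * Complex.exp B * Complex.exp C →
      Complex.exp D * X = Complex.exp A * (Complex.exp B * X * Complex.exp C) := by
    intro A B C D X h; rw [h]; ring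
  apply e4
  rw [← Complex.exp_add, ← Complex.exp_add]
  congr 1
  push_cast; ring

/-- The localized pieces are integrable, and their Fourier transforms are supported near the
rescaled Fourier support of `f`. -/
lemma localized_spec (χ : 𝓢(Plane, ℂ)) (hχ : ∀ w, χ w ≠ 0 → ‖w‖ ≤ 1 / 16) {f : Plane → ℂ}
    {K : Set Plane} (hf : HasFourierSupportIn f K) {s ρ : ℝ} (c : ℝ) (hs : s ≠ 0) (hρ : 0 < ρ)
    (z : Fin 2 → ℤ) (η : Plane) :
    Integrable (localized χ f s c ρ z η) ∧
      ∀ ζ, 𝓕 (localized χ f s c ρ z η) ζ ≠ 0 →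
        ∃ ξ ∈ K, ‖rescalingT s c ξ - η - (2 * Real.pi) • ζ‖ ≤ ρ / 2 := by
  have hχc : HasCompactSupport χ :=
    HasCompactSupport.intro (isCompact_closedBall (0 : Plane) (1 / 16)) fun x hx => by
      by_contra h
      exact hx (by simpa using hχ x h)
  have hdet := det_rescaling_ne_zero hs c
  constructor
  · obtain ⟨φ, a, ha, -, hφ⟩ := exists_testFunction χ hχc c hs hρ z η
    have h1 := (integrable_comp_linearMap volume hdet (hf.1.integrable_mul (𝓕 φ))).const_mul a⁻¹
    refine h1.congr (Filter.Eventually.of_forall fun y => ?_)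
    simp only [localized, hφ]
    field_simp
  · intro ζ hζ
    by_contra! hcon
    -- Adding 2πζ to the modulation turns the pairing with `φ` into the Fourier integral of the
    -- localized piece at `ζ`, up to a nonzero factor. If no point of `K` is close, the support of
    -- `φ` misses `K` and the pairing vanishes.
    obtain ⟨φ, a, ha, hsupp, hφ⟩ :=
      exists_testFunction χ hχc c hs hρ z (η + (2 * Real.pi) • ζ)
    apply hζ
    have hcl : tsupport φ ⊆ {ξ | ‖rescalingT s c ξ - η - (2 * Real.pi) • ζ‖ ≤ ρ / 2} := by
      refine closure_minimal (fun ξ hξ => ?_) (isClosed_le ?_ continuous_const)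
      · have h := hχ _ (hsupp ξ hξ)
        have hπ := Real.pi_pos
        rw [norm_smul, norm_inv, Real.norm_eq_abs, abs_of_pos (by positivity),
          inv_mul_le_iff₀ (by positivity), ← sub_sub] at h
        -- The radius 1/16 of the support of `χ` is chosen so that, by π < 4, the frequency blur is
        -- at most ρ/2.
        have : 2 * Real.pi * ρ * (1 / 16) ≤ ρ / 2 := by nlinarith [Real.pi_lt_four]
        exact h.trans this
      · have := (rescalingT s c).continuous_of_finiteDimensional
        fun_prop
    have hzero : fourierDistribution f φ = 0 :=
      hf.2 φ fun ξ hξ hξK => absurd (hcl hξ) (not_le.2 (hcon ξ hξK))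
    have h1 : ∫ y, f (rescaling s c y) * 𝓕 φ ((2 * Real.pi)⁻¹ • rescaling s c y) = 0 := by
      rw [integral_comp_linearMap volume hdet (fun x => f x * 𝓕 φ ((2 * Real.pi)⁻¹ • x))]
      rw [fourierDistribution] at hzero
      rw [hzero, mul_zero]
    have h2 : 𝓕 (localized χ f s c ρ z η) ζ =
        a⁻¹ * ∫ y, f (rescaling s c y) * 𝓕 φ ((2 * Real.pi)⁻¹ • rescaling s c y) := by
      rw [Real.fourier_eq', ← integral_const_mul]
      refine integral_congr_ae (Filter.Eventually.of_forall fun y => ?_)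
      simp only [localized, hφ, smul_eq_mul, inner_add_left, real_inner_smul_left]
      have e5 : Complex.exp (-((inner ℝ η y + 2 * Real.pi * inner ℝ ζ y : ℝ) : ℂ) * Complex.I) =
          Complex.exp (((-2 * Real.pi * inner ℝ y ζ : ℝ) : ℂ) * Complex.I) *
            Complex.exp (-((inner ℝ η y : ℝ) : ℂ) * Complex.I) := by
        rw [← Complex.exp_add, real_inner_comm y ζ]
        congr 1
        push_cast; ring
      rw [e5]
      field_simp
    rw [h2, h1, mul_zero]

/-! ### Geometry of the rescaled parabola and transversality. -/

/-- The image of the point `(c, c²)` in the rescaled frequency coordinates. -/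
noncomputable def centre (s c : ℝ) : Plane := rescalingT s c (WithLp.toLp 2 ![c, c ^ 2])

/-- The point with first coordinate `X + σ u` and second coordinate `(X + σ u)² + σ² (v - u²)` is a
block point in rescaled coordinates, `σ` being `r / s`. Moving it by σ²/2 changes the square of its
first coordinate by at most 263 σ²/2, because all coordinates are bounded; with the 3σ² from the
block and the displacement σ²/2 this totals 135 σ². -/
lemma parabola_perturb {σ X u v t q : ℝ} (hσ0 : 0 < σ) (hσ1 : σ ≤ 1) (hX : |X| ≤ 130)
    (hu : |u| ≤ 1) (hv : |v| ≤ 2) (e0 : |X + σ * u - t| ≤ σ ^ 2 / 2)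
    (e1 : |(X + σ * u) ^ 2 + σ ^ 2 * (v - u ^ 2) - q| ≤ σ ^ 2 / 2) :
    |t - X| ≤ 3 / 2 * σ ∧ |q - t ^ 2| ≤ 135 * σ ^ 2 ∧ |t| ≤ 132 := by
  obtain ⟨X1, X2⟩ := abs_le.1 hX
  obtain ⟨u1, u2⟩ := abs_le.1 hu
  obtain ⟨v1, v2⟩ := abs_le.1 hv
  obtain ⟨d1, d2⟩ := abs_le.1 e0
  obtain ⟨q1, q2⟩ := abs_le.1 e1
  have hu2 : u ^ 2 ≤ 1 := by nlinarith
  have hσ2 : σ ^ 2 ≤ σ := by nlinarith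
  have su1 : -σ ≤ σ * u := by nlinarith
  have su2 : σ * u ≤ σ := by nlinarith
  have sv1 : σ ^ 2 * (-3) ≤ σ ^ 2 * (v - u ^ 2) :=
    mul_le_mul_of_nonneg_left (by linarith) (sq_nonneg σ)
  have sv2 : σ ^ 2 * (v - u ^ 2) ≤ σ ^ 2 * 3 :=
    mul_le_mul_of_nonneg_left (by linarith [sq_nonneg u]) (sq_nonneg σ)
  have hsum : |X + σ * u + t| ≤ 263 := by
    rw [abs_le]; constructor <;> linarith
  have hprod : |(X + σ * u) ^ 2 - t ^ 2| ≤ 263 * (σ ^ 2 / 2) := by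
    have : (X + σ * u) ^ 2 - t ^ 2 = (X + σ * u + t) * (X + σ * u - t) := by ring
    rw [this, abs_mul]
    gcongr
  obtain ⟨p1, p2⟩ := abs_le.1 hprod
  refine ⟨?_, ?_, ?_⟩ <;> rw [abs_le] <;> constructor <;> linarith

/-- The position of the Fourier support of a localized block in rescaled coordinates. -/
lemma block_rescaled {r s c : ℝ} (hr : 0 < r) (hrs : r ≤ s) {m : ℤ} (hm : |r * m - c| ≤ 130 * s)
    {ξ ζ : Plane} (hξ : ξ ∈ block r (r * m))
    (hζ : ‖rescalingT s c ξ - centre s c - (2 * Real.pi) • ζ‖ ≤ (r / s) ^ 2 / 2) :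
    |2 * Real.pi * ζ 0 - (r * m - c) / s| ≤ 3 / 2 * (r / s) ∧
      |2 * Real.pi * ζ 1 - (2 * Real.pi * ζ 0) ^ 2| ≤ 135 * (r / s) ^ 2 ∧
      |2 * Real.pi * ζ 0| ≤ 132 := by
  have hs : 0 < s := hr.trans_le hrs
  obtain ⟨u, v, hu, hv, h0, h1⟩ := hξ
  have e0 := (abs_apply_le_norm _ 0).trans hζ
  have e1 := (abs_apply_le_norm _ 1).trans hζ
  simp only [centre, PiLp.sub_apply, PiLp.smul_apply, smul_eq_mul, rescalingT_zero,
    rescalingT_one, Matrix.cons_val_zero, Matrix.cons_val_one, h0, h1] at e0 e1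
  have hXb : |(r * m - c) / s| ≤ 130 := by
    rw [abs_div, abs_of_pos hs, div_le_iff₀ hs]; exact hm
  refine parabola_perturb (by positivity) ((div_le_one hs).2 hrs) hXb hu hv ?_ ?_
  · refine le_of_eq_of_le (congrArg abs ?_) e0
    field_simp
    ring
  · refine le_of_eq_of_le (congrArg abs ?_) e1
    field_simp
    ring

/-- Transversality: the fibres of the sum map over a pair of separated pieces of the parabola, or
over a piece of the smallest scale, have diameter `O((r / s)²)`. -/
lemma fibre_close {r s : ℝ} (hr : 0 < r) (hrs : r ≤ s) {X Y t q t' q' : ℝ}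
    (h1 : |q - t ^ 2| ≤ 135 * (r / s) ^ 2) (h2 : |Y - q - (X - t) ^ 2| ≤ 135 * (r / s) ^ 2)
    (h1' : |q' - t' ^ 2| ≤ 135 * (r / s) ^ 2) (h2' : |Y - q' - (X - t') ^ 2| ≤ 135 * (r / s) ^ 2)
    (ht : |t| ≤ 132) (ht' : |t'| ≤ 132)
    (hsep : s ≤ 8 * r ∨ (1 / 4 ≤ (X - t) - t ∧ 1 / 4 ≤ (X - t') - t')) :
    |t - t'| ≤ 3000000 * (r / s) ^ 2 ∧ |q - q'| ≤ 3000000 * (r / s) ^ 2 := by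
  have hs : 0 < s := hr.trans_le hrs
  set ρ := (r / s) ^ 2 with hρ
  have hρ0 : 0 < ρ := by positivity
  -- If `s ≤ 8 * r` then `ρ ≥ 1/64`, and boundedness of the coordinates suffices.
  rcases hsep with h | ⟨h, h'⟩
  · have hρ1 : 1 / 64 ≤ ρ := by
      have : 1 / 8 ≤ r / s := by rw [div_le_div_iff₀ (by norm_num) hs]; linarith
      calc (1 / 64 : ℝ) = (1 / 8) ^ 2 := by norm_num
        _ ≤ ρ := by rw [hρ]; gcongr
    have hρ2 : ρ ≤ 1 := by
      rw [hρ]; exact pow_le_one₀ (by positivity) ((div_le_one hs).2 hrs)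
    have a1 : t ^ 2 ≤ 132 ^ 2 := by rw [← sq_abs t]; gcongr
    have a2 : t' ^ 2 ≤ 132 ^ 2 := by rw [← sq_abs t']; gcongr
    rw [abs_le] at h1 h1' ht ht'
    constructor
    · rw [abs_le]; constructor <;> linarith
    · rw [abs_le]; constructor <;> linarith [sq_nonneg t, sq_nonneg t']
  · have key : |t - t'| ≤ 1080 * ρ := by
      -- Along a fibre `t² + (X - t)²` equals `Y` up to O(ρ), and its difference quotient is minus
      -- the sum of the two separations, hence at least 1/2 in size.
      have e : (t - t') * (((X - t) - t) + ((X - t') - t')) =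
          -(t ^ 2 + (X - t) ^ 2 - (t' ^ 2 + (X - t') ^ 2)) := by ring
      have e2 : |(t - t') * (((X - t) - t) + ((X - t') - t'))| ≤ 540 * ρ := by
        rw [e, abs_neg, abs_le]
        rw [abs_le] at *
        constructor <;> linarith [h1.1, h1.2, h2.1, h2.2, h1'.1, h1'.2, h2'.1, h2'.2]
      rw [abs_mul] at e2
      have e3 : 1 / 2 ≤ |((X - t) - t) + ((X - t') - t')| :=
        le_trans (by linarith) (le_abs_self _)
      nlinarith [abs_nonneg (t - t')]
    refine ⟨by linarith, ?_⟩
    have e4 : |t ^ 2 - t' ^ 2| ≤ 264 * (1080 * ρ) := by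
      have : t ^ 2 - t' ^ 2 = (t + t') * (t - t') := by ring
      rw [this, abs_mul]
      have : |t + t'| ≤ 264 := (abs_add_le _ _).trans (by linarith)
      gcongr
    rw [abs_le] at *
    constructor <;> linarith [h1.1, h1.2, h1'.1, h1'.2, e4.1, e4.2]

lemma norm_le_add_abs (x : Plane) : ‖x‖ ≤ |x 0| + |x 1| := by
  rw [EuclideanSpace.norm_eq, Fin.sum_univ_two]
  refine Real.sqrt_le_iff.2 ⟨by positivity, ?_⟩
  simp only [Real.norm_eq_abs]
  nlinarith [abs_nonneg (x 0), abs_nonneg (x 1)]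

/-- Turns the coordinatewise diameter bound of `fibre_close` into the area bound O(ρ²). -/
lemma exists_volume_le_of_close (D : ℝ) (hD : 0 ≤ D) :
    ∃ C : ℝ≥0∞, C ≠ ⊤ ∧ ∀ (S : Set Plane) (ρ : ℝ), 0 ≤ ρ →
      (∀ x ∈ S, ∀ y ∈ S, |x 0 - y 0| ≤ D * ρ ∧ |x 1 - y 1| ≤ D * ρ) →
      volume S ≤ C * ENNReal.ofReal (ρ ^ 2) := by
  refine ⟨ENNReal.ofReal ((2 * D) ^ 2) * volume (Metric.ball (0 : Plane) 1),
    ENNReal.mul_ne_top ENNReal.ofReal_ne_top measure_ball_lt_top.ne, fun S ρ hρ h => ?_⟩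
  rcases S.eq_empty_or_nonempty with rfl | ⟨x, hx⟩
  · simp
  have hsub : S ⊆ Metric.closedBall x (2 * D * ρ) := by
    intro y hy
    rw [Metric.mem_closedBall, dist_eq_norm]
    obtain ⟨h0, h1⟩ := h y hy x hx
    refine (norm_le_add_abs _).trans ?_
    simp only [PiLp.sub_apply]
    linarith
  refine (measure_mono hsub).trans ?_
  rw [Measure.addHaar_closedBall _ _ (by positivity), finrank_euclideanSpace, Fintype.card_fin,
    mul_pow, ENNReal.ofReal_mul (by positivity)]
  exact le_of_eq (by ring)

/-- The weighted bilinear estimate for blocks localized to an envelope. The indices lie near the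
centre `c`, and they are either separated at scale `s` or of scale comparable to `s`. -/
lemma exists_lintegral_localized_le (χ : 𝓢(Plane, ℂ)) (hχ : ∀ w, χ w ≠ 0 → ‖w‖ ≤ 1 / 16) :
    ∃ C : ℝ≥0∞, C ≠ ⊤ ∧ ∀ (r s c : ℝ) (A B : Finset ℤ) (f : ℤ → Plane → ℂ) (z : Fin 2 → ℤ),
      0 < r → r ≤ s → (∀ m ∈ A ∪ B, |r * m - c| ≤ 130 * s) →
      (∀ m ∈ A ∪ B, HasFourierSupportIn (f m) (block r (r * m))) →
      (s ≤ 8 * r ∨ ∀ m ∈ A, ∀ m' ∈ B, 3 * r + s / 4 ≤ r * (m' - m)) →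
      ∀ W : Plane → ℝ≥0∞, AEMeasurable W → ∀ M : ℝ≥0∞, (∀ z, ∫⁻ x in unitSquare z, W x ≤ M) →
        ∫⁻ y, ‖(∑ m ∈ A, localized χ (f m) s c ((r / s) ^ 2) z (centre s c) y) *
            ∑ m ∈ B, localized χ (f m) s c ((r / s) ^ 2) z (centre s c) y‖ₑ ^ 2 * W y ≤
          C * M * ENNReal.ofReal (((r / s) ^ 2) ^ 2) *
            ((∑ m ∈ A, ∫⁻ y, ‖localized χ (f m) s c ((r / s) ^ 2) z (centre s c) y‖ₑ ^ 2) *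
              ∑ m ∈ B, ∫⁻ y, ‖localized χ (f m) s c ((r / s) ^ 2) z (centre s c) y‖ₑ ^ 2) := by
  -- The frequencies satisfy |ζ₀| ≤ 132 and |ζ₁| ≤ 132² + 135, whose sum is below 20000. The overlap
  -- 4 is the number of integers that a closed interval of length 3 can contain.
  obtain ⟨C, hC, hbil⟩ := exists_lintegral_bilinear_le 20000 (by norm_num) 4
  obtain ⟨C', hC', hvol⟩ := exists_volume_le_of_close 3000000 (by norm_num)
  refine ⟨C * C', ENNReal.mul_ne_top hC hC', fun r s c A B f z hr hrs hm hf hsep W hW M hM => ?_⟩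
  have hs : 0 < s := hr.trans_le hrs
  have hπ := Real.pi_gt_three
  have hρ0 : 0 < (r / s) ^ 2 := by positivity
  have hρ1 : (r / s) ^ 2 ≤ 1 := pow_le_one₀ (by positivity) ((div_le_one hs).2 hrs)
  set g : ℤ → Plane → ℂ := fun m => localized χ (f m) s c ((r / s) ^ 2) z (centre s c) with hg
  have hspec : ∀ m ∈ A ∪ B, Integrable (g m) ∧ ∀ ζ, 𝓕 (g m) ζ ≠ 0 →
      |2 * Real.pi * ζ 0 - (r * m - c) / s| ≤ 3 / 2 * (r / s) ∧
      |2 * Real.pi * ζ 1 - (2 * Real.pi * ζ 0) ^ 2| ≤ 135 * (r / s) ^ 2 ∧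
      |2 * Real.pi * ζ 0| ≤ 132 := by
    intro m hmA
    obtain ⟨h1, h2⟩ := localized_spec χ hχ (hf m hmA) c hs.ne' hρ0 z (centre s c)
    refine ⟨h1, fun ζ hζ => ?_⟩
    obtain ⟨ξ, hξ, h⟩ := h2 ζ hζ
    exact block_rescaled hr hrs (hm m hmA) hξ h
  have h := hbil A B g (C' * ENNReal.ofReal (((r / s) ^ 2) ^ 2)) (fun m hm => (hspec m hm).1) ?_ ?_
    ?_ W hW M hM
  · refine h.trans_eq ?_
    ring
  · intro m hmA ζ hζ
    by_contra hne
    obtain ⟨-, h2, h3⟩ := (hspec m hmA).2 ζ hne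
    have h4 := norm_le_add_abs ζ
    have hπ4 := Real.pi_lt_four
    rw [abs_mul, abs_of_pos (by positivity : 0 < 2 * Real.pi)] at h3
    have h5 : |ζ 0| ≤ 132 := by nlinarith [abs_nonneg (ζ 0)]
    have h6 : |2 * Real.pi * ζ 1| ≤ 132 ^ 2 + 135 := by
      have h7 : |(2 * Real.pi * ζ 0) ^ 2| ≤ 132 ^ 2 := by
        rw [abs_pow, abs_mul, abs_of_pos (by positivity : 0 < 2 * Real.pi)]; gcongr
      have h8 := abs_sub_abs_le_abs_sub (2 * Real.pi * ζ 1) ((2 * Real.pi * ζ 0) ^ 2)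
      linarith
    rw [abs_mul, abs_of_pos (by positivity : 0 < 2 * Real.pi)] at h6
    nlinarith [abs_nonneg (ζ 1)]
  · intro ζ
    -- The first coordinate of `ζ`, measured in units of block indices: the supports containing `ζ`
    -- have indices within 3/2 of it.
    set x : ℝ := (s * (2 * Real.pi * ζ 0) + c) / r with hx
    refine ⟨Finset.Icc ⌈x - 3 / 2⌉ ⌊x + 3 / 2⌋, ?_, fun m hmA hmt => ?_⟩
    · rw [Int.card_Icc]
      have h1 := Int.floor_le (x + 3 / 2)
      have h2 := Int.le_ceil (x - 3 / 2)
      have h3 : ((⌊x + 3 / 2⌋ - ⌈x - 3 / 2⌉ : ℤ) : ℝ) ≤ 3 := by push_cast; linarith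
      have h4 : ⌊x + 3 / 2⌋ - ⌈x - 3 / 2⌉ ≤ 3 := by exact_mod_cast h3
      omega
    · by_contra hne
      apply hmt
      obtain ⟨h1, -, -⟩ := (hspec m hmA).2 ζ hne
      have h2 : |x - m| ≤ 3 / 2 := by
        have : x - m = (2 * Real.pi * ζ 0 - (r * m - c) / s) * (s / r) := by
          rw [hx]; field_simp; ring
        rw [this, abs_mul, abs_of_pos (by positivity : 0 < s / r)]
        calc _ ≤ 3 / 2 * (r / s) * (s / r) := by gcongr
          _ = 3 / 2 := by field_simp
      rw [abs_le] at h2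
      rw [Finset.mem_Icc, Int.ceil_le, Int.le_floor]
      constructor <;> linarith [h2.1, h2.2]
  · intro ξ
    -- Each support blurs its first coordinate by 3/2 · r/s. The term `3 * r` in the separation
    -- hypothesis pays for the two blurs and leaves 1/4 at unit scale.
    have hsepζ : ∀ ζ : Plane, ∀ m ∈ A, ∀ m' ∈ B, 𝓕 (g m) ζ ≠ 0 → 𝓕 (g m') (ξ - ζ) ≠ 0 →
        s ≤ 8 * r ∨ 1 / 4 ≤ (2 * Real.pi * ξ 0 - 2 * Real.pi * ζ 0) - 2 * Real.pi * ζ 0 := by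
      intro ζ m hmA m' hmB h1 h2
      rcases hsep with h | h
      · exact Or.inl h
      right
      have h := h m hmA m' hmB
      obtain ⟨a1, -, -⟩ := (hspec m (Finset.mem_union_left _ hmA)).2 ζ h1
      obtain ⟨a2, -, -⟩ := (hspec m' (Finset.mem_union_right _ hmB)).2 _ h2
      rw [abs_le] at a1 a2
      simp only [PiLp.sub_apply] at a2
      have h3 : 3 * (r / s) + 1 / 4 ≤ (r * m' - c) / s - (r * m - c) / s := by
        have : (r * m' - c) / s - (r * m - c) / s = r * (m' - m) / s := by ring
        rw [this, le_div_iff₀ hs, add_mul, mul_assoc, div_mul_cancel₀ _ hs.ne']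
        linarith
      linarith [a1.1, a1.2, a2.1, a2.2]
    refine hvol _ _ hρ0.le ?_
    rintro ζ ⟨⟨m, hmA, n1⟩, m', hmB, n2⟩ ζ' ⟨⟨k, hkA, n3⟩, k', hkB, n4⟩
    obtain ⟨-, b1, b2⟩ := (hspec m (Finset.mem_union_left _ hmA)).2 ζ n1
    obtain ⟨-, c1, -⟩ := (hspec m' (Finset.mem_union_right _ hmB)).2 _ n2
    obtain ⟨-, d1, d2⟩ := (hspec k (Finset.mem_union_left _ hkA)).2 ζ' n3
    obtain ⟨-, e1, -⟩ := (hspec k' (Finset.mem_union_right _ hkB)).2 _ n4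
    simp only [PiLp.sub_apply, mul_sub] at c1 e1
    have hs1 := hsepζ ζ m hmA m' hmB n1 n2
    have hs2 := hsepζ ζ' k hkA k' hkB n3 n4
    have hfin := fibre_close hr hrs b1 c1 d1 e1 b2 d2 (by
      rcases hs1 with h | h
      · exact Or.inl h
      rcases hs2 with h' | h'
      · exact Or.inl h'
      exact Or.inr ⟨h, h'⟩)
    have hscale : ∀ a b : ℝ, |2 * Real.pi * a - 2 * Real.pi * b| ≤ 3000000 * (r / s) ^ 2 →
        |a - b| ≤ 3000000 * (r / s) ^ 2 := by
      intro a b h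
      rw [← mul_sub, abs_mul, abs_of_pos (by positivity)] at h
      nlinarith [abs_nonneg (a - b)]
    exact ⟨hscale _ _ hfin.1, hscale _ _ hfin.2⟩

/-! ### The estimate on one cell, and the sum over all cells. -/

/-- The square of side `ρ⁻¹` centred at `ρ⁻¹ z`. -/
def cell (ρ : ℝ) (z : Fin 2 → ℤ) : Set Plane := {y | ρ • y ∈ unitSquare z}

lemma measurableSet_cell (ρ : ℝ) (z : Fin 2 → ℤ) : MeasurableSet (cell ρ z) :=
  ((isClosed_unitSquare z).preimage (continuous_const_smul ρ)).measurableSet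

lemma iUnion_cell (ρ : ℝ) : ⋃ z, cell ρ z = Set.univ := by
  refine Set.eq_univ_of_forall fun y => ?_
  have h : ρ • y ∈ ⋃ z, unitSquare z := by rw [iUnion_unitSquare]; trivial
  obtain ⟨z, hz⟩ := Set.mem_iUnion.1 h
  exact Set.mem_iUnion.2 ⟨z, hz⟩

lemma enorm_localized (χ : 𝓢(Plane, ℂ)) (f : Plane → ℂ) (s c ρ : ℝ) (z : Fin 2 → ℤ)
    (η y : Plane) :
    ‖localized χ f s c ρ z η y‖ₑ =
      ‖f (rescaling s c y)‖ₑ * ‖𝓕 (χ : Plane → ℂ) (ρ • y - latticePoint z)‖ₑ := by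
  have h1 : ‖Complex.exp (-(inner ℝ η y : ℝ) * Complex.I)‖ₑ = 1 := by
    rw [← ofReal_norm, ← Complex.ofReal_neg, Complex.norm_exp_ofReal_mul_I, ENNReal.ofReal_one]
  rw [localized, enorm_mul, enorm_mul, h1, mul_one]

lemma sum_localized (χ : 𝓢(Plane, ℂ)) (A : Finset ℤ) (f : ℤ → Plane → ℂ) (s c ρ : ℝ)
    (z : Fin 2 → ℤ) (η y : Plane) :
    ∑ m ∈ A, localized χ (f m) s c ρ z η y =
      localized χ (fun x => ∑ m ∈ A, f m x) s c ρ z η y := by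
  simp only [localized, Finset.sum_mul]

/-- Replaces a partition of unity: the squared bumps of all cells have a bounded sum, so the
estimates on cells can be added. -/
lemma exists_tsum_localizer_le (χ : 𝓢(Plane, ℂ)) :
    ∃ C : ℝ≥0∞, C ≠ ⊤ ∧ ∀ y : Plane,
      ∑' z, ‖𝓕 (χ : Plane → ℂ) (y - latticePoint z)‖ₑ ^ 2 ≤ C := by
  obtain ⟨B, hB, hd⟩ := exists_norm_le_decay (𝓕 χ)
  obtain ⟨C, hC, hsum⟩ := exists_tsum_decay_le
  refine ⟨ENNReal.ofReal (B ^ 2) * C, ENNReal.mul_ne_top ENNReal.ofReal_ne_top hC, fun y => ?_⟩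
  calc _ ≤ ∑' z : Fin 2 → ℤ, ENNReal.ofReal (B ^ 2) *
        ENNReal.ofReal (decay (y 0 - z 0) (y 1 - z 1)) := by
        refine ENNReal.tsum_le_tsum fun z => ?_
        rw [← ofReal_norm, ← ENNReal.ofReal_pow (norm_nonneg _),
          ← ENNReal.ofReal_mul (by positivity)]
        refine ENNReal.ofReal_le_ofReal ?_
        have h1 := hd (y - latticePoint z)
        rw [SchwartzMap.fourier_coe] at h1
        simp only [latticePoint, PiLp.sub_apply] at h1 ⊢
        have h2 := decay_nonneg (y 0 - z 0) (y 1 - z 1)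
        have h3 := decay_le_one (y 0 - z 0) (y 1 - z 1)
        calc _ ≤ (B * decay (y 0 - z 0) (y 1 - z 1)) ^ 2 := by gcongr
          _ = B ^ 2 * (decay (y 0 - z 0) (y 1 - z 1) * decay (y 0 - z 0) (y 1 - z 1)) := by ring
          _ ≤ _ := by gcongr; exact mul_le_of_le_one_right h2 h3
    _ ≤ _ := by rw [ENNReal.tsum_mul_left]; gcongr; exact hsum _ _

lemma lintegral_localizer (χ : 𝓢(Plane, ℂ)) {ρ : ℝ} (hρ : 0 < ρ) (z : Fin 2 → ℤ) :
    ∫⁻ y, ‖𝓕 (χ : Plane → ℂ) (ρ • y - latticePoint z)‖ₑ ^ 2 =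
      (ENNReal.ofReal (ρ ^ 2))⁻¹ * ∫⁻ y, ‖𝓕 (χ : Plane → ℂ) y‖ₑ ^ 2 := by
  have hdet : LinearMap.det (ρ • (LinearMap.id : Plane →ₗ[ℝ] Plane)) = ρ ^ 2 := by
    rw [LinearMap.det_smul, LinearMap.det_id, finrank_euclideanSpace, Fintype.card_fin, mul_one]
  have h := lintegral_comp_linearMap (volume : Measure Plane)
    (T := ρ • (LinearMap.id : Plane →ₗ[ℝ] Plane)) (by rw [hdet]; positivity)
    (fun y => ‖𝓕 (χ : Plane → ℂ) (y - latticePoint z)‖ₑ ^ 2)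
  rw [lintegral_sub_right_eq_self (fun y => ‖𝓕 (χ : Plane → ℂ) y‖ₑ ^ 2), hdet,
    abs_of_pos (by positivity), ENNReal.ofReal_inv_of_pos (by positivity)] at h
  exact h

/-- Hölder's inequality relating the `p/2`-th power to the second power, `2 ≤ p ≤ 4`. -/
lemma lintegral_rpow_weight_le {α : Type*} [MeasurableSpace α] {μ : Measure α}
    {X W : α → ℝ≥0∞} (hX : AEMeasurable X μ) (hW : AEMeasurable W μ) {p : ℝ} (hp : 2 ≤ p)
    (hp4 : p ≤ 4) :
    ∫⁻ x, X x ^ (p / 2) * W x ∂μ ≤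
      (∫⁻ x, X x ^ 2 * W x ∂μ) ^ (p / 4) * (∫⁻ x, W x ∂μ) ^ (1 - p / 4) := by
  have h := ENNReal.lintegral_mul_norm_pow_le (μ := μ) (f := fun x => X x ^ 2 * W x) (g := W)
    ((hX.pow_const 2).mul hW) hW (p := p / 4) (q := 1 - p / 4) (by linarith) (by linarith)
    (by ring)
  refine le_trans (le_of_eq (lintegral_congr fun x => ?_)) h
  rw [ENNReal.mul_rpow_of_nonneg _ _ (by linarith), mul_assoc,
    ← ENNReal.rpow_add_of_nonneg _ _ (by linarith) (by linarith), ← ENNReal.rpow_natCast,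
    ← ENNReal.rpow_mul]
  congr 1
  · congr 1; push_cast; ring
  · rw [add_sub_cancel, ENNReal.rpow_one]

/-- Jensen's inequality for the measure with density `W`, written without dividing by its total
mass. It brings the square function from an L² quantity to the exponent p/2 on a single cell. -/
lemma rpow_lintegral_weight_le {α : Type*} [MeasurableSpace α] {μ : Measure α}
    {X W : α → ℝ≥0∞} (hX : AEMeasurable X μ) (hW : AEMeasurable W μ) {p : ℝ} (hp : 2 ≤ p) :
    (∫⁻ x, X x * W x ∂μ) ^ (p / 2) ≤
      (∫⁻ x, X x ^ (p / 2) * W x ∂μ) * (∫⁻ x, W x ∂μ) ^ (p / 2 - 1) := by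
  have hp0 : 0 < p := by linarith
  have h := ENNReal.lintegral_mul_norm_pow_le (μ := μ) (f := fun x => X x ^ (p / 2) * W x) (g := W)
    ((hX.pow_const _).mul hW) hW (p := 2 / p) (q := 1 - 2 / p) (by positivity)
    (by rw [sub_nonneg, div_le_one hp0]; exact hp) (by ring)
  have h1 : ∫⁻ x, X x * W x ∂μ ≤ (∫⁻ x, X x ^ (p / 2) * W x ∂μ) ^ (2 / p) *
      (∫⁻ x, W x ∂μ) ^ (1 - 2 / p) := by
    refine le_trans (le_of_eq (lintegral_congr fun x => ?_)) h
    rw [ENNReal.mul_rpow_of_nonneg _ _ (by positivity), mul_assoc,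
      ← ENNReal.rpow_add_of_nonneg _ _ (by positivity)
        (by rw [sub_nonneg, div_le_one hp0]; exact hp), ← ENNReal.rpow_mul, add_sub_cancel,
      ENNReal.rpow_one, div_mul_div_cancel₀ (by norm_num), div_self hp0.ne', ENNReal.rpow_one]
  refine (ENNReal.rpow_le_rpow h1 (by positivity)).trans_eq ?_
  rw [ENNReal.mul_rpow_of_nonneg _ _ (by positivity), ← ENNReal.rpow_mul, ← ENNReal.rpow_mul,
    div_mul_div_cancel₀ hp0.ne', div_self two_ne_zero, ENNReal.rpow_one]
  congr 2
  field_simp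

/-- With `b` the mean over the envelope and `a` a tube average, the bound on their weighted product
can be solved for `a`. The largest admissible value `M` then recombines with the Hölder factor in
`b` to give exactly `κ ^ p`; this is why the weight parameter has exponents 1/4 and 1/p - 1/4. -/
lemma exists_mass_bound {b κ : ℝ≥0∞} (hb0 : b ≠ 0) (hb : b ≠ ⊤) {p : ℝ} (hp : 2 ≤ p) :
    ∃ M : ℝ≥0∞, (∀ a : ℝ≥0∞, a ^ (1 / 4 : ℝ) * b ^ (1 / p - 1 / 4) ≤ κ → a ≤ M) ∧
      M ^ (p / 4) * b ^ (1 - p / 4) = κ ^ p := by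
  have hp0 : 0 < p := by linarith
  set d := b ^ (1 / p - 1 / 4) with hd
  have hd0 : d ≠ 0 := (ENNReal.rpow_pos (pos_iff_ne_zero.2 hb0) hb).ne'
  have hdt : d ≠ ⊤ := ENNReal.rpow_ne_top_of_ne_zero hb0 hb
  refine ⟨(κ / d) ^ (4 : ℝ), fun a ha => ?_, ?_⟩
  · have h1 : a ^ (1 / 4 : ℝ) ≤ κ / d := (ENNReal.le_div_iff_mul_le (Or.inl hd0) (Or.inl hdt)).2 ha
    have h2 := ENNReal.rpow_le_rpow h1 (by norm_num : (0 : ℝ) ≤ 4)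
    rwa [← ENNReal.rpow_mul, one_div_mul_cancel (by norm_num), ENNReal.rpow_one] at h2
  · have h3 : b ^ (1 - p / 4) = d ^ p := by
      rw [hd, ← ENNReal.rpow_mul]; congr 1; field_simp
    rw [← ENNReal.rpow_mul, h3, mul_div_cancel₀ _ (by norm_num : (4 : ℝ) ≠ 0),
      ← ENNReal.mul_rpow_of_nonneg _ _ hp0.le, ENNReal.div_mul_cancel hd0 hdt]

lemma lintegral_enorm_sq_ne_top (K : 𝓢(Plane, ℂ)) : ∫⁻ y, ‖K y‖ₑ ^ 2 ≠ ⊤ := by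
  have h := (eLpNorm_lt_top_iff_lintegral_rpow_enorm_lt_top (f := (K : Plane → ℂ))
    (μ := volume) (p := 2) (by norm_num) (by norm_num)).1 (K.memLp 2 volume).2
  simpa using h.ne

set_option maxHeartbeats 1000000 in
/-- The weighted estimate on a single envelope, in rescaled coordinates. -/
lemma exists_lintegral_cell_le (χ : 𝓢(Plane, ℂ)) (hχ : ∀ w, χ w ≠ 0 → ‖w‖ ≤ 1 / 16)
    (hχ' : ∀ y : Plane, (∀ i, |y i| ≤ 1 / 2) → 1 / 2 ≤ ‖𝓕 (χ : Plane → ℂ) y‖)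
    {p : ℝ} (hp : 2 ≤ p) (hp4 : p ≤ 4) :
    ∃ C : ℝ≥0∞, C ≠ ⊤ ∧ ∀ (r s c : ℝ) (A B : Finset ℤ) (f : ℤ → Plane → ℂ) (z : Fin 2 → ℤ),
      0 < r → r ≤ s → (∀ m ∈ A ∪ B, |r * m - c| ≤ 130 * s) →
      (∀ m ∈ A ∪ B, HasFourierSupportIn (f m) (block r (r * m))) →
      (s ≤ 8 * r ∨ ∀ m ∈ A, ∀ m' ∈ B, 3 * r + s / 4 ≤ r * (m' - m)) →
      ∀ H : Plane → ℝ≥0∞, AEMeasurable H → ∀ κ : ℝ≥0∞,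
        ∫⁻ y in cell ((r / s) ^ 2) z, H y ≠ ⊤ →
        (∀ z', (∫⁻ y in unitSquare z' ∩ cell ((r / s) ^ 2) z, H y) ^ (1 / 4 : ℝ) *
          (ENNReal.ofReal (((r / s) ^ 2) ^ 2) * ∫⁻ y in cell ((r / s) ^ 2) z, H y) ^
            (1 / p - 1 / 4) ≤ κ) →
        ∫⁻ y in cell ((r / s) ^ 2) z, ‖(∑ m ∈ A, f m (rescaling s c y)) *
            ∑ m ∈ B, f m (rescaling s c y)‖ₑ ^ (p / 2) * H y ≤
          C * κ ^ p * ∫⁻ y, (∑ m ∈ A ∪ B, ‖f m (rescaling s c y)‖ₑ ^ 2) ^ (p / 2) *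
            ‖𝓕 (χ : Plane → ℂ) ((r / s) ^ 2 • y - latticePoint z)‖ₑ ^ 2 := by
  obtain ⟨C, hC, hmain⟩ := exists_lintegral_localized_le χ hχ
  have hP : ∫⁻ y, ‖𝓕 (χ : Plane → ℂ) y‖ₑ ^ 2 ≠ ⊤ := lintegral_enorm_sq_ne_top (𝓕 χ)
  set P := ∫⁻ y, ‖𝓕 (χ : Plane → ℂ) y‖ₑ ^ 2 with hPdef
  refine ⟨(16 * C) ^ (p / 4) * P ^ (p / 2 - 1), ENNReal.mul_ne_top
    (ENNReal.rpow_ne_top_of_nonneg (by linarith) (ENNReal.mul_ne_top (by norm_num) hC))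
    (ENNReal.rpow_ne_top_of_nonneg (by linarith) hP),
    fun r s c A B f z hr hrs hm hf hsep H hH κ hHt hκ => ?_⟩
  have hs : 0 < s := hr.trans_le hrs
  set ρ := (r / s) ^ 2 with hρ
  have hρ0 : 0 < ρ := by positivity
  set E := ENNReal.ofReal (ρ ^ 2) with hE
  have hE0 : E ≠ 0 := by rw [hE]; exact (ENNReal.ofReal_pos.2 (by positivity)).ne'
  have hEt : E ≠ ⊤ := ENNReal.ofReal_ne_top
  set h := ∫⁻ y in cell ρ z, H y with hh
  have hfm : ∀ m ∈ A ∪ B, AEMeasurable fun y => f m (rescaling s c y) := fun m hmA =>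
    (hf m hmA).1.aestronglyMeasurable.aemeasurable.comp_quasiMeasurePreserving
      (quasiMeasurePreserving_linearMap volume (det_rescaling_ne_zero hs.ne' c))
  have hFA : AEMeasurable fun y => ∑ m ∈ A, f m (rescaling s c y) :=
    Finset.aemeasurable_fun_sum _ fun m hmA => hfm m (Finset.mem_union_left _ hmA)
  have hFB : AEMeasurable fun y => ∑ m ∈ B, f m (rescaling s c y) :=
    Finset.aemeasurable_fun_sum _ fun m hmB => hfm m (Finset.mem_union_right _ hmB)
  set ψ : Plane → ℂ := fun y => 𝓕 (χ : Plane → ℂ) (ρ • y - latticePoint z) with hψ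
  have hψm : Measurable fun y => ‖ψ y‖ₑ ^ 2 := by
    have h1 : Continuous ψ := (continuous_fourier χ.integrable).comp
      ((continuous_const_smul ρ).sub continuous_const)
    exact h1.enorm.measurable.pow_const 2
  have hψc : ∀ y ∈ cell ρ z, 1 ≤ 2 * ‖ψ y‖ₑ := by
    intro y hy
    have h1 := hχ' (ρ • y - latticePoint z) (fun i => by simpa [latticePoint] using hy i)
    rw [← ofReal_norm]
    have : (1 : ℝ) ≤ 2 * ‖ψ y‖ := by linarith
    calc (1 : ℝ≥0∞) = ENNReal.ofReal 1 := by simp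
      _ ≤ ENNReal.ofReal (2 * ‖ψ y‖) := ENNReal.ofReal_le_ofReal this
      _ = _ := by rw [ENNReal.ofReal_mul (by norm_num)]; simp
  set X : Plane → ℝ≥0∞ := fun y => ‖(∑ m ∈ A, f m (rescaling s c y)) *
            ∑ m ∈ B, f m (rescaling s c y)‖ₑ with hX
  have hXm : AEMeasurable X := (hFA.mul hFB).enorm
  set S : Plane → ℝ≥0∞ := fun y => ∑ m ∈ A ∪ B, ‖f m (rescaling s c y)‖ₑ ^ 2 with hS
  have hSm : AEMeasurable S :=
    Finset.aemeasurable_fun_sum _ fun m hmA => (hfm m hmA).enorm.pow_const 2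
  -- A weight with no mass on the cell makes the left side vanish; this case is split off because
  -- `exists_mass_bound` divides by a power of the mean.
  by_cases hb0 : E * h = 0
  · have hh0 : h = 0 := (mul_eq_zero.1 hb0).resolve_left hE0
    have h1 : ∀ᵐ y ∂(volume.restrict (cell ρ z)), H y = 0 :=
      (lintegral_eq_zero_iff' hH.restrict).1 hh0
    have h2 : ∫⁻ y in cell ρ z, X y ^ (p / 2) * H y = 0 := by
      rw [lintegral_congr_ae (g := fun _ => 0), lintegral_zero]
      filter_upwards [h1] with y hy
      rw [hy, mul_zero]
    rw [h2]; exact zero_le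
  obtain ⟨M, hM, hMκ⟩ := exists_mass_bound (κ := κ) hb0 (ENNReal.mul_ne_top hEt hHt) hp
  -- The weight is cut off to the cell, so that its masses on unit squares correspond to tubes
  -- intersected with the envelope, as in the definition of the weight parameter.
  have hloc := hmain r s c A B f z hr hrs hm hf hsep ((cell ρ z).indicator H)
    (hH.indicator (measurableSet_cell ρ z)) M (fun z' => by
      rw [setLIntegral_indicator (measurableSet_cell ρ z), Set.inter_comm]
      exact hM _ (hκ z'))
  set Q := ∫⁻ y, S y * ‖ψ y‖ₑ ^ 2 with hQ
  have hQle : ∀ G : Finset ℤ, G ⊆ A ∪ B →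
      ∑ m ∈ G, ∫⁻ y, ‖localized χ (f m) s c ρ z (centre s c) y‖ₑ ^ 2 ≤ Q := by
    intro G hG
    rw [← lintegral_finsetSum']
    · refine lintegral_mono fun y => ?_
      simp only [enorm_localized, mul_pow, ← Finset.sum_mul, hS]
      gcongr
    · intro m hmG
      simp only [enorm_localized, mul_pow]
      exact ((hfm m (hG hmG)).enorm.pow_const 2).mul hψm.aemeasurable
  -- On the cell the bump is at least 1/2 in modulus; inserting it four times costs 2⁴ = 16.
  have hI : ∫⁻ y in cell ρ z, X y ^ 2 * H y ≤ 16 * C * M * E * Q ^ 2 := by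
    calc ∫⁻ y in cell ρ z, X y ^ 2 * H y
        ≤ ∫⁻ y, 16 * (‖(∑ m ∈ A, localized χ (f m) s c ρ z (centre s c) y) *
            ∑ m ∈ B, localized χ (f m) s c ρ z (centre s c) y‖ₑ ^ 2 *
              (cell ρ z).indicator H y) := by
          rw [← lintegral_indicator (measurableSet_cell ρ z)]
          refine lintegral_mono fun y => ?_
          by_cases hy : y ∈ cell ρ z
          · simp only [hy, Set.indicator_of_mem, sum_localized, enorm_mul, enorm_localized]
            have h1 : X y = ‖∑ m ∈ A, f m (rescaling s c y)‖ₑ *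
                ‖∑ m ∈ B, f m (rescaling s c y)‖ₑ := enorm_mul _ _
            rw [h1]
            calc _ = (1 : ℝ≥0∞) ^ 4 * ((‖∑ m ∈ A, f m (rescaling s c y)‖ₑ *
                ‖∑ m ∈ B, f m (rescaling s c y)‖ₑ) ^ 2 * H y) := by rw [one_pow, one_mul]
              _ ≤ (2 * ‖ψ y‖ₑ) ^ 4 * ((‖∑ m ∈ A, f m (rescaling s c y)‖ₑ *
                ‖∑ m ∈ B, f m (rescaling s c y)‖ₑ) ^ 2 * H y) := by
                  gcongr; exact hψc y hy
              _ = _ := by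
                  have h16 : (2 : ℝ≥0∞) ^ 4 = 16 := by norm_num
                  rw [mul_pow, h16]; ring
          · simp [hy]
      _ = 16 * ∫⁻ y, (‖(∑ m ∈ A, localized χ (f m) s c ρ z (centre s c) y) *
            ∑ m ∈ B, localized χ (f m) s c ρ z (centre s c) y‖ₑ ^ 2 *
              (cell ρ z).indicator H y) := lintegral_const_mul' _ _ (by norm_num)
      _ ≤ 16 * (C * M * E * (Q * Q)) := by
          gcongr
          refine hloc.trans ?_
          gcongr
          · exact hQle A Finset.subset_union_left
          · exact hQle B Finset.subset_union_right
      _ = _ := by ring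
  have hQp := rpow_lintegral_weight_le hSm hψm.aemeasurable hp
  rw [← hQ, lintegral_localizer χ hρ0 z, ← hPdef, ← hE] at hQp
  set J := ∫⁻ y, S y ^ (p / 2) * ‖ψ y‖ₑ ^ 2 with hJ
  have hp14 : 0 ≤ 1 - p / 4 := by linarith
  have hp4' : 0 ≤ p / 4 := by linarith
  have hp2' : 0 ≤ p / 2 - 1 := by linarith
  calc ∫⁻ y in cell ρ z, X y ^ (p / 2) * H y
      ≤ (∫⁻ y in cell ρ z, X y ^ 2 * H y) ^ (p / 4) * h ^ (1 - p / 4) :=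
        lintegral_rpow_weight_le hXm.restrict hH.restrict hp hp4
    _ ≤ (16 * C * M * E * Q ^ 2) ^ (p / 4) * (E⁻¹ * (E * h)) ^ (1 - p / 4) := by
        rw [← mul_assoc, ENNReal.inv_mul_cancel hE0 hEt, one_mul]
        gcongr
    _ = (16 * C) ^ (p / 4) * (M ^ (p / 4) * (E * h) ^ (1 - p / 4)) *
          (E ^ (p / 4) * E⁻¹ ^ (1 - p / 4)) * Q ^ (p / 2) := by
        rw [ENNReal.mul_rpow_of_nonneg _ _ hp4', ENNReal.mul_rpow_of_nonneg _ _ hp4',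
          ENNReal.mul_rpow_of_nonneg _ _ hp4', ENNReal.mul_rpow_of_nonneg _ (E * h) hp14,
          ← ENNReal.rpow_natCast, ← ENNReal.rpow_mul Q]
        have : ((2 : ℕ) : ℝ) * (p / 4) = p / 2 := by push_cast; ring
        rw [this]; ring
    _ ≤ (16 * C) ^ (p / 4) * κ ^ p * (E ^ (p / 4) * E⁻¹ ^ (1 - p / 4)) *
          (J * (E⁻¹ * P) ^ (p / 2 - 1)) := by
        rw [hMκ]
        gcongr
    _ = (16 * C) ^ (p / 4) * P ^ (p / 2 - 1) * κ ^ p * J *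
          (E ^ (p / 4) * E⁻¹ ^ (1 - p / 4) * E⁻¹ ^ (p / 2 - 1)) := by
        rw [ENNReal.mul_rpow_of_nonneg _ _ hp2']; ring
    _ = _ := by
        -- Scale invariance: the transversality gain, the normalization of the mean and the mass of
        -- the squared bump contribute powers of `E = ρ²` whose exponents sum to zero.
        have : E ^ (p / 4) * E⁻¹ ^ (1 - p / 4) * E⁻¹ ^ (p / 2 - 1) = 1 := by
          rw [ENNReal.inv_rpow, ENNReal.inv_rpow, ← ENNReal.rpow_neg, ← ENNReal.rpow_neg,
            ← ENNReal.rpow_add _ _ hE0 hEt, ← ENNReal.rpow_add _ _ hE0 hEt]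
          have : p / 4 + -(1 - p / 4) + -(p / 2 - 1) = 0 := by ring
          rw [this, ENNReal.rpow_zero]
        rw [this, mul_one]

/-- The weighted estimate for a pair of pieces, summed over all envelopes. -/
lemma exists_lintegral_pair_le {p : ℝ} (hp : 2 ≤ p) (hp4 : p ≤ 4) :
    ∃ C : ℝ≥0∞, C ≠ ⊤ ∧ ∀ (r s c : ℝ) (A B : Finset ℤ) (f : ℤ → Plane → ℂ),
      0 < r → r ≤ s → (∀ m ∈ A ∪ B, |r * m - c| ≤ 130 * s) →
      (∀ m ∈ A ∪ B, HasFourierSupportIn (f m) (block r (r * m))) →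
      (s ≤ 8 * r ∨ ∀ m ∈ A, ∀ m' ∈ B, 3 * r + s / 4 ≤ r * (m' - m)) →
      ∀ H : Plane → ℝ≥0∞, AEMeasurable H → ∀ κ : ℝ≥0∞,
        (∀ z, ∫⁻ y in cell ((r / s) ^ 2) z, H (rescaling s c y) ≠ ⊤) →
        (∀ z z', (∫⁻ y in unitSquare z' ∩ cell ((r / s) ^ 2) z, H (rescaling s c y)) ^
            (1 / 4 : ℝ) *
          (ENNReal.ofReal (((r / s) ^ 2) ^ 2) *
            ∫⁻ y in cell ((r / s) ^ 2) z, H (rescaling s c y)) ^ (1 / p - 1 / 4) ≤ κ) →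
        ∫⁻ x, ‖(∑ m ∈ A, f m x) * ∑ m ∈ B, f m x‖ₑ ^ (p / 2) * H x ≤
          C * κ ^ p * ∫⁻ x, (∑ m ∈ A ∪ B, ‖f m x‖ₑ ^ 2) ^ (p / 2) := by
  obtain ⟨χ, hχ, hχ'⟩ := exists_localizer
  obtain ⟨C, hC, hcell⟩ := exists_lintegral_cell_le χ hχ hχ' hp hp4
  obtain ⟨C', hC', hsum⟩ := exists_tsum_localizer_le χ
  refine ⟨C * C', ENNReal.mul_ne_top hC hC', fun r s c A B f hr hrs hm hf hsep H hH κ hHt hκ => ?_⟩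
  have hs : 0 < s := hr.trans_le hrs
  have hdet := det_rescaling_ne_zero hs.ne' c
  have hqm := quasiMeasurePreserving_linearMap (volume : Measure Plane) hdet
  set D := ENNReal.ofReal |(LinearMap.det (rescaling s c))⁻¹| with hD
  have hD0 : D ≠ 0 := (ENNReal.ofReal_pos.2 (abs_pos.2 (inv_ne_zero hdet))).ne'
  have hDt : D ≠ ⊤ := ENNReal.ofReal_ne_top
  have hfm : ∀ m ∈ A ∪ B, AEMeasurable fun y => f m (rescaling s c y) := fun m hmA =>
    (hf m hmA).1.aestronglyMeasurable.aemeasurable.comp_quasiMeasurePreserving hqm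
  have hSm : AEMeasurable fun y => (∑ m ∈ A ∪ B, ‖f m (rescaling s c y)‖ₑ ^ 2) ^ (p / 2) :=
    (Finset.aemeasurable_fun_sum _ fun m hmA => (hfm m hmA).enorm.pow_const 2).pow_const _
  have hψm : ∀ z, Measurable fun y => ‖𝓕 (χ : Plane → ℂ)
      ((r / s) ^ 2 • y - latticePoint z)‖ₑ ^ 2 := fun z => by
    have h1 : Continuous fun y => 𝓕 (χ : Plane → ℂ) ((r / s) ^ 2 • y - latticePoint z) :=
      (continuous_fourier χ.integrable).comp ((continuous_const_smul _).sub continuous_const)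
    exact h1.enorm.measurable.pow_const 2
  have h1 := lintegral_comp_linearMap (volume : Measure Plane) hdet
    (fun x => ‖(∑ m ∈ A, f m x) * ∑ m ∈ B, f m x‖ₑ ^ (p / 2) * H x)
  have h2 := lintegral_comp_linearMap (volume : Measure Plane) hdet
    (fun x => (∑ m ∈ A ∪ B, ‖f m x‖ₑ ^ 2) ^ (p / 2))
  rw [← ENNReal.mul_le_mul_iff_right hD0 hDt, ← h1]
  calc _ = ∫⁻ y in ⋃ z, cell ((r / s) ^ 2) z, ‖(∑ m ∈ A, f m (rescaling s c y)) *
            ∑ m ∈ B, f m (rescaling s c y)‖ₑ ^ (p / 2) * H (rescaling s c y) := by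
        rw [iUnion_cell, setLIntegral_univ]
    _ ≤ ∑' z, ∫⁻ y in cell ((r / s) ^ 2) z, ‖(∑ m ∈ A, f m (rescaling s c y)) *
            ∑ m ∈ B, f m (rescaling s c y)‖ₑ ^ (p / 2) * H (rescaling s c y) :=
        lintegral_iUnion_le _ _
    _ ≤ ∑' z, C * κ ^ p * ∫⁻ y, (∑ m ∈ A ∪ B, ‖f m (rescaling s c y)‖ₑ ^ 2) ^ (p / 2) *
            ‖𝓕 (χ : Plane → ℂ) ((r / s) ^ 2 • y - latticePoint z)‖ₑ ^ 2 :=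
        ENNReal.tsum_le_tsum fun z => hcell r s c A B f z hr hrs hm hf hsep _
          (hH.comp_quasiMeasurePreserving hqm) κ (hHt z) (hκ z)
    _ = C * κ ^ p * ∫⁻ y, (∑ m ∈ A ∪ B, ‖f m (rescaling s c y)‖ₑ ^ 2) ^ (p / 2) *
            ∑' z, ‖𝓕 (χ : Plane → ℂ) ((r / s) ^ 2 • y - latticePoint z)‖ₑ ^ 2 := by
        rw [ENNReal.tsum_mul_left, ← lintegral_tsum fun z => hSm.fun_mul (hψm z).aemeasurable]
        simp_rw [ENNReal.tsum_mul_left]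
    _ ≤ C * κ ^ p * ∫⁻ y, (∑ m ∈ A ∪ B, ‖f m (rescaling s c y)‖ₑ ^ 2) ^ (p / 2) * C' := by
        gcongr
        exact hsum _
    _ = _ := by
        rw [lintegral_mul_const'' _ hSm, h2]; ring

/-! ### Translation of the weight parameters into masses in rescaled coordinates. -/

lemma volume_unitSquare (z : Fin 2 → ℤ) : volume (unitSquare z) = 1 := by
  have hpre : unitSquare z = (MeasurableEquiv.toLp 2 (Fin 2 → ℝ)).symm ⁻¹'
      (Set.Icc (fun i => (z i : ℝ) - 1 / 2) fun i => (z i : ℝ) + 1 / 2) := by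
    ext x
    simp only [unitSquare, Set.mem_ofPred_eq, Set.mem_preimage, Set.mem_Icc, Pi.le_def, abs_le,
      ← forall_and]
    refine forall_congr' fun i => ?_
    change _ ↔ (z i : ℝ) - 1 / 2 ≤ x i ∧ x i ≤ z i + 1 / 2
    constructor <;> rintro ⟨h1, h2⟩ <;> constructor <;> linarith
  rw [hpre, (EuclideanSpace.volume_preserving_symm_measurableEquiv_toLp (Fin 2)).measure_preimage
    measurableSet_Icc.nullMeasurableSet, Real.volume_Icc_pi]
  simp
  norm_num

lemma volume_cell {ρ : ℝ} (hρ : 0 < ρ) (z : Fin 2 → ℤ) :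
    volume (cell ρ z) = ENNReal.ofReal ((ρ ^ 2)⁻¹) := by
  have h := Measure.addHaar_preimage_smul (volume : Measure Plane) hρ.ne' (unitSquare z)
  rw [volume_unitSquare, finrank_euclideanSpace, Fintype.card_fin, mul_one,
    abs_of_pos (by positivity)] at h
  exact h

/-- The rescaling is linear and commutes with dilation, so dilated tubes correspond to cells. -/
lemma smul_rescaling_image {ρ : ℝ} (hρ : 0 < ρ) (s c : ℝ) (z : Fin 2 → ℤ) :
    ρ⁻¹ • (rescaling s c '' unitSquare z) = rescaling s c '' cell ρ z := by
  ext x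
  simp only [Set.mem_smul_set, Set.mem_image]
  constructor
  · rintro ⟨_, ⟨y, hy, rfl⟩, rfl⟩
    refine ⟨ρ⁻¹ • y, ?_, by rw [map_smul]⟩
    simpa [cell, smul_smul, mul_inv_cancel₀ hρ.ne'] using hy
  · rintro ⟨y, hy, rfl⟩
    exact ⟨_, ⟨ρ • y, hy, rfl⟩, by rw [map_smul, smul_smul, inv_mul_cancel₀ hρ.ne', one_smul]⟩

lemma volume_real_rescaling_image {s : ℝ} (hs : 0 < s) (c : ℝ) (X : Set Plane) :
    volume.real (rescaling s c '' X) = (s ^ 3)⁻¹ * volume.real X := by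
  rw [Measure.real, Measure.addHaar_image_linearMap, det_rescaling, abs_of_pos (by positivity),
    ENNReal.toReal_mul, ENNReal.toReal_ofReal (by positivity), Measure.real]

lemma volume_rescaling_image_ne_top (s c : ℝ) {X : Set Plane} (hX : volume X ≠ ⊤) :
    volume (rescaling s c '' X) ≠ ⊤ := by
  rw [Measure.addHaar_image_linearMap]
  exact ENNReal.mul_ne_top ENNReal.ofReal_ne_top hX

lemma setIntegral_rescaling_image {s : ℝ} (hs : 0 < s) (c : ℝ) {X : Set Plane}
    (hX : MeasurableSet X) {H : Plane → ℝ} (hH : AEMeasurable H) (h0 : ∀ x, 0 ≤ H x) :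
    ∫ x in rescaling s c '' X, H x =
      (s ^ 3)⁻¹ * (∫⁻ y in X, ENNReal.ofReal (H (rescaling s c y))).toReal := by
  have hdet := det_rescaling_ne_zero hs.ne' c
  have hemb := measurableEmbedding_of_det_ne_zero hdet
  rw [integral_eq_lintegral_of_nonneg_ae (Filter.Eventually.of_forall h0)
    hH.aestronglyMeasurable.restrict]
  have hLX : MeasurableSet (rescaling s c '' X) := hemb.measurableSet_image.2 hX
  have h := lintegral_comp_linearMap (volume : Measure Plane) hdet
    ((rescaling s c '' X).indicator fun x => ENNReal.ofReal (H x))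
  rw [lintegral_indicator hLX, det_rescaling, inv_inv, abs_of_pos (by positivity)] at h
  have h2 : ∀ y, (rescaling s c '' X).indicator (fun x => ENNReal.ofReal (H x))
      (rescaling s c y) = X.indicator (fun y => ENNReal.ofReal (H (rescaling s c y))) y := by
    intro y
    by_cases hy : y ∈ X
    · rw [Set.indicator_of_mem hy, Set.indicator_of_mem (Set.mem_image_of_mem _ hy)]
    · rw [Set.indicator_of_notMem hy, Set.indicator_of_notMem]
      rwa [hemb.injective.mem_set_image]
  simp_rw [h2] at h
  rw [lintegral_indicator hX] at h
  rw [h, ENNReal.toReal_mul, ENNReal.toReal_ofReal (by positivity),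
    inv_mul_cancel_left₀ (by positivity)]

lemma average_le_one {H : Plane → ℝ} (hH : ∀ x, H x ∈ Set.Icc (0 : ℝ) 1) {S T : Set Plane}
    (hST : S ⊆ T) (hT : volume T ≠ ⊤) :
    0 ≤ (∫ x in S, H x) / volume.real T ∧ (∫ x in S, H x) / volume.real T ≤ 1 := by
  have h0 : 0 ≤ ∫ x in S, H x := integral_nonneg fun x => (hH x).1
  refine ⟨div_nonneg h0 measureReal_nonneg, div_le_one_of_le₀ ?_ measureReal_nonneg⟩
  have h1 := norm_setIntegral_le_of_norm_le_const (μ := volume) (f := H) (C := 1)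
    ((measure_mono hST).trans_lt hT.lt_top) fun x _ => by
      rw [Real.norm_eq_abs, abs_of_nonneg (hH x).1]; exact (hH x).2
  rw [one_mul, Real.norm_eq_abs, abs_of_nonneg h0] at h1
  exact h1.trans (measureReal_mono hST hT)

/-- Provides the upper bound needed to compare single terms with the real suprema in `kappa` and
`kappaSup`, which would be meaningless for unbounded families. -/
lemma kappa_term_le_one {H : Plane → ℝ} (hH : ∀ x, H x ∈ Set.Icc (0 : ℝ) 1) {p : ℝ} (hp : 2 ≤ p)
    (hp4 : p ≤ 4) {s c : ℝ} {U : Set Plane} (hU : volume U ≠ ⊤) (T : tubes s c) :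
    ((∫ x in (T : Set Plane) ∩ U, H x) / volume.real (T : Set Plane)) ^ (1 / 4 : ℝ) *
      ((∫ x in U, H x) / volume.real U) ^ (1 / p - 1 / 4) ≤ 1 := by
  obtain ⟨T, z, rfl⟩ := T
  have hT : volume (rescaling s c '' unitSquare z) ≠ ⊤ :=
    volume_rescaling_image_ne_top s c (by rw [volume_unitSquare]; simp)
  obtain ⟨a0, a1⟩ := average_le_one hH (Set.inter_subset_left (s := _) (t := U)) hT
  obtain ⟨b0, b1⟩ := average_le_one hH (subset_refl U) hU
  have hp' : 0 ≤ 1 / p - 1 / 4 := by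
    rw [sub_nonneg]; exact one_div_le_one_div_of_le (by linarith) hp4
  exact mul_le_one₀ (Real.rpow_le_one a0 a1 (by norm_num)) (Real.rpow_nonneg b0 _)
    (Real.rpow_le_one b0 b1 hp')

lemma scales_pos {R s : ℝ} (hR : 0 < R) (hs : s ∈ scales R) : 0 < s :=
  lt_of_lt_of_le (by positivity) hs.2

/-- The hypothesis of the pair estimate holds with the supremum of the weight parameters. -/
lemma kappaSup_bound {R : ℝ} (hR : 0 < R) {H : Plane → ℝ} (hHm : AEMeasurable H)
    (hH : ∀ x, H x ∈ Set.Icc (0 : ℝ) 1) {p : ℝ} (hp : 2 ≤ p) (hp4 : p ≤ 4) {s : ℝ}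
    (hs : s ∈ scales R) {m : ℤ} (hm : m ∈ blockIndices s) (z z' : Fin 2 → ℤ) :
    (∫⁻ y in unitSquare z' ∩ cell (((√R)⁻¹ / s) ^ 2) z,
        ENNReal.ofReal (H (rescaling s (s * m) y))) ^ (1 / 4 : ℝ) *
      (ENNReal.ofReal ((((√R)⁻¹ / s) ^ 2) ^ 2) * ∫⁻ y in cell (((√R)⁻¹ / s) ^ 2) z,
        ENNReal.ofReal (H (rescaling s (s * m) y))) ^ (1 / p - 1 / 4) ≤
      ENNReal.ofReal (kappaSup p H R) := by
  have hs0 := scales_pos hR hs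
  have hp' : 0 ≤ 1 / p - 1 / 4 := by
    rw [sub_nonneg]; exact one_div_le_one_div_of_le (by linarith) hp4
  set ρ := ((√R)⁻¹ / s) ^ 2 with hρdef
  have hρ : 0 < ρ := by positivity
  have hρi : ρ⁻¹ = R * s ^ 2 := by
    rw [hρdef, div_pow, inv_pow, Real.sq_sqrt hR.le]; field_simp
  set L := rescaling s (s * m) with hL
  set U := L '' cell ρ z with hU
  have hUenv : U ∈ envelopes R s (s * m) :=
    ⟨L '' unitSquare z, ⟨z, rfl⟩, by rw [← hρi, smul_rescaling_image hρ]⟩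
  have hcellt : volume (cell ρ z) ≠ ⊤ := by rw [volume_cell hρ]; exact ENNReal.ofReal_ne_top
  have hUt : ∀ s c, ∀ U ∈ envelopes R s c, volume U ≠ ⊤ := by
    rintro s c U ⟨T, ⟨z, rfl⟩, rfl⟩
    rw [Measure.addHaar_smul]
    exact ENNReal.mul_ne_top ENNReal.ofReal_ne_top
      (volume_rescaling_image_ne_top s c (by rw [volume_unitSquare]; simp))
  have hfin : ∀ X ⊆ cell ρ z, ∫⁻ y in X, ENNReal.ofReal (H (L y)) ≠ ⊤ := by
    intro X hX
    refine ne_top_of_le_ne_top hcellt ?_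
    calc _ ≤ ∫⁻ y in X, 1 := lintegral_mono fun y => by
            simpa using (hH (L y)).2
      _ = volume X := by simp
      _ ≤ _ := measure_mono hX
  have hinj := (measurableEmbedding_of_det_ne_zero
    (det_rescaling_ne_zero hs0.ne' (s * m))).injective
  -- The Jacobians in numerator and denominator cancel, here and for the mean over the envelope;
  -- there the area ρ⁻² of the cell supplies the factor ρ².
  have ha : (∫ x in (L '' unitSquare z') ∩ U, H x) / volume.real (L '' unitSquare z') =
      (∫⁻ y in unitSquare z' ∩ cell ρ z, ENNReal.ofReal (H (L y))).toReal := by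
    rw [hU, ← Set.image_inter hinj, setIntegral_rescaling_image hs0 _
      ((measurableSet_unitSquare z').inter (measurableSet_cell ρ z)) hHm fun x => (hH x).1,
      volume_real_rescaling_image hs0, Measure.real, volume_unitSquare]
    simp only [ENNReal.toReal_one, mul_one]
    rw [mul_div_cancel_left₀ _ (by positivity)]
  have hb : (∫ x in U, H x) / volume.real U =
      (ENNReal.ofReal (ρ ^ 2) * ∫⁻ y in cell ρ z, ENNReal.ofReal (H (L y))).toReal := by
    rw [hU, setIntegral_rescaling_image hs0 _ (measurableSet_cell ρ z) hHm fun x => (hH x).1,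
      volume_real_rescaling_image hs0, Measure.real, volume_cell hρ,
      ENNReal.toReal_ofReal (by positivity), ENNReal.toReal_mul,
      ENNReal.toReal_ofReal (by positivity)]
    field_simp
    rw [hL]
  have h1 : ((∫ x in (L '' unitSquare z') ∩ U, H x) / volume.real (L '' unitSquare z')) ^
      (1 / 4 : ℝ) * ((∫ x in U, H x) / volume.real U) ^ (1 / p - 1 / 4) ≤ kappaSup p H R := by
    calc _ ≤ kappa p H s (s * m) U :=
          le_ciSup (f := fun T : tubes s (s * m) =>
            ((∫ x in (T : Set Plane) ∩ U, H x) / volume.real (T : Set Plane)) ^ (1 / 4 : ℝ) *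
            ((∫ x in U, H x) / volume.real U) ^ (1 / p - 1 / 4))
            ⟨1, by
              rintro _ ⟨T, rfl⟩
              exact kappa_term_le_one hH hp hp4 (hUt _ _ U hUenv) T⟩
            ⟨L '' unitSquare z', z', rfl⟩
      _ ≤ _ := by
          refine le_csSup ⟨1, ?_⟩ ⟨s, hs, m, hm, U, hUenv, rfl⟩
          rintro _ ⟨s', -, m', -, U', hU', rfl⟩
          exact Real.iSup_le (fun T => kappa_term_le_one hH hp hp4 (hUt _ _ U' hU') T) zero_le_one
  rw [ha, hb] at h1
  refine le_trans (le_of_eq ?_) (ENNReal.ofReal_le_ofReal h1)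
  rw [ENNReal.ofReal_mul (by positivity), ← ENNReal.ofReal_rpow_of_nonneg (by positivity)
    (by norm_num), ← ENNReal.ofReal_rpow_of_nonneg (by positivity) hp',
    ENNReal.ofReal_toReal (hfin _ Set.inter_subset_right), ENNReal.ofReal_toReal
    (ENNReal.mul_ne_top ENNReal.ofReal_ne_top (hfin _ (subset_refl _)))]

lemma lintegral_cell_ne_top {H : Plane → ℝ} (hH : ∀ x, H x ∈ Set.Icc (0 : ℝ) 1) {ρ : ℝ}
    (hρ : 0 < ρ) (s c : ℝ) (z : Fin 2 → ℤ) :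
    ∫⁻ y in cell ρ z, ENNReal.ofReal (H (rescaling s c y)) ≠ ⊤ := by
  refine ne_top_of_le_ne_top (b := volume (cell ρ z)) ?_ ?_
  · rw [volume_cell hρ]; exact ENNReal.ofReal_ne_top
  · calc _ ≤ ∫⁻ y in cell ρ z, 1 := lintegral_mono fun y => by
            simpa using (hH (rescaling s c y)).2
      _ = volume (cell ρ z) := by simp

/-! ### Dyadic intervals of indices and the broad-narrow inequality. -/

/-- The indices of `S` in the `k`-th dyadic interval of length `2 ^ i`. -/
def dyadicPart (S : Finset ℤ) (i : ℕ) (k : ℤ) : Finset ℤ := {m ∈ S | m / 2 ^ i = k}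

lemma sum_dyadicPart_succ (S : Finset ℤ) (a : ℤ → ℂ) (i : ℕ) (k : ℤ) :
    ∑ m ∈ dyadicPart S (i + 1) k, a m =
      ∑ m ∈ dyadicPart S i (2 * k), a m + ∑ m ∈ dyadicPart S i (2 * k + 1), a m := by
  have hdisj : Disjoint (dyadicPart S i (2 * k)) (dyadicPart S i (2 * k + 1)) := by
    rw [Finset.disjoint_left]
    intro m h1 h2
    simp only [dyadicPart, Finset.mem_filter] at h1 h2
    omega
  rw [← Finset.sum_union hdisj]
  congr 1
  ext m
  simp only [dyadicPart, Finset.mem_filter, Finset.mem_union, ← and_or_left]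
  refine and_congr_right fun _ => ?_
  rw [pow_succ, ← Int.ediv_ediv_of_nonneg (by positivity)]
  omega

lemma sum_eq_dyadicPart_top (S : Finset ℤ) (a : ℤ → ℂ) {n : ℕ}
    (hS : ∀ m ∈ S, -2 ^ n ≤ m ∧ m < 2 ^ n) :
    ∑ m ∈ S, a m = ∑ m ∈ dyadicPart S n (-1), a m + ∑ m ∈ dyadicPart S n 0, a m := by
  have hdisj : Disjoint (dyadicPart S n (-1)) (dyadicPart S n 0) := by
    rw [Finset.disjoint_left]
    intro m h1 h2
    simp only [dyadicPart, Finset.mem_filter] at h1 h2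
    omega
  rw [← Finset.sum_union hdisj]
  congr 1
  -- Integer division rounds down, so at level `n` negative indices fall in the interval -1 and
  -- nonnegative ones in the interval 0.
  ext m
  simp only [dyadicPart, Finset.mem_filter, Finset.mem_union, ← and_or_left]
  refine ⟨fun h => ⟨h, ?_⟩, fun h => h.1⟩
  obtain ⟨h1, h2⟩ := hS m h
  have hpos : (0 : ℤ) < 2 ^ n := by positivity
  rcases lt_or_ge m 0 with h0 | h0
  · left
    refine le_antisymm ?_ ?_
    · have := Int.ediv_neg_of_neg_of_pos h0 hpos; omega
    · rw [Int.le_ediv_iff_mul_le hpos]; linarith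
  · right
    exact Int.ediv_eq_zero_of_lt h0 h2

/-- One step of the broad-narrow alternative for four consecutive pieces. -/
lemma norm_add_four_le {a b c d : ℂ} {X B ε : ℝ} (hε : 0 ≤ ε) (hX : 0 ≤ X) (hXB : B ≤ ε * X)
    (hB : 0 ≤ B) (hab : ‖a + b‖ ≤ X) (hbc : ‖b + c‖ ≤ X) (hcd : ‖c + d‖ ≤ X)
    (hac : ‖a * c‖ ≤ B ^ 2) (had : ‖a * d‖ ≤ B ^ 2) (hbd : ‖b * d‖ ≤ B ^ 2) :
    ‖a + b + (c + d)‖ ≤ (1 + 2 * ε) * X := by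
  -- Of two nonadjacent pieces at least one is at most `ε * X`. The pieces exceeding this are
  -- therefore contained in one adjacent pair, whose sum is at most `X`, and the other two are
  -- small.
  have key : ∀ x y : ℂ, ‖x * y‖ ≤ B ^ 2 → ‖x‖ ≤ ε * X ∨ ‖y‖ ≤ ε * X := by
    intro x y h
    by_contra! h2
    rw [norm_mul] at h
    have h3 : 0 ≤ ε * X := by positivity
    nlinarith [mul_pos (sub_pos.2 h2.1) (sub_pos.2 h2.2)]
  have e1 : ‖a + b + (c + d)‖ ≤ ‖a + b‖ + (‖c‖ + ‖d‖) :=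
    (norm_add_le _ _).trans (by gcongr; exact norm_add_le _ _)
  have e2 : ‖a + b + (c + d)‖ ≤ ‖a‖ + ‖b‖ + ‖c + d‖ :=
    (norm_add_le _ _).trans (by gcongr; exact norm_add_le _ _)
  have e3 : ‖a + b + (c + d)‖ ≤ ‖a‖ + ‖b + c‖ + ‖d‖ := by
    have : a + b + (c + d) = a + (b + c) + d := by ring
    rw [this]
    exact (norm_add_le _ _).trans (by gcongr; exact norm_add_le _ _)
  rcases key a c hac with h1 | h1 <;> rcases key a d had with h2 | h2 <;>
    rcases key b d hbd with h3 | h3 <;> linarith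

/-- A sum is controlled by its pieces of the smallest scale and by products of separated pieces
of intermediate scales. -/
lemma norm_sum_le_broad_narrow (S : Finset ℤ) (a : ℤ → ℂ) {n : ℕ} (hn : 2 ≤ n)
    (hS : ∀ m ∈ S, -2 ^ n ≤ m ∧ m < 2 ^ n) {B : ℝ} (hB : 0 ≤ B)
    (hN : ∀ k, ‖∑ m ∈ dyadicPart S 2 k, a m‖ ≤ B)
    (hbr : ∀ i, 2 ≤ i → i < n → ∀ k, ∀ d ∈ ({2, 3} : Finset ℤ),
      ‖(∑ m ∈ dyadicPart S i k, a m) * ∑ m ∈ dyadicPart S i (k + d), a m‖ ≤ B ^ 2) :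
    ‖∑ m ∈ S, a m‖ ≤ Real.exp 2 * (2 * n) * B := by
  have hn0 : (0 : ℝ) < n := by positivity
  -- The choice ε = 1/n balances the losses: the factors 1 + 2ε accumulate to at most e², while the
  -- starting bound `2 * n * B` ensures `B ≤ ε * X` at every level.
  set ε : ℝ := (n : ℝ)⁻¹ with hε
  have hε0 : 0 < ε := by positivity
  have hn2 : (2 : ℝ) ≤ n := by exact_mod_cast hn
  have hBn : B ≤ ε * (2 * n * B) := by
    have : ε * (2 * n * B) = 2 * B := by rw [hε]; field_simp
    linarith
  -- Adjacent pairs are carried through the induction because products of neighbours are not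
  -- controlled. An adjacent pair one level up consists of four consecutive pieces, and a single
  -- interval one level up is itself an adjacent pair.
  have main : ∀ j : ℕ, 2 + j ≤ n → ∀ k,
      ‖∑ m ∈ dyadicPart S (2 + j) k, a m‖ ≤ (1 + 2 * ε) ^ j * (2 * n * B) ∧
      ‖∑ m ∈ dyadicPart S (2 + j) k, a m + ∑ m ∈ dyadicPart S (2 + j) (k + 1), a m‖ ≤
        (1 + 2 * ε) ^ j * (2 * n * B) := by
    intro j
    induction j with
    | zero =>
      intro _ k
      rw [pow_zero, one_mul, add_zero]
      have h1 := hN k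
      have h2 := hN (k + 1)
      have h3 : 2 * B ≤ 2 * n * B := by nlinarith
      exact ⟨by linarith, (norm_add_le _ _).trans (by linarith)⟩
    | succ j ih =>
      intro hj k
      have ih := ih (by omega)
      have hbr := hbr (2 + j) (by omega) (by omega)
      set X := (1 + 2 * ε) ^ j * (2 * n * B) with hX
      have hX0 : 0 ≤ X := by positivity
      have hX1 : 2 * n * B ≤ X :=
        le_mul_of_one_le_left (by positivity) (one_le_pow₀ (by linarith))
      have hXB : B ≤ ε * X := hBn.trans (by gcongr)
      have hpow : (1 + 2 * ε) ^ (j + 1) * (2 * n * B) = (1 + 2 * ε) * X := by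
        rw [hX, pow_succ]; ring
      rw [hpow, ← add_assoc, sum_dyadicPart_succ, sum_dyadicPart_succ]
      have e1 : 2 * (k + 1) = 2 * k + 2 := by ring
      have e2 : 2 * (k + 1) + 1 = 2 * k + 3 := by ring
      rw [e2, e1]
      have e3 : 2 * k + 1 + 1 = 2 * k + 2 := by ring
      have e4 : 2 * k + 2 + 1 = 2 * k + 3 := by ring
      have e5 : 2 * k + 1 + 2 = 2 * k + 3 := by ring
      have p1 := (ih (2 * k)).2
      have p2 := (ih (2 * k + 1)).2
      have p3 := (ih (2 * k + 2)).2
      rw [e3] at p2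
      rw [e4] at p3
      have q3 := hbr (2 * k + 1) 2 (by simp)
      rw [e5] at q3
      refine ⟨p1.trans (by nlinarith), ?_⟩
      exact norm_add_four_le hε0.le hX0 hXB hB p1 p2 p3 (hbr (2 * k) 2 (by simp))
        (hbr (2 * k) 3 (by simp)) q3
  obtain ⟨j, rfl⟩ := Nat.exists_eq_add_of_le hn
  have h := (main j le_rfl (-1)).2
  rw [sum_eq_dyadicPart_top S a hS]
  have hneg : (-1 : ℤ) + 1 = 0 := by norm_num
  rw [hneg] at h
  refine h.trans ?_
  rw [mul_assoc (Real.exp 2)]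
  gcongr
  calc (1 + 2 * ε) ^ j ≤ (Real.exp (2 * ε)) ^ j := by
        gcongr; rw [add_comm]; exact Real.add_one_le_exp _
    _ = Real.exp (j * (2 * ε)) := (Real.exp_nat_mul _ _).symm
    _ ≤ Real.exp 2 := by
        refine Real.exp_le_exp.2 ?_
        have : (j : ℝ) * ε ≤ 1 := by
          rw [hε, ← div_eq_mul_inv, div_le_one hn0]; push_cast; linarith
        linarith

/-! ### Choice of levels, scales and centres; the estimate for one dyadic pair. -/

lemma exists_levels {R : ℝ} (hR : 2 ≤ R) :
    ∃ n : ℕ, 2 ≤ n ∧ ⌈√R⌉ < 2 ^ n ∧ (2 : ℝ) ^ n * (√R)⁻¹ ≤ 32 ∧ (n : ℝ) ≤ 9 * Real.log R := by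
  have hs1 : 1 ≤ √R := Real.one_le_sqrt.2 (by linarith)
  have hs0 : 0 < √R := by linarith
  set q := Nat.clog 2 (⌈√R⌉₊ + 1) with hq
  have hc0 : 1 ≤ ⌈√R⌉₊ := Nat.one_le_ceil_iff.2 hs0
  have hq1 : 0 < q := Nat.clog_pos (by norm_num) (by omega)
  have h1 : ⌈√R⌉₊ + 1 ≤ 2 ^ q := Nat.le_pow_clog (by norm_num) _
  have h2 : 2 ^ (q - 1) < ⌈√R⌉₊ + 1 := Nat.pow_pred_clog_lt_self (by norm_num) (by omega)
  have h3 : (⌈√R⌉₊ : ℝ) < √R + 1 := Nat.ceil_lt_add_one hs0.le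
  have h4 : (2 : ℝ) ^ (q + 1) ≤ 12 * √R := by
    have e : (2 : ℝ) ^ (q + 1) = 4 * 2 ^ (q - 1) := by
      obtain ⟨t, ht⟩ : ∃ t, q = t + 1 := ⟨q - 1, by omega⟩
      rw [ht]; simp only [Nat.add_sub_cancel]; ring
    have h2' : ((2 : ℝ) ^ (q - 1)) < ⌈√R⌉₊ + 1 := by exact_mod_cast h2
    rw [e]; linarith
  refine ⟨q + 1, by omega, ?_, ?_, ?_⟩
  · have e : (⌈√R⌉ : ℤ) = (⌈√R⌉₊ : ℤ) := (Int.natCast_ceil_eq_ceil hs0.le).symm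
    rw [e]
    have : ⌈√R⌉₊ < 2 ^ (q + 1) := by
      have := Nat.pow_le_pow_right (by norm_num : 0 < 2) (Nat.le_succ q)
      omega
    exact_mod_cast this
  · rw [← div_eq_mul_inv, div_le_iff₀ hs0]; linarith
  · have hl2 := Real.log_two_gt_d9
    have hl : Real.log 2 ≤ Real.log R := Real.log_le_log (by norm_num) hR
    have hsR : √R ≤ R := Real.sqrt_le_iff.2 ⟨by linarith, by nlinarith⟩
    have h5 : (2 : ℝ) ^ (q + 1) ≤ 2 ^ 4 * R := by linarith
    have h6 := Real.log_le_log (by positivity) h5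
    rw [Real.log_pow, Real.log_mul (by norm_num) (by linarith), Real.log_pow] at h6
    push_cast at h6 ⊢
    have h7 : ((q : ℝ) + 1) * Real.log 2 ≤ 5 * Real.log R := by linarith
    nlinarith

/-- Admissible scales do not exceed 1, whereas interval lengths can reach 32; the scale 1 then
serves all longer intervals, which explains the factor 32. -/
lemma exists_scale {R l : ℝ} (hR : 2 ≤ R) (hl : (√R)⁻¹ ≤ l) (hl32 : l ≤ 32) :
    ∃ s ∈ scales R, l ≤ 32 * s ∧ s ≤ 2 * l ∧ s ≤ 1 := by
  have hs1 : 1 ≤ √R := Real.one_le_sqrt.2 (by linarith)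
  have hl0 : 0 < l := lt_of_lt_of_le (by positivity) hl
  rcases le_or_gt l 1 with h | h
  · obtain ⟨j, h1, h2⟩ := exists_nat_pow_near_of_lt_one hl0 h (by norm_num : (0 : ℝ) < 1 / 2)
      (by norm_num)
    refine ⟨(1 / 2) ^ j, ⟨⟨j, rfl⟩, hl.trans h2⟩, by linarith, ?_,
      pow_le_one₀ (by norm_num) (by norm_num)⟩
    rw [pow_succ] at h1; linarith
  · exact ⟨1, ⟨⟨0, by simp⟩, inv_le_one_of_one_le₀ hs1⟩, by linarith, by linarith, le_rfl⟩

/-- Rounding `x / s` down may leave the permitted indices by at most one step, because `|x| ≤ 1 +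
s`; in that case the extreme index is still close enough. -/
lemma exists_centre {s x : ℝ} (hs : 0 < s) (hx : |x| ≤ 1 + s) :
    ∃ m ∈ blockIndices s, |s * m - x| ≤ s := by
  have hN := Int.le_ceil s⁻¹
  set N := ⌈s⁻¹⌉
  have hy : |x / s| ≤ N + 1 := by
    rw [abs_div, abs_of_pos hs, div_le_iff₀ hs]
    have : s⁻¹ * s = 1 := inv_mul_cancel₀ hs.ne'
    nlinarith
  suffices h : ∃ m ∈ blockIndices s, |(m : ℝ) - x / s| ≤ 1 by
    obtain ⟨m, hm, h⟩ := h
    refine ⟨m, hm, ?_⟩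
    have e : s * m - x = s * (m - x / s) := by field_simp
    rw [e, abs_mul, abs_of_pos hs]
    exact mul_le_of_le_one_right hs.le h
  have hN0 : 0 < N := Int.ceil_pos.2 (by positivity)
  rw [abs_le] at hy
  have f1 := Int.floor_le (x / s)
  have f2 := Int.lt_floor_add_one (x / s)
  simp only [blockIndices, Finset.mem_Icc]
  rcases lt_or_ge N ⌊x / s⌋ with h | h
  · refine ⟨N, ⟨by omega, le_rfl⟩, ?_⟩
    have h' : (N : ℝ) + 1 ≤ ⌊x / s⌋ := by exact_mod_cast h
    rw [abs_le]; constructor <;> linarith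
  rcases lt_or_ge ⌊x / s⌋ (-N) with h' | h'
  · refine ⟨-N, ⟨le_rfl, by omega⟩, ?_⟩
    have h'' : (⌊x / s⌋ : ℝ) + 1 ≤ -N := by exact_mod_cast h'
    push_cast
    rw [abs_le]; constructor <;> linarith
  · exact ⟨⌊x / s⌋, ⟨h', h⟩, by rw [abs_le]; constructor <;> linarith⟩

/-- The weighted estimate for a pair of dyadic pieces. -/
lemma exists_lintegral_dyadic_le {p : ℝ} (hp : 2 ≤ p) (hp4 : p ≤ 4) :
    ∃ C : ℝ≥0∞, C ≠ ⊤ ∧ ∀ (R : ℝ), 2 ≤ R → ∀ H : Plane → ℝ, AEMeasurable H →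
      (∀ x, H x ∈ Set.Icc (0 : ℝ) 1) → ∀ f : ℤ → Plane → ℂ,
      (∀ m ∈ blockIndices (√R)⁻¹, HasFourierSupportIn (f m) (block (√R)⁻¹ ((√R)⁻¹ * m))) →
      ∀ (i : ℕ) (k d : ℤ), 2 ≤ i → (2 : ℝ) ^ i * (√R)⁻¹ ≤ 32 → 0 ≤ d → d ≤ 3 →
        (i = 2 ∨ 2 ≤ d) →
        ∫⁻ x, ‖(∑ m ∈ dyadicPart (blockIndices (√R)⁻¹) i k, f m x) *
            ∑ m ∈ dyadicPart (blockIndices (√R)⁻¹) i (k + d), f m x‖ₑ ^ (p / 2) *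
              ENNReal.ofReal (H x) ≤
          C * ENNReal.ofReal (kappaSup p H R) ^ p *
            ∫⁻ x, (∑ m ∈ dyadicPart (blockIndices (√R)⁻¹) i k ∪
              dyadicPart (blockIndices (√R)⁻¹) i (k + d), ‖f m x‖ₑ ^ 2) ^ (p / 2) := by
  obtain ⟨C, hC, hpair⟩ := exists_lintegral_pair_le hp hp4
  refine ⟨C, hC, fun R hR H hHm hH f hf i k d hi hil hd0 hd3 hid => ?_⟩
  set r := (√R)⁻¹ with hr
  have hs1 : 1 ≤ √R := Real.one_le_sqrt.2 (by linarith)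
  have hr0 : 0 < r := by positivity
  set A := dyadicPart (blockIndices r) i k with hA
  set B := dyadicPart (blockIndices r) i (k + d) with hB
  rcases A.eq_empty_or_nonempty with h | ⟨m₁, hm₁⟩
  · rw [h]
    simp [ENNReal.zero_rpow_of_pos (by linarith : 0 < p / 2)]
  have hi4 : (4 : ℝ) ≤ 2 ^ i := by
    calc (4 : ℝ) = 2 ^ 2 := by norm_num
      _ ≤ 2 ^ i := pow_le_pow_right₀ (by norm_num) hi
  have hl : r ≤ 2 ^ i * r := by nlinarith
  obtain ⟨s, hs, hls, hsl, -⟩ := exists_scale hR hl hil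
  have hrs : r ≤ s := hs.2
  have hs0 : 0 < s := hr0.trans_le hrs
  have hmem : ∀ (e : ℤ) (m : ℤ), m ∈ dyadicPart (blockIndices r) i e →
      m ∈ blockIndices r ∧ (e : ℝ) * 2 ^ i ≤ m ∧ (m : ℝ) + 1 ≤ (e + 1) * 2 ^ i := by
    intro e m hm
    simp only [dyadicPart, Finset.mem_filter] at hm
    obtain ⟨h1, h2⟩ := hm
    have hpos : (0 : ℤ) < 2 ^ i := by positivity
    have h3 := Int.ediv_mul_le m hpos.ne'
    have h4 := Int.lt_ediv_add_one_mul_self m hpos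
    rw [h2] at h3 h4
    refine ⟨h1, by exact_mod_cast h3, by exact_mod_cast h4⟩
  obtain ⟨hm₁S, hm₁l, hm₁u⟩ := hmem k m₁ hm₁
  have hx : |r * m₁| ≤ 1 + s := by
    rw [blockIndices, Finset.mem_Icc, hr, inv_inv] at hm₁S
    have h1 : |(m₁ : ℝ)| ≤ ⌈√R⌉ := by
      rw [abs_le]; exact ⟨by exact_mod_cast hm₁S.1, by exact_mod_cast hm₁S.2⟩
    have h2 := Int.ceil_lt_add_one √R
    rw [abs_mul, abs_of_pos hr0]
    calc r * |(m₁ : ℝ)| ≤ r * (√R + 1) := by gcongr; linarith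
      _ = 1 + r := by rw [mul_add, hr, inv_mul_cancel₀ (by positivity), mul_one]
      _ ≤ 1 + s := by gcongr
  obtain ⟨m₀, hm₀, hc⟩ := exists_centre hs0 hx
  have hd3' : (d : ℝ) ≤ 3 := by exact_mod_cast hd3
  have hd0' : (0 : ℝ) ≤ d := by exact_mod_cast hd0
  have hpow : (0 : ℝ) < 2 ^ i := by positivity
  -- Indices of the pair span at most four intervals, hence a distance 4 · 2^i r ≤ 128 s from `r *
  -- m₁`; the centre is within another `s`.
  have hAB : ∀ m ∈ A ∪ B, m ∈ blockIndices r ∧ |r * m - s * m₀| ≤ 130 * s := by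
    intro m hm
    have h : m ∈ blockIndices r ∧ (k : ℝ) * 2 ^ i ≤ m ∧ (m : ℝ) ≤ (k + 4) * 2 ^ i := by
      rcases Finset.mem_union.1 hm with h | h
      · obtain ⟨a1, a2, a3⟩ := hmem k m h
        exact ⟨a1, a2, by nlinarith⟩
      · obtain ⟨a1, a2, a3⟩ := hmem (k + d) m h
        push_cast at a2 a3
        exact ⟨a1, by nlinarith, by nlinarith⟩
    refine ⟨h.1, ?_⟩
    have h1 : |(m : ℝ) - m₁| ≤ 4 * 2 ^ i := by
      rw [abs_le]; constructor <;> nlinarith [h.2.1, h.2.2]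
    have h2 : |r * m - r * m₁| ≤ 4 * (2 ^ i * r) := by
      rw [← mul_sub, abs_mul, abs_of_pos hr0]
      calc r * |(m : ℝ) - m₁| ≤ r * (4 * 2 ^ i) := by gcongr
        _ = _ := by ring
    have h3 := abs_sub_le (r * m) (r * m₁) (s * m₀)
    rw [abs_sub_comm (r * m₁ : ℝ)] at h3
    linarith
  refine hpair r s (s * m₀) A B f hr0 hrs (fun m hm => (hAB m hm).2)
    (fun m hm => hf m (hAB m hm).1) ?_ (fun x => ENNReal.ofReal (H x)) hHm.ennreal_ofReal _
    (fun z => lintegral_cell_ne_top hH (by positivity) s (s * m₀) z)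
    (fun z z' => kappaSup_bound (by linarith) hHm hH hp hp4 hs hm₀ z z')
  -- For `i = 2` the interval has length 4r, so `s ≤ 8 * r`. For `d ≥ 2` the index gap is at least
  -- 2^i + 1, and `2 ^ i ≥ 4` together with `s ≤ 2 · 2^i r` gives the required separation.
  rcases hid with rfl | hd
  · left; linarith
  · right
    intro m hm m' hm'
    obtain ⟨-, a2, a3⟩ := hmem k m hm
    obtain ⟨-, b2, b3⟩ := hmem (k + d) m' hm'
    have hd' : (2 : ℝ) ≤ d := by exact_mod_cast hd
    push_cast at b2
    have h1 : (2 : ℝ) ^ i + 1 ≤ m' - m := by nlinarith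
    calc 3 * r + s / 4 ≤ r * (2 ^ i + 1) := by nlinarith
      _ ≤ _ := by gcongr

/-! ### Summation over intervals and levels. -/

lemma sum_rpow_le_rpow_sum {ι : Type*} (K : Finset ι) (x : ι → ℝ≥0∞) {q : ℝ} (hq : 1 ≤ q) :
    ∑ k ∈ K, x k ^ q ≤ (∑ k ∈ K, x k) ^ q := by
  have hsplit : ∀ t : ℝ≥0∞, t ^ q = t * t ^ (q - 1) := by
    intro t
    nth_rewrite 2 [← ENNReal.rpow_one t]
    rw [← ENNReal.rpow_add_of_nonneg _ _ zero_le_one (by linarith), add_sub_cancel]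
  calc ∑ k ∈ K, x k ^ q ≤ ∑ k ∈ K, x k * (∑ k ∈ K, x k) ^ (q - 1) := by
        refine Finset.sum_le_sum fun k hk => ?_
        rw [hsplit]
        gcongr
        exact Finset.single_le_sum (f := x) (fun _ _ => zero_le) hk
    _ = _ := by rw [← Finset.sum_mul, ← hsplit]

lemma sum_dyadicPart_le (S : Finset ℤ) (K : Finset ℤ) (i : ℕ) (d : ℤ) (x : ℤ → ℝ≥0∞) :
    ∑ k ∈ K, ∑ m ∈ dyadicPart S i (k + d), x m ≤ ∑ m ∈ S, x m := by
  have h : ∀ k, dyadicPart S i (k + d) = {m ∈ S | m / 2 ^ i - d = k} := by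
    intro k
    ext m
    simp only [dyadicPart, Finset.mem_filter]
    refine and_congr_right fun _ => ?_
    constructor <;> intro h <;> linarith
  simp_rw [h]
  rw [Finset.sum_fiberwise_eq_sum_filter]
  exact Finset.sum_le_sum_of_subset (Finset.filter_subset _ _)

/-- At a fixed level every index lies in at most two of the unions, so their sums add to at most
twice the full sum; exponents at least one are superadditive. -/
lemma sum_rpow_union_le (S : Finset ℤ) (K : Finset ℤ) (i : ℕ) (d : ℤ) (x : ℤ → ℝ≥0∞) {q : ℝ}
    (hq : 1 ≤ q) :
    ∑ k ∈ K, (∑ m ∈ dyadicPart S i k ∪ dyadicPart S i (k + d), x m) ^ q ≤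
      2 ^ q * (∑ m ∈ S, x m) ^ q := by
  refine (sum_rpow_le_rpow_sum K _ hq).trans ?_
  rw [← ENNReal.mul_rpow_of_nonneg _ _ (by linarith)]
  gcongr
  calc _ ≤ ∑ k ∈ K, (∑ m ∈ dyadicPart S i (k + 0), x m + ∑ m ∈ dyadicPart S i (k + d), x m) := by
        refine Finset.sum_le_sum fun k _ => ?_
        rw [add_zero]
        exact le_self_add.trans_eq Finset.sum_union_inter
    _ ≤ _ := by
        rw [Finset.sum_add_distrib, two_mul]
        exact add_le_add (sum_dyadicPart_le S K i 0 x) (sum_dyadicPart_le S K i d x)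

/-- The pointwise broad-narrow inequality for `p`-th powers. -/
lemma enorm_sum_rpow_le (S : Finset ℤ) (a : ℤ → ℂ) {n : ℕ} (hn : 2 ≤ n)
    (hS : ∀ m ∈ S, -2 ^ n ≤ m ∧ m < 2 ^ n) {p : ℝ} (hp : 2 ≤ p) :
    ‖∑ m ∈ S, a m‖ₑ ^ p ≤ ENNReal.ofReal (Real.exp 2 * (2 * n)) ^ p *
      (∑ k ∈ Finset.Icc (-2 ^ n) (2 ^ n), ‖(∑ m ∈ dyadicPart S 2 k, a m) *
          ∑ m ∈ dyadicPart S 2 (k + 0), a m‖ₑ ^ (p / 2) +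
        ∑ i ∈ Finset.Ico 2 n, ∑ d ∈ ({2, 3} : Finset ℤ), ∑ k ∈ Finset.Icc (-2 ^ n) (2 ^ n),
          ‖(∑ m ∈ dyadicPart S i k, a m) *
            ∑ m ∈ dyadicPart S i (k + d), a m‖ₑ ^ (p / 2)) := by
  set T : ℝ≥0∞ := ∑ k ∈ Finset.Icc (-2 ^ n) (2 ^ n), ‖(∑ m ∈ dyadicPart S 2 k, a m) *
          ∑ m ∈ dyadicPart S 2 (k + 0), a m‖ₑ ^ (p / 2) +
        ∑ i ∈ Finset.Ico 2 n, ∑ d ∈ ({2, 3} : Finset ℤ), ∑ k ∈ Finset.Icc (-2 ^ n) (2 ^ n),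
          ‖(∑ m ∈ dyadicPart S i k, a m) *
            ∑ m ∈ dyadicPart S i (k + d), a m‖ₑ ^ (p / 2) with hT
  have hp0 : 0 < p := by linarith
  have hfin : ∀ x : ℂ, ‖x‖ₑ ^ (p / 2) ≠ ⊤ := fun x =>
    ENNReal.rpow_ne_top_of_nonneg (by positivity) enorm_ne_top
  have hTt : T ≠ ⊤ := by
    refine ENNReal.add_ne_top.2 ⟨ENNReal.sum_ne_top.2 fun k _ => hfin _,
      ENNReal.sum_ne_top.2 fun i _ => ENNReal.sum_ne_top.2 fun d _ =>
        ENNReal.sum_ne_top.2 fun k _ => hfin _⟩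
  have hempty : ∀ i k, k ∉ Finset.Icc (-2 ^ n : ℤ) (2 ^ n) → dyadicPart S i k = ∅ := by
    intro i k hk
    refine Finset.filter_eq_empty_iff.2 fun m hm h => hk ?_
    obtain ⟨h1, h2⟩ := hS m hm
    have hpos : (0 : ℤ) < 2 ^ i := by positivity
    have hone : (1 : ℤ) ≤ 2 ^ i := hpos
    have hn0 : (0 : ℤ) < 2 ^ n := by positivity
    rw [← h, Finset.mem_Icc]
    constructor
    · rw [Int.le_ediv_iff_mul_le hpos]; nlinarith
    · refine (Int.ediv_lt_of_lt_mul hpos ?_).le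
      nlinarith
  -- The maximum over all pieces and pairs is replaced by a sum: every term is at most `T`, so each
  -- product has modulus at most T^{2/p} = B². Intervals outside the range of summation are empty.
  set B : ℝ := T.toReal ^ (1 / p) with hB
  have hB0 : 0 ≤ B := by positivity
  have hterm : ∀ x : ℂ, ‖x‖ₑ ^ (p / 2) ≤ T → ‖x‖ ≤ B ^ 2 := by
    intro x hx
    have h1 := ENNReal.toReal_mono hTt hx
    rw [← ENNReal.toReal_rpow, toReal_enorm] at h1
    have h2 := Real.rpow_le_rpow (by positivity) h1 (by positivity : 0 ≤ 2 / p)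
    rw [← Real.rpow_mul (norm_nonneg _), div_mul_div_cancel₀ (by norm_num), div_self hp0.ne',
      Real.rpow_one] at h2
    rw [hB, ← Real.rpow_natCast, ← Real.rpow_mul ENNReal.toReal_nonneg]
    convert h2 using 2
    push_cast; ring
  have hbase : ∀ k, ‖∑ m ∈ dyadicPart S 2 k, a m‖ ≤ B := by
    intro k
    by_cases hk : k ∈ Finset.Icc (-2 ^ n : ℤ) (2 ^ n)
    · have h1 := hterm ((∑ m ∈ dyadicPart S 2 k, a m) * ∑ m ∈ dyadicPart S 2 (k + 0), a m)
        (le_trans (Finset.single_le_sum (f := fun k => ‖(∑ m ∈ dyadicPart S 2 k, a m) *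
          ∑ m ∈ dyadicPart S 2 (k + 0), a m‖ₑ ^ (p / 2)) (fun _ _ => zero_le) hk) le_self_add)
      rw [add_zero, norm_mul, ← pow_two] at h1
      exact (pow_le_pow_iff_left₀ (norm_nonneg _) hB0 two_ne_zero).1 h1
    · rw [hempty 2 k hk, Finset.sum_empty, norm_zero]; exact hB0
  have hbroad : ∀ i, 2 ≤ i → i < n → ∀ k, ∀ d ∈ ({2, 3} : Finset ℤ),
      ‖(∑ m ∈ dyadicPart S i k, a m) * ∑ m ∈ dyadicPart S i (k + d), a m‖ ≤ B ^ 2 := by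
    intro i hi hin k d hd
    by_cases hk : k ∈ Finset.Icc (-2 ^ n : ℤ) (2 ^ n)
    · refine hterm _ ?_
      refine le_trans ?_ (le_add_self (a := ∑ i ∈ Finset.Ico 2 n, ∑ d ∈ ({2, 3} : Finset ℤ),
        ∑ k ∈ Finset.Icc (-2 ^ n) (2 ^ n), ‖(∑ m ∈ dyadicPart S i k, a m) *
            ∑ m ∈ dyadicPart S i (k + d), a m‖ₑ ^ (p / 2)))
      refine le_trans ?_ (Finset.single_le_sum (f := fun i => ∑ d ∈ ({2, 3} : Finset ℤ),
        ∑ k ∈ Finset.Icc (-2 ^ n) (2 ^ n), ‖(∑ m ∈ dyadicPart S i k, a m) *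
            ∑ m ∈ dyadicPart S i (k + d), a m‖ₑ ^ (p / 2)) (fun _ _ => zero_le)
        (Finset.mem_Ico.2 ⟨hi, hin⟩))
      refine le_trans ?_ (Finset.single_le_sum (f := fun d =>
        ∑ k ∈ Finset.Icc (-2 ^ n) (2 ^ n), ‖(∑ m ∈ dyadicPart S i k, a m) *
            ∑ m ∈ dyadicPart S i (k + d), a m‖ₑ ^ (p / 2)) (fun _ _ => zero_le) hd)
      exact Finset.single_le_sum (f := fun k => ‖(∑ m ∈ dyadicPart S i k, a m) *
            ∑ m ∈ dyadicPart S i (k + d), a m‖ₑ ^ (p / 2)) (fun _ _ => zero_le) hk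
    · rw [hempty i k hk, Finset.sum_empty, zero_mul, norm_zero]; positivity
  have h := norm_sum_le_broad_narrow S a hn hS hB0 hbase hbroad
  have h1 := ENNReal.ofReal_le_ofReal h
  rw [ofReal_norm, ENNReal.ofReal_mul (by positivity)] at h1
  refine (ENNReal.rpow_le_rpow h1 hp0.le).trans_eq ?_
  rw [ENNReal.mul_rpow_of_nonneg _ _ hp0.le, ENNReal.ofReal_rpow_of_nonneg hB0 hp0.le, hB,
    ← Real.rpow_mul ENNReal.toReal_nonneg, one_div_mul_cancel hp0.ne', Real.rpow_one,
    ENNReal.ofReal_toReal hTt]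

lemma enorm_squareFunction_rpow (R : ℝ) (f : ℤ → Plane → ℂ) (p : ℝ) (x : Plane) :
    ‖squareFunction R f x‖ₑ ^ p = (∑ m ∈ blockIndices (√R)⁻¹, ‖f m x‖ₑ ^ 2) ^ (p / 2) := by
  have hsum : ∑ m ∈ blockIndices (√R)⁻¹, ‖f m x‖ₑ ^ 2 =
      ENNReal.ofReal (∑ m ∈ blockIndices (√R)⁻¹, ‖f m x‖ ^ 2) := by
    rw [ENNReal.ofReal_sum_of_nonneg fun _ _ => by positivity]
    refine Finset.sum_congr rfl fun m _ => ?_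
    rw [ENNReal.ofReal_pow (norm_nonneg _), ofReal_norm]
  have h0 : 0 ≤ ∑ m ∈ blockIndices (√R)⁻¹, ‖f m x‖ ^ 2 :=
    Finset.sum_nonneg fun _ _ => by positivity
  rw [hsum, squareFunction, Real.enorm_of_nonneg (Real.sqrt_nonneg _), Real.sqrt_eq_rpow,
    ← ENNReal.ofReal_rpow_of_nonneg h0 (by norm_num), ← ENNReal.rpow_mul]
  congr 1; ring

/-- The weighted square function estimate for `p`-th powers. -/
lemma exists_lintegral_rpow_le {p : ℝ} (hp : 2 ≤ p) (hp4 : p ≤ 4) :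
    ∃ C : ℝ≥0∞, C ≠ ⊤ ∧ ∀ (R : ℝ), 2 ≤ R → ∀ H : Plane → ℝ, AEMeasurable H →
      (∀ x, H x ∈ Set.Icc (0 : ℝ) 1) → ∀ f : ℤ → Plane → ℂ,
      (∀ m ∈ blockIndices (√R)⁻¹, HasFourierSupportIn (f m) (block (√R)⁻¹ ((√R)⁻¹ * m))) →
      ∃ n : ℕ, (n : ℝ) ≤ 9 * Real.log R ∧
        ∫⁻ x, ‖∑ m ∈ blockIndices (√R)⁻¹, f m x‖ₑ ^ p * ENNReal.ofReal (H x) ≤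
          ENNReal.ofReal (Real.exp 2 * (2 * n)) ^ p * ((1 + 2 * n : ℕ) *
            (C * ENNReal.ofReal (kappaSup p H R) ^ p *
              ∫⁻ x, ‖squareFunction R f x‖ₑ ^ p)) := by
  obtain ⟨C, hC, hdy⟩ := exists_lintegral_dyadic_le hp hp4
  refine ⟨C * 2 ^ (p / 2), ENNReal.mul_ne_top hC (ENNReal.rpow_ne_top_of_nonneg (by linarith)
    (by norm_num)), fun R hR H hHm hH f hf => ?_⟩
  obtain ⟨n, hn2, hn, hn32, hnlog⟩ := exists_levels hR
  refine ⟨n, hnlog, ?_⟩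
  have hp0 : 0 < p := by linarith
  set S := blockIndices (√R)⁻¹ with hSdef
  set κ := ENNReal.ofReal (kappaSup p H R) with hκ
  have hS : ∀ m ∈ S, -2 ^ n ≤ m ∧ m < 2 ^ n := by
    intro m hm
    rw [hSdef, blockIndices, Finset.mem_Icc, inv_inv] at hm
    constructor <;> linarith [hm.1, hm.2]
  have hfm : ∀ m ∈ S, AEMeasurable (f m) :=
    fun m hm => (hf m hm).1.aestronglyMeasurable.aemeasurable
  have hpart : ∀ i k, AEMeasurable fun x => ∑ m ∈ dyadicPart S i k, f m x := fun i k =>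
    Finset.aemeasurable_fun_sum _ fun m hm => hfm m (Finset.mem_filter.1 hm).1
  have hHm' : AEMeasurable fun x => ENNReal.ofReal (H x) := hHm.ennreal_ofReal
  have hg : ∀ i k d, AEMeasurable fun x => ‖(∑ m ∈ dyadicPart S i k, f m x) *
      ∑ m ∈ dyadicPart S i (k + d), f m x‖ₑ ^ (p / 2) * ENNReal.ofReal (H x) := fun i k d =>
    (((hpart i k).fun_mul (hpart i (k + d))).enorm.pow_const _).fun_mul hHm'
  set J := ∫⁻ x, ‖squareFunction R f x‖ₑ ^ p with hJ
  have hlevel : ∀ i d, 2 ≤ i → (2 : ℝ) ^ i * (√R)⁻¹ ≤ 32 → 0 ≤ d → d ≤ 3 → (i = 2 ∨ 2 ≤ d) →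
      ∑ k ∈ Finset.Icc (-2 ^ n) (2 ^ n), ∫⁻ x, ‖(∑ m ∈ dyadicPart S i k, f m x) *
        ∑ m ∈ dyadicPart S i (k + d), f m x‖ₑ ^ (p / 2) * ENNReal.ofReal (H x) ≤
        C * 2 ^ (p / 2) * κ ^ p * J := by
    intro i d hi hi32 hd0 hd3 hid
    calc _ ≤ ∑ k ∈ Finset.Icc (-2 ^ n) (2 ^ n), C * κ ^ p *
          ∫⁻ x, (∑ m ∈ dyadicPart S i k ∪ dyadicPart S i (k + d), ‖f m x‖ₑ ^ 2) ^ (p / 2) :=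
          Finset.sum_le_sum fun k _ => hdy R hR H hHm hH f hf i k d hi hi32 hd0 hd3 hid
      _ = C * κ ^ p * ∫⁻ x, ∑ k ∈ Finset.Icc (-2 ^ n) (2 ^ n),
          (∑ m ∈ dyadicPart S i k ∪ dyadicPart S i (k + d), ‖f m x‖ₑ ^ 2) ^ (p / 2) := by
          rw [← Finset.mul_sum, lintegral_finsetSum']
          intro k _
          refine (Finset.aemeasurable_fun_sum _ fun m hm => ?_).pow_const _
          refine (hfm m ?_).enorm.pow_const 2
          rcases Finset.mem_union.1 hm with h | h <;> exact (Finset.mem_filter.1 h).1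
      _ ≤ C * κ ^ p * ∫⁻ x, 2 ^ (p / 2) * ‖squareFunction R f x‖ₑ ^ p := by
          gcongr with x
          rw [enorm_squareFunction_rpow]
          exact sum_rpow_union_le S _ i d _ (by linarith)
      _ = _ := by
          rw [lintegral_const_mul' _ _ (ENNReal.rpow_ne_top_of_nonneg (by linarith)
            (by norm_num))]
          ring
  have hpow32 : ∀ i ≤ n, (2 : ℝ) ^ i * (√R)⁻¹ ≤ 32 := fun i hi =>
    le_trans (by gcongr; norm_num) hn32
  calc _ ≤ ∫⁻ x, ENNReal.ofReal (Real.exp 2 * (2 * n)) ^ p *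
        (∑ k ∈ Finset.Icc (-2 ^ n) (2 ^ n), ‖(∑ m ∈ dyadicPart S 2 k, f m x) *
          ∑ m ∈ dyadicPart S 2 (k + 0), f m x‖ₑ ^ (p / 2) * ENNReal.ofReal (H x) +
        ∑ i ∈ Finset.Ico 2 n, ∑ d ∈ ({2, 3} : Finset ℤ), ∑ k ∈ Finset.Icc (-2 ^ n) (2 ^ n),
          ‖(∑ m ∈ dyadicPart S i k, f m x) *
            ∑ m ∈ dyadicPart S i (k + d), f m x‖ₑ ^ (p / 2) * ENNReal.ofReal (H x)) := by
        refine lintegral_mono fun x => ?_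
        simp only [← Finset.sum_mul, ← add_mul]
        rw [← mul_assoc]
        gcongr
        exact enorm_sum_rpow_le S (fun m => f m x) hn2 hS hp
    _ = ENNReal.ofReal (Real.exp 2 * (2 * n)) ^ p *
        ((∑ k ∈ Finset.Icc (-2 ^ n) (2 ^ n), ∫⁻ x, ‖(∑ m ∈ dyadicPart S 2 k, f m x) *
          ∑ m ∈ dyadicPart S 2 (k + 0), f m x‖ₑ ^ (p / 2) * ENNReal.ofReal (H x)) +
        ∑ i ∈ Finset.Ico 2 n, ∑ d ∈ ({2, 3} : Finset ℤ), ∑ k ∈ Finset.Icc (-2 ^ n) (2 ^ n),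
          ∫⁻ x, ‖(∑ m ∈ dyadicPart S i k, f m x) *
            ∑ m ∈ dyadicPart S i (k + d), f m x‖ₑ ^ (p / 2) * ENNReal.ofReal (H x)) := by
        rw [lintegral_const_mul' _ _ (ENNReal.rpow_ne_top_of_nonneg hp0.le ENNReal.ofReal_ne_top),
          lintegral_add_left' (Finset.aemeasurable_fun_sum _ fun k _ => hg 2 k 0),
          lintegral_finsetSum' _ fun k _ => hg 2 k 0,
          lintegral_finsetSum' _ fun i _ => Finset.aemeasurable_fun_sum _ fun d _ =>
            Finset.aemeasurable_fun_sum _ fun k _ => hg i k d]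
        congr 2
        refine Finset.sum_congr rfl fun i _ => ?_
        rw [lintegral_finsetSum' _ fun d _ => Finset.aemeasurable_fun_sum _ fun k _ => hg i k d]
        refine Finset.sum_congr rfl fun d _ => ?_
        rw [lintegral_finsetSum' _ fun k _ => hg i k d]
    _ ≤ ENNReal.ofReal (Real.exp 2 * (2 * n)) ^ p * (C * 2 ^ (p / 2) * κ ^ p * J +
        ∑ i ∈ Finset.Ico 2 n, ∑ d ∈ ({2, 3} : Finset ℤ), C * 2 ^ (p / 2) * κ ^ p * J) := by
        gcongr with i hi d hd
        · exact hlevel 2 0 le_rfl (hpow32 2 hn2) le_rfl (by norm_num) (Or.inl rfl)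
        · rw [Finset.mem_Ico] at hi
          have hd' : d = 2 ∨ d = 3 := by simpa using hd
          exact hlevel i d hi.1 (hpow32 i hi.2.le) (by omega) (by omega) (Or.inr (by omega))
    _ ≤ _ := by
        gcongr
        -- One contribution from the smallest intervals and two distances at each of the n - 2 broad
        -- levels, all with the same bound.
        set Y := C * 2 ^ (p / 2) * κ ^ p * J
        have hcard : ({2, 3} : Finset ℤ).card = 2 := by decide
        rw [Finset.sum_const, Finset.sum_const, hcard, Nat.card_Ico, smul_smul, nsmul_eq_mul]
        have hn' : (n - 2) * 2 ≤ 2 * n := by omega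
        calc Y + ((n - 2) * 2 : ℕ) * Y ≤ Y + (2 * n : ℕ) * Y :=
              add_le_add le_rfl (mul_le_mul_left (Nat.cast_le.2 hn') Y)
          _ = _ := by push_cast; ring

lemma kappaSup_nonneg {p : ℝ} {H : Plane → ℝ} (hH : ∀ x, 0 ≤ H x) (R : ℝ) :
    0 ≤ kappaSup p H R := by
  refine Real.sSup_nonneg ?_
  rintro _ ⟨s, _, m, _, U, _, rfl⟩
  refine Real.iSup_nonneg fun T => mul_nonneg (Real.rpow_nonneg ?_ _) (Real.rpow_nonneg ?_ _)
  · exact div_nonneg (integral_nonneg hH) measureReal_nonneg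
  · exact div_nonneg (integral_nonneg hH) measureReal_nonneg

lemma eLpNorm_ofReal_eq {E : Type*} [NormedAddCommGroup E] {p : ℝ} (hp : 0 < p) (g : Plane → E)
    (μ : Measure Plane) :
    eLpNorm g (ENNReal.ofReal p) μ = (∫⁻ x, ‖g x‖ₑ ^ p ∂μ) ^ (1 / p) := by
  rw [eLpNorm_eq_lintegral_rpow_enorm_toReal (by simpa using hp) ENNReal.ofReal_ne_top,
    ENNReal.toReal_ofReal hp.le]

/-- The logarithmic losses of the dyadic decomposition with `n` levels. -/
lemma levels_loss_le {n : ℕ} {R p : ℝ} (hR : 2 ≤ R) (hn : (n : ℝ) ≤ 9 * Real.log R)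
    (hp : 1 ≤ p) :
    ENNReal.ofReal (Real.exp 2 * (2 * n)) * ((1 + 2 * n : ℕ) : ℝ≥0∞) ^ (1 / p) ≤
      ENNReal.ofReal (360 * Real.exp 2 * Real.log R ^ 2) := by
  have hlog : 1 / 2 ≤ Real.log R :=
    le_trans (by linarith [Real.log_two_gt_d9]) (Real.log_le_log (by norm_num) hR)
  have h1 : ((1 + 2 * n : ℕ) : ℝ≥0∞) ^ (1 / p) ≤ ENNReal.ofReal (20 * Real.log R) := by
    calc ((1 + 2 * n : ℕ) : ℝ≥0∞) ^ (1 / p) ≤ ((1 + 2 * n : ℕ) : ℝ≥0∞) ^ (1 : ℝ) :=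
          ENNReal.rpow_le_rpow_of_exponent_le (by exact_mod_cast Nat.le_add_right 1 _)
            (by rw [div_le_one (by linarith)]; exact hp)
      _ = ENNReal.ofReal ((1 + 2 * n : ℕ) : ℝ) := by
          rw [ENNReal.rpow_one, ENNReal.ofReal_natCast]
      _ ≤ _ := ENNReal.ofReal_le_ofReal (by push_cast; linarith)
  calc _ ≤ ENNReal.ofReal (Real.exp 2 * (2 * (9 * Real.log R))) *
        ENNReal.ofReal (20 * Real.log R) := by gcongr
    _ = _ := by
        rw [← ENNReal.ofReal_mul (by positivity)]
        congr 1; ring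

end WeightedSquare

/-! ### Assembly of the theorem. -/

open WeightedSquare

theorem mainTheorem2 :
    ∃ A : ℕ, ∀ p : ℝ, 2 ≤ p → p ≤ 4 → ∃ C : ℝ, 0 < C ∧
      ∀ R : ℝ, 2 ≤ R →
      ∀ H : WeightedSquare.Plane → ℝ, AEMeasurable H volume → (∀ x, H x ∈ Set.Icc (0 : ℝ) 1) →
      ∀ f : WeightedSquare.Plane → ℂ,
        WeightedSquare.HasFourierSupportIn f (WeightedSquare.parabolaNhd R⁻¹) →
      ∀ fθ : ℤ → WeightedSquare.Plane → ℂ, WeightedSquare.IsBlockDecomposition R f fθ →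
        eLpNorm f (ENNReal.ofReal p) (volume.withDensity fun x => ENNReal.ofReal (H x)) ≤
          ENNReal.ofReal
              (C * Real.log R ^ A * (WeightedSquare.kappaSup p H R + (R ^ 100)⁻¹)) *
            eLpNorm (WeightedSquare.squareFunction R fθ) (ENNReal.ofReal p) volume := by
  -- One logarithm comes from the broad-narrow inequality and one from the number of levels, whose
  -- 1/p-th power is bounded by its first power.
  refine ⟨2, fun p hp hp4 => ?_⟩
  have hp0 : 0 < p := by linarith
  obtain ⟨C, hC, hmain⟩ := exists_lintegral_rpow_le hp hp4
  set D : ℝ≥0∞ := C ^ (1 / p) with hD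
  have hDt : D ≠ ⊤ := ENNReal.rpow_ne_top_of_nonneg (by positivity) hC
  refine ⟨360 * Real.exp 2 * (D.toReal + 1), by positivity, fun R hR H hHm hH f _ fθ hf => ?_⟩
  obtain ⟨n, hn, hle⟩ := hmain R hR H hHm hH fθ hf.1
  have hκ : 0 ≤ kappaSup p H R := kappaSup_nonneg (fun x => (hH x).1) R
  set κ := kappaSup p H R
  set J := ∫⁻ x, ‖squareFunction R fθ x‖ₑ ^ p with hJ
  have hsum : AEMeasurable fun x => ∑ m ∈ blockIndices (√R)⁻¹, fθ m x :=
    Finset.aemeasurable_fun_sum _ fun m hm => (hf.1 m hm).1.aestronglyMeasurable.aemeasurable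
  have hfm : AEMeasurable f := hsum.congr (hf.2.mono fun x hx => hx.symm)
  have h_int : ∫⁻ x, ‖f x‖ₑ ^ p ∂(volume.withDensity fun x => ENNReal.ofReal (H x)) =
      ∫⁻ x, ‖∑ m ∈ blockIndices (√R)⁻¹, fθ m x‖ₑ ^ p * ENNReal.ofReal (H x) := by
    have hd : AEMeasurable fun x => ENNReal.ofReal (H x) := hHm.ennreal_ofReal
    rw [lintegral_withDensity_eq_lintegral_mul₀ hd (hfm.enorm.pow_const p)]
    refine lintegral_congr_ae (hf.2.mono fun x hx => ?_)
    simp only [Pi.mul_apply, hx, mul_comm]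
  rw [eLpNorm_ofReal_eq hp0, eLpNorm_ofReal_eq hp0, h_int, ← hJ]
  have hinv : (0 : ℝ) ≤ 1 / p := by positivity
  calc _ ≤ (ENNReal.ofReal (Real.exp 2 * (2 * n)) ^ p * ((1 + 2 * n : ℕ) *
        (C * ENNReal.ofReal κ ^ p * J))) ^ (1 / p) := ENNReal.rpow_le_rpow hle hinv
    _ = (ENNReal.ofReal (Real.exp 2 * (2 * n)) * ((1 + 2 * n : ℕ) : ℝ≥0∞) ^ (1 / p)) *
        (D * ENNReal.ofReal κ) * J ^ (1 / p) := by
        simp only [ENNReal.mul_rpow_of_nonneg _ _ hinv, ← ENNReal.rpow_mul,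
          mul_one_div_cancel hp0.ne', ENNReal.rpow_one]
        ring
    _ ≤ ENNReal.ofReal (360 * Real.exp 2 * Real.log R ^ 2) *
        (ENNReal.ofReal (D.toReal + 1) * ENNReal.ofReal (κ + (R ^ 100)⁻¹)) * J ^ (1 / p) := by
        gcongr
        · exact levels_loss_le hR hn (by linarith)
        · rw [← ENNReal.ofReal_toReal hDt]
          refine ENNReal.ofReal_le_ofReal ?_
          rw [ENNReal.toReal_ofReal ENNReal.toReal_nonneg]; linarith
        -- The estimate already holds with the supremum alone; the nonnegative additional term only
        -- enlarges the right side.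
        · have : (0 : ℝ) ≤ (R ^ 100)⁻¹ := by positivity
          linarith
    _ = _ := by
        rw [← ENNReal.ofReal_mul (by positivity), ← ENNReal.ofReal_mul (by positivity)]
        congr 2; ring
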